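/- Let $T:\mathbb{R}^d\to[0,\infty)$ be measurable, $p=-i\nabla$, and let $T(p)$ be the Fourier multiplier with symbol $T$ on $L^2(\mathbb{R}^d)$, with form domain $\mathcal{Q}(T(p))$. A potential is a measurable function $V:\mathbb{R}^d\to\mathbb{R}$; it is called relatively form compact (with respect to $T(p)$) if $(T(p)+1)^{-1/2}|V|(T(p)+1)^{-1/2}$ is a compact operator on $L^2(\mathbb{R}^d)$. For such $V$ let $T(p)+V$ be the self-adjoint operator defined as the sum of quadratic forms on $\mathcal{Q}(T(p))$, and let $N(T(p)+V)$ be the number of its strictly negative eigenvalues, counted with multiplicity. "$V\neq 0$" means that $V$ is not almost everywhere zero. Write $V_-=\max(0,-V)$, $1/0=\infty$, and $$G(u)=u\int_{\{T<u\}}\frac{1}{T(\eta)}\,\frac{d\eta}{(2\pi)^d},\qquad u\in[0,\infty].$$ Let $Z=\{T=0\}$ and, for $\delta>0$, $Z_\delta=\{\eta:\operatorname{dist}(\eta,Z)\le\delta\}$ (with $Z_\delta=\emptyset$ if $Z=\emptyset$), $Z_\delta^c=\mathbb{R}^d\setminus Z_\delta$. Assume that $Z$ is compact, that for every $\delta>0$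 there is $u>0$ with $$\int_{\{T<u\}\cap Z_\delta^c}\frac{1}{T(\eta)}\,d\eta<\infty ,$$ and that there is at least one relatively form compact potential $V\neq0$ (this is the case, for instance, if $T(\eta)\to\infty$ as $|\eta|\to\infty$, or if all sets $\{T<u\}$, $0<u<\infty$, have finite Lebesgue measure). Then: (a) The condition $$\int_{Z_\delta}\frac{1}{T(\eta)}\,d\eta=\infty\quad\text{for some }\delta>0 \tag{1}$$ holds if and only if for every relatively form compact potential $V\le 0$, $V\neq0$, the operator $T(p)+V$ has at least one strictly negative eigenvalue. Moreover, if $T$ is in addition locally bounded, then (1) holds if and only if for every relatively form compact $V\in L^1(\mathbb{R}^d)$ with $V\ne0$ and $\int V\,dx\le0$ the operator $T(p)+V$ has at least one strictly negative eigenvalue. (b) The condition $$\int_{Z_\delta}\frac{1}{T(\eta)}\,d\eta<\infty\quad\text{for some }\delta>0 \tag{2}$$ holds if and only if there is a measurable function $G_0:[0,\infty]\to[0,\infty]$ with $G_0(u)<\infty$ for all sufficiently small $u>0$ and $\lim_{u\to0+}G_0(u)=0$ such that for every relatively form compact potential $V$ $$N(T(p)+V)\le\int_{\mathbb{R}^d}G_0(V_-(x))\,dx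 .$$ Moreover, if (2) holds, then for every $0<\alpha<\tfrac14$ one can take $G_0(u)=\frac{\alpha^2}{(1-4\alpha)^2}\,G(u/\alpha^2)$. -/

import Mathlib

open MeasureTheory Set Filter Topology
open scoped ENNReal NNReal FourierTransform ComplexConjugate

noncomputable section

/-- Momentum (and position) space `ℝ^d` with its Euclidean norm. -/
abbrev RSpace (d : ℕ) : Type := EuclideanSpace ℝ (Fin d)

/-- The Hilbert space `L²(ℝ^d; ℂ)`. -/
abbrev L2 (d : ℕ) : Type := Lp ℂ 2 (volume : Measure (RSpace d))

/-- The zero set `Z = {T = 0}` of the kinetic energy symbol. -/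
def zeroSet {d : ℕ} (T : RSpace d → ℝ≥0) : Set (RSpace d) := {η | T η = 0}

/-- `∫_A T(η)⁻¹ dη` as a value in `[0, ∞]`, with `0⁻¹ = ∞`. -/
def intInv {d : ℕ} (T : RSpace d → ℝ≥0) (A : Set (RSpace d)) : ℝ≥0∞ :=
  ∫⁻ η in A, (T η : ℝ≥0∞)⁻¹

/-- `G(u) = u ∫_{T < u} T(η)⁻¹ dη / (2π)^d`, for `u ∈ [0, ∞]`. -/
def bigG {d : ℕ} (T : RSpace d → ℝ≥0) (u : ℝ≥0∞) : ℝ≥0∞ :=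
  u * (intInv T {η | (T η : ℝ≥0∞) < u} / ENNReal.ofReal ((2 * Real.pi) ^ d))

/-- The form domain `Q(T(p))`. Mathlib's Fourier transform `𝓕` has the kernel `exp (-2πi ⟨ξ, x⟩)`,
so that `p = -i∇` acts on the `𝓕` side as multiplication by `2πξ`, and `T(p)` as multiplication
by `T(2πξ)`. Hence `ψ ∈ Q(T(p))` iff `∫ T(2πξ) |𝓕ψ(ξ)|² dξ < ∞`. -/
def kinFormDomain {d : ℕ} (T : RSpace d → ℝ≥0) : Set (L2 d) :=
  {ψ | ∫⁻ ξ, (T ((2 * Real.pi) • ξ) : ℝ≥0∞) * ‖(𝓕 ψ : L2 d) ξ‖ₑ ^ 2 < ∞}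

/-- The sesquilinear form `⟨φ, T(p) ψ⟩` of the kinetic energy. -/
def kinForm {d : ℕ} (T : RSpace d → ℝ≥0) (φ ψ : L2 d) : ℂ :=
  ∫ ξ, ((T ((2 * Real.pi) • ξ) : ℝ) : ℂ) * (conj ((𝓕 φ : L2 d) ξ) * (𝓕 ψ : L2 d) ξ)

/-- The sesquilinear form `⟨φ, V ψ⟩ = ∫ V(x) conj(φ(x)) ψ(x) dx` of the potential. -/
def potForm {d : ℕ} (V : RSpace d → ℝ) (φ ψ : L2 d) : ℂ :=
  ∫ x, (V x : ℂ) * (conj (φ x) * ψ x)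

/-- `φ = (T(p) + 1)^{-1/2} f`, that is `𝓕φ(ξ) = (T(2πξ) + 1)^{-1/2} 𝓕f(ξ)` for almost all `ξ`. -/
def IsInvSqrtApply {d : ℕ} (T : RSpace d → ℝ≥0) (f φ : L2 d) : Prop :=
  ∀ᵐ ξ, (𝓕 φ : L2 d) ξ =
    (((Real.sqrt ((T ((2 * Real.pi) • ξ) : ℝ) + 1))⁻¹ : ℝ) : ℂ) * (𝓕 f : L2 d) ξ

/-- `V` is relatively form compact with respect to `T(p)`:
`(T(p) + 1)^{-1/2} |V| (T(p) + 1)^{-1/2}` is (well defined in the form sense and) a compact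
operator `K` on `L²(ℝ^d)`, i.e. for `φ = (T(p) + 1)^{-1/2} f` and `ψ = (T(p) + 1)^{-1/2} g` the
integral defining `⟨φ, |V| ψ⟩` converges absolutely and `⟨f, K g⟩ = ⟨φ, |V| ψ⟩`.
As `Q(T(p))` is the range of `(T(p) + 1)^{-1/2}`, this contains `Q(T(p)) ⊆ Q(V)`. -/
def RelFormCompact {d : ℕ} (T : RSpace d → ℝ≥0) (V : RSpace d → ℝ) : Prop :=
  ∃ K : L2 d →L[ℂ] L2 d, IsCompactOperator K ∧
    ∀ f g φ ψ : L2 d, IsInvSqrtApply T f φ → IsInvSqrtApply T g ψ →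
      Integrable (fun x => |V x| * (‖φ x‖ * ‖ψ x‖)) ∧
      inner ℂ f (K g) = potForm (fun x => |V x|) φ ψ

/-- The graph of the operator `H = T(p) + V`, the self-adjoint operator associated with the
quadratic form `⟨ψ, T(p) ψ⟩ + ⟨ψ, V ψ⟩` with form domain `Q(T(p))`: by definition, `ψ ∈ D(H)` and
`H ψ = χ` iff `ψ ∈ Q(T(p))` and `⟨φ, T(p) ψ⟩ + ⟨φ, V ψ⟩ = ⟨φ, χ⟩` for all `φ ∈ Q(T(p))`. -/
def OpApply {d : ℕ} (T : RSpace d → ℝ≥0) (V : RSpace d → ℝ) (ψ χ : L2 d) : Prop :=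
  ψ ∈ kinFormDomain T ∧ ∀ φ ∈ kinFormDomain T, kinForm T φ ψ + potForm V φ ψ = inner ℂ φ χ

/-- `E` is an eigenvalue of `T(p) + V`. -/
def IsOpEigenvalue {d : ℕ} (T : RSpace d → ℝ≥0) (V : RSpace d → ℝ) (E : ℝ) : Prop :=
  ∃ ψ : L2 d, ψ ≠ 0 ∧ OpApply T V ψ ((E : ℂ) • ψ)

/-- `T(p) + V` has at least one strictly negative eigenvalue. -/
def HasNegEigenvalue {d : ℕ} (T : RSpace d → ℝ≥0) (V : RSpace d → ℝ) : Prop :=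
  ∃ E : ℝ, E < 0 ∧ IsOpEigenvalue T V E

/-- The multiplicity of `E` as an eigenvalue of `T(p) + V`: the dimension of the eigenspace
`{ψ | H ψ = E ψ}` (which is a subspace, so that taking its span changes nothing). -/
def eigMult {d : ℕ} (T : RSpace d → ℝ≥0) (V : RSpace d → ℝ) (E : ℝ) : ℕ∞ :=
  Cardinal.toENat (Module.rank ℂ (Submodule.span ℂ {ψ : L2 d | OpApply T V ψ ((E : ℂ) • ψ)}))

/-- `N(T(p) + V)`: the number of strictly negative eigenvalues, counted with multiplicity. -/
def numNegEig {d : ℕ} (T : RSpace d → ℝ≥0) (V : RSpace d → ℝ) : ℝ≥0∞ :=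
  ∑' E : Set.Iio (0 : ℝ), (eigMult T V E : ℝ≥0∞)

/-- `V` is not the zero function (as a function defined almost everywhere). -/
def NonTrivial {d : ℕ} (V : RSpace d → ℝ) : Prop := ¬ (∀ᵐ x, V x = 0)

/-- `G₀` gives a quantitative bound on the number of strictly negative eigenvalues of `T(p) + V`,
for all relatively form compact potentials `V`. -/
def IsQuantBound {d : ℕ} (T : RSpace d → ℝ≥0) (G₀ : ℝ≥0∞ → ℝ≥0∞) : Prop :=
  Measurable G₀ ∧
  (∃ u₀ : ℝ≥0∞, 0 < u₀ ∧ ∀ u, 0 < u → u < u₀ → G₀ u < ∞) ∧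
  Tendsto G₀ (𝓝[>] 0) (𝓝 0) ∧
  ∀ V : RSpace d → ℝ, Measurable V → RelFormCompact T V →
    numNegEig T V ≤ ∫⁻ x, G₀ (ENNReal.ofReal (max 0 (-V x)))

end

/-! Reduction to bounded operators. Put R = (T(p)+1)^{-1/2}, an injective contraction whose range is
the form domain. With ψ = R f, the form of T(p)+V at ψ becomes ‖f‖² - ‖R f‖² + ⟨f, K f⟩ with K
compact (`kinForm_eq`, `RelFormCompact.exists_compact`). If it is negative at one vector, there is a
negative eigenvalue: for e > 0 the operator 1 - R†R + e R†R is coercive and K is weakly continuous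
on bounded sets, so the bottom of the spectrum is attained (`exists_ground_state`,
`hasNegEigenvalue_of_neg`).

Divergent case. Since Z is compact, ∫ 1/T diverges on every ball around some point. Truncations of
1/T on shrinking balls, normalized to mass one, are the Fourier transforms of functions ψ_n whose
kinetic energies tend to 0 while ψ_n tends pointwise to a plane wave, of modulus one
(`exists_planeWave_seq`). If V ≤ 0 and no eigenvalue were negative, Fatou would give ∫ |V| = 0. If
only ∫ V ≤ 0 is known, then t φ is added to ψ_n, where φ is correlated with V along the plane wave:
the gain is of order t, the cost of order t². Local boundedness of T puts φ into the form domain.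

Convergent case. This is Cwikel's argument (`card_le_of_orthonormal`). On the span of eigenfunctions
with negative eigenvalues, ∫ V_- |ψ|² dominates the kinetic energy; the span is orthonormalized in
the kinetic energy inner product. V_- is cut into dyadic layers, and on each layer the frequencies
are cut at the matching level of T. A geometric series shows that the high frequencies contribute at
most 4α² per function; Bessel's inequality bounds the sum of the low frequency parts pointwise in x,
which produces G. The resulting bound vanishes at u = 0, so a small, bounded, compactly supported V
≤ 0 has N < 1; this gives the converse directions in (a).

Converse in (b). An arbitrary G₀ may be positive at 0, so a compactly supported V does not suffice.
Summing translates of one relatively form compact potential along a dense sequence gives one that is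
positive almost everywhere. It dominates some U > 0 with ∫ G₀(U) < 1, so T(p) - U has no negative
eigenvalue, which the divergent case excludes (`not_isQuantBound`). -/

/-! ### Weak limits and compact operators in a Hilbert space -/

section HilbertSpace

variable {H : Type*} [NormedAddCommGroup H] [InnerProductSpace ℂ H]

/-- A nonnegative quadratic form that vanishes at `f` has `f` in the kernel of its operator. -/
theorem eq_zero_of_forall_re_inner_nonneg {A : H →L[ℂ] H}
    (hA : ∀ f g, inner ℂ f (A g) = inner ℂ (A f) g)
    (h0 : ∀ f, 0 ≤ (inner ℂ f (A f)).re) {f : H} (hf : (inner ℂ f (A f)).re ≤ 0) : A f = 0 := by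
  by_contra hne
  set a := A f with ha
  have hn : 0 < ‖a‖ ^ 2 := by positivity
  -- The form at f - t A f, for which the term of order zero is nonpositive. A small t > 0 makes the
  -- linear term win unless A f = 0.
  have hexp : ∀ t : ℝ, 0 ≤ -2 * t * ‖a‖ ^ 2 + t ^ 2 * (inner ℂ a (A a)).re := by
    intro t
    have h1 := h0 (f - (t : ℂ) • a)
    have h2 : inner ℂ f (A a) = inner ℂ a a := by rw [hA, ← ha]
    rw [map_sub, map_smul, ← ha, inner_sub_left, inner_sub_right, inner_sub_right,
      inner_smul_left, inner_smul_right, inner_smul_left, inner_smul_right, h2] at h1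
    simp only [Complex.conj_ofReal, Complex.sub_re, Complex.re_ofReal_mul] at h1
    have h3 : (inner ℂ a a).re = ‖a‖ ^ 2 := by
      rw [inner_self_eq_norm_sq_to_K]; norm_cast
    rw [h3] at h1
    nlinarith
  set b := (inner ℂ a (A a)).re
  have hb : 0 ≤ b := h0 a
  have := hexp (‖a‖ ^ 2 / (b + 1))
  have hb1 : 0 < b + 1 := by linarith
  field_simp at this
  nlinarith [mul_pos hn hn, mul_nonneg hn.le hb]

variable [CompleteSpace H]

/-- A bounded family in a Hilbert space has a weak limit along every ultrafilter. -/
theorem exists_weak_limit_ultrafilter {ι : Type*} (l : Ultrafilter ι) (f : ι → H) (C : ℝ)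
    (hf : ∀ i, ‖f i‖ ≤ C) :
    ∃ f₀ : H, ‖f₀‖ ≤ C ∧ ∀ g, Tendsto (fun i => inner ℂ (f i) g) l (𝓝 (inner ℂ f₀ g)) := by
  have hc := WeakDual.isCompact_closedBall (𝕜 := ℂ) (E := H) 0 C
  let F : ι → WeakDual ℂ H := fun i => StrongDual.toWeakDual (InnerProductSpace.toDual ℂ H (f i))
  have hF : ∀ i, F i ∈ WeakDual.toStrongDual ⁻¹' Metric.closedBall (0 : StrongDual ℂ H) C := by
    intro i
    simp [F, hf i]
  obtain ⟨x, hxC, hx⟩ := hc.ultrafilter_le_nhds (l.map F)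
    (le_principal_iff.2 (Filter.mem_map.2 (Filter.univ_mem' hF)))
  refine ⟨(InnerProductSpace.toDual ℂ H).symm (WeakDual.toStrongDual x), by simpa using hxC,
    fun g => ?_⟩
  rw [InnerProductSpace.toDual_symm_apply]
  have h1 : Tendsto F l (𝓝 x) := hx
  have h2 := ((WeakDual.eval_continuous g).tendsto x).comp h1
  exact h2

/-- A compact operator maps weakly convergent bounded families to norm convergent ones. -/
theorem IsCompactOperator.tendsto_of_weak {ι : Type*} (l : Ultrafilter ι) {f : ι → H} {C : ℝ}
    (hf : ∀ i, ‖f i‖ ≤ C) {f₀ : H}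
    (hw : ∀ g, Tendsto (fun i => inner ℂ (f i) g) l (𝓝 (inner ℂ f₀ g)))
    {K : H →L[ℂ] H} (hK : IsCompactOperator K) :
    Tendsto (fun i => K (f i)) l (𝓝 (K f₀)) := by
  obtain ⟨S, hS, hKS⟩ := IsCompactOperator.image_closedBall_subset_compact (𝕜₁ := ℂ)
    (f := (K : H →ₗ[ℂ] H)) hK C
  obtain ⟨x, -, hx⟩ := hS.ultrafilter_le_nhds (l.map fun i => K (f i))
    (le_principal_iff.2 (Filter.mem_map.2 (Filter.univ_mem' fun i => hKS ⟨f i, by simpa using hf i, rfl⟩)))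
  have h1 : Tendsto (fun i => K (f i)) l (𝓝 x) := hx
  have : x = K f₀ := by
    refine ext_inner_right ℂ fun g => ?_
    have h2 : Tendsto (fun i => inner ℂ (K (f i)) g) l (𝓝 (inner ℂ x g)) :=
      h1.inner tendsto_const_nhds
    have h3 := hw (ContinuousLinearMap.adjoint K g)
    simp only [ContinuousLinearMap.adjoint_inner_right] at h3
    exact tendsto_nhds_unique h2 h3
  rwa [this] at h1

/-- An operator dominated by the quadratic form of a compact operator is compact. -/
theorem IsCompactOperator.of_sq_norm_le {K K' : H →L[ℂ] H} (hK : IsCompactOperator K) {C : ℝ}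
    (h : ∀ f, ‖K' f‖ ^ 2 ≤ C * (inner ℂ f (K f)).re) : IsCompactOperator K' := by
  rw [isCompactOperator_iff_exists_mem_nhds_image_subset_compact]
  refine ⟨Metric.closedBall 0 1, Metric.closedBall_mem_nhds 0 one_pos, _, ?_, subset_rfl⟩
  rw [isCompact_iff_ultrafilter_le_nhds']
  intro l hl
  -- Preimages in the unit ball, with the value 0 off the image. They have a weak limit f₀, and the
  -- form of K at s i - f₀ tends to 0, which forces K' (s i) → K' f₀ in norm.
  have hs : ∀ y : H, ∃ x : H, ‖x‖ ≤ 1 ∧ (y ∈ K' '' Metric.closedBall 0 1 → K' x = y) := by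
    intro y
    by_cases hy : y ∈ K' '' Metric.closedBall 0 1
    · obtain ⟨x, hx, rfl⟩ := hy
      exact ⟨x, by simpa using hx, fun _ => rfl⟩
    · exact ⟨0, by simp, fun h => absurd h hy⟩
  choose s hs1 hs2 using hs
  obtain ⟨f₀, hf₀, hw⟩ := exists_weak_limit_ultrafilter l s 1 hs1
  refine ⟨K' f₀, ⟨f₀, by simpa using hf₀, rfl⟩, ?_⟩
  have hw' : ∀ g, Tendsto (fun i => inner ℂ (s i - f₀) g) l (𝓝 (inner ℂ (0 : H) g)) := by
    intro g
    simpa [inner_sub_left] using (hw g).sub_const (inner ℂ f₀ g)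
  have hb : ∀ i, ‖s i - f₀‖ ≤ 2 := fun i => (norm_sub_le _ _).trans (by linarith [hs1 i])
  have hT := hK.tendsto_of_weak l hb hw'
  rw [map_zero] at hT
  have h0 : Tendsto (fun i => inner ℂ (s i - f₀) (K (s i - f₀))) l (𝓝 0) := by
    rw [tendsto_zero_iff_norm_tendsto_zero]
    refine squeeze_zero (fun _ => norm_nonneg _)
      (fun i => (norm_inner_le_norm _ _).trans
        (mul_le_mul_of_nonneg_right (hb i) (norm_nonneg _))) ?_
    simpa using hT.norm.const_mul 2
  have h1 : Tendsto (fun i => ‖K' (s i - f₀)‖ ^ 2) l (𝓝 0) := by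
    refine squeeze_zero (fun _ => sq_nonneg _) (fun i => h _) ?_
    simpa using ((Complex.continuous_re.tendsto _).comp h0).const_mul C
  have h2 : Tendsto (fun i => K' (s i)) l (𝓝 (K' f₀)) := by
    rw [tendsto_iff_norm_sub_tendsto_zero]
    have := h1.sqrt
    simpa [Real.sqrt_sq (norm_nonneg _)] using this
  have h3 : Tendsto (fun i : H => i) l (𝓝 (K' f₀)) := by
    refine h2.congr' ?_
    filter_upwards [hl] with y hy using hs2 y hy
  exact h3

end HilbertSpace

/-! ### Existence of a ground state for a compactly perturbed form -/

section GroundState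

variable {H : Type*} [NormedAddCommGroup H] [InnerProductSpace ℂ H]

/-- The quadratic form of `1 - R† R + K + e R† R`. -/
noncomputable def perturbedForm (R K : H →L[ℂ] H) (e : ℝ) (f : H) : ℝ :=
  ‖f‖ ^ 2 - ‖R f‖ ^ 2 + (inner ℂ f (K f)).re + e * ‖R f‖ ^ 2

theorem perturbedForm_smul (R K : H →L[ℂ] H) (e : ℝ) (f : H) (t : ℝ) :
    perturbedForm R K e ((t : ℂ) • f) = t ^ 2 * perturbedForm R K e f := by
  simp [perturbedForm, norm_smul, mul_pow]
  ring

theorem exists_unit_of_perturbedForm_neg {R K : H →L[ℂ] H} {e : ℝ}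
    (h : ∃ f, perturbedForm R K e f < 0) : ∃ f, ‖f‖ = 1 ∧ perturbedForm R K e f < 0 := by
  obtain ⟨f, hf⟩ := h
  have hne : f ≠ 0 := by
    rintro rfl
    simp [perturbedForm] at hf
  refine ⟨((‖f‖⁻¹ : ℝ) : ℂ) • f, ?_, ?_⟩
  · simp [norm_smul, hne]
  · rw [perturbedForm_smul]
    have : 0 < (‖f‖⁻¹) ^ 2 := by positivity
    nlinarith

variable [CompleteSpace H]

/-- K turns weak into norm convergence, and a weakly convergent bounded factor may be paired with a
norm convergent one. -/
theorem IsCompactOperator.tendsto_inner_of_weak {ι : Type*} (l : Ultrafilter ι) {f : ι → H} {C : ℝ}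
    (hf : ∀ i, ‖f i‖ ≤ C) {f₀ : H}
    (hw : ∀ g, Tendsto (fun i => inner ℂ (f i) g) l (𝓝 (inner ℂ f₀ g)))
    {K : H →L[ℂ] H} (hK : IsCompactOperator K) :
    Tendsto (fun i => inner ℂ (f i) (K (f i))) l (𝓝 (inner ℂ f₀ (K f₀))) := by
  have h1 := hK.tendsto_of_weak l hf hw
  have h2 : Tendsto (fun i => inner ℂ (f i) (K (f i) - K f₀)) l (𝓝 0) := by
    rw [tendsto_zero_iff_norm_tendsto_zero]
    refine squeeze_zero (fun _ => norm_nonneg _)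
      (fun i => (norm_inner_le_norm _ _).trans
        (mul_le_mul_of_nonneg_right (hf i) (norm_nonneg _))) ?_
    simpa using (tendsto_iff_norm_sub_tendsto_zero.1 h1).const_mul C
  simpa [inner_sub_right] using h2.add (hw (K f₀))

/-- The operator `1 - R† R + K + e R† R`. -/
noncomputable def perturbedOp (R K : H →L[ℂ] H) (e : ℝ) : H →L[ℂ] H :=
  ContinuousLinearMap.id ℂ H + K + ((e - 1 : ℝ) : ℂ) • (ContinuousLinearMap.adjoint R ∘L R)

theorem inner_perturbedOp (R K : H →L[ℂ] H) (e : ℝ) (g f : H) :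
    inner ℂ g (perturbedOp R K e f) =
      inner ℂ g f - inner ℂ (R g) (R f) + inner ℂ g (K f) + e * inner ℂ (R g) (R f) := by
  simp [perturbedOp, ContinuousLinearMap.adjoint_inner_right]
  ring

theorem perturbedForm_eq (R K : H →L[ℂ] H) (e : ℝ) (f : H) :
    perturbedForm R K e f = (inner ℂ f (perturbedOp R K e f)).re := by
  have h (x : H) : (inner ℂ x x).re = ‖x‖ ^ 2 := by
    rw [inner_self_eq_norm_sq_to_K]; norm_cast
  rw [inner_perturbedOp]
  simp only [Complex.add_re, Complex.sub_re, Complex.re_ofReal_mul, h, perturbedForm]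

/-- The direct method. The eigenvalue is -E, where E is the supremum of all e for which the form
shifted by e ‖R f‖² still takes negative values. A weak limit of almost optimal unit vectors is
nonzero by coercivity and makes the shifted form at E nonpositive. This form is nonnegative
everywhere, so the limit lies in the kernel of its operator. -/
theorem exists_ground_state {R K : H →L[ℂ] H} (hR : Function.Injective R)
    (hR1 : ∀ f, ‖R f‖ ≤ ‖f‖) (hK : IsCompactOperator K)
    (hKs : ∀ f g, inner ℂ f (K g) = inner ℂ (K f) g)
    (h0 : ∃ f, ‖f‖ ^ 2 - ‖R f‖ ^ 2 + (inner ℂ f (K f)).re < 0) :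
    ∃ e : ℝ, 0 < e ∧ ∃ f : H, f ≠ 0 ∧ ∀ g : H,
      inner ℂ g f - inner ℂ (R g) (R f) + inner ℂ g (K f) = -(e : ℂ) * inner ℂ (R g) (R f) := by
  have hR2 : ∀ f, ‖R f‖ ^ 2 ≤ ‖f‖ ^ 2 := fun f => pow_le_pow_left₀ (norm_nonneg _) (hR1 f) 2
  set S : Set ℝ := {e | 0 < e ∧ ∃ f, ‖f‖ = 1 ∧ perturbedForm R K e f < 0} with hS
  have hSne : S.Nonempty := by
    obtain ⟨f, hf⟩ := h0
    set a := ‖f‖ ^ 2 - ‖R f‖ ^ 2 + (inner ℂ f (K f)).re with ha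
    -- This shift raises the negative value a by at most |a|/2.
    refine ⟨-a / (2 * (‖R f‖ ^ 2 + 1)), div_pos (by linarith) (by positivity),
      exists_unit_of_perturbedForm_neg ⟨f, ?_⟩⟩
    have h1 : ‖R f‖ ^ 2 / (2 * (‖R f‖ ^ 2 + 1)) ≤ 1 / 2 := by
      rw [div_le_div_iff₀ (by positivity) (by positivity)]
      nlinarith [sq_nonneg ‖R f‖]
    have : perturbedForm R K (-a / (2 * (‖R f‖ ^ 2 + 1))) f =
        a - a * (‖R f‖ ^ 2 / (2 * (‖R f‖ ^ 2 + 1))) := by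
      simp only [perturbedForm, ← ha]; ring
    rw [this]
    nlinarith
  -- With r = ‖R f‖² in [0, 1], the right side 1 - r + e r is a convex combination of 1 and e.
  have hlow : ∀ (e : ℝ) (f : H), ‖f‖ = 1 →
      min 1 e ≤ ‖f‖ ^ 2 - ‖R f‖ ^ 2 + e * ‖R f‖ ^ 2 := by
    intro e f hf
    have h1 := hR2 f
    rw [hf] at h1 ⊢
    rcases min_cases 1 e with ⟨h, h'⟩ | ⟨h, h'⟩ <;> rw [h] <;> nlinarith [sq_nonneg ‖R f‖]
  have hweak : ∀ f : ℕ → H, (∀ n, ‖f n‖ = 1) → ∃ f₀ : H,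
      (∀ g, Tendsto (fun i => inner ℂ (f i) g) (hyperfilter ℕ) (𝓝 (inner ℂ f₀ g))) ∧
      Tendsto (fun i => (inner ℂ (f i) (K (f i))).re) (hyperfilter ℕ)
        (𝓝 (inner ℂ f₀ (K f₀)).re) := by
    intro f hf
    obtain ⟨f₀, -, hw⟩ := exists_weak_limit_ultrafilter (hyperfilter ℕ) f 1 (fun n => (hf n).le)
    exact ⟨f₀, hw, (Complex.continuous_re.tendsto _).comp
      (hK.tendsto_inner_of_weak (hyperfilter ℕ) (fun n => (hf n).le) hw)⟩
  have hle : (hyperfilter ℕ : Filter ℕ) ≤ atTop := Nat.hyperfilter_le_atTop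
  -- Arbitrarily large shifts would force ‖R (f n)‖ → 0. The weak limit is then 0 because R is
  -- injective, so ⟨f n, K (f n)⟩ → 0, although it stays below -1.
  have hbdd : BddAbove S := by
    by_contra hub
    have hex : ∀ n : ℕ, ∃ e : ℝ, (n : ℝ) + 1 < e ∧ ∃ f, ‖f‖ = 1 ∧ perturbedForm R K e f < 0 := by
      intro n
      rw [not_bddAbove_iff] at hub
      obtain ⟨e, he, hlt⟩ := hub (n + 1)
      exact ⟨e, hlt, he.2⟩
    choose e he f hf hQ using hex
    obtain ⟨f₀, hw, hKl⟩ := hweak f hf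
    have hRf : ∀ n, ‖R (f n)‖ ^ 2 ≤ ‖K‖ / (n + 1) := by
      intro n
      have h1 := hQ n
      have h2 := hR2 (f n)
      have h3 : |(inner ℂ (f n) (K (f n))).re| ≤ ‖K‖ := by
        refine (Complex.abs_re_le_norm _).trans ((norm_inner_le_norm _ _).trans ?_)
        simpa [hf n] using K.le_opNorm (f n)
      have h4 := neg_le_of_abs_le h3
      rw [le_div_iff₀ (by positivity)]
      simp only [perturbedForm] at h1
      nlinarith [he n, sq_nonneg ‖R (f n)‖]
    have hR0 : Tendsto (fun n => ‖R (f n)‖ ^ 2) (hyperfilter ℕ) (𝓝 0) := by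
      refine squeeze_zero (fun _ => sq_nonneg _) hRf ?_
      exact (tendsto_const_div_atTop_nhds_zero_nat ‖K‖ |>.comp (tendsto_add_atTop_nat 1)
        |>.congr (fun n => by simp)).mono_left hle
    have hf₀ : f₀ = 0 := by
      apply hR
      rw [map_zero]
      refine ext_inner_right ℂ fun g => ?_
      have h1 := hw (ContinuousLinearMap.adjoint R g)
      simp only [ContinuousLinearMap.adjoint_inner_right] at h1
      refine tendsto_nhds_unique h1 ?_
      rw [inner_zero_left, tendsto_zero_iff_norm_tendsto_zero]
      have h2 : Tendsto (fun n => ‖R (f n)‖) (hyperfilter ℕ) (𝓝 0) := by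
        simpa [Real.sqrt_sq (norm_nonneg _)] using hR0.sqrt
      exact squeeze_zero (fun _ => norm_nonneg _) (fun i => norm_inner_le_norm _ _)
        (by simpa using h2.mul_const ‖g‖)
    have h1 : ∀ n, 1 ≤ -(inner ℂ (f n) (K (f n))).re := by
      intro n
      have h1 := hQ n
      have h2 := hlow (e n) (f n) (hf n)
      rw [min_eq_left (by linarith [he n, (Nat.cast_nonneg n : (0 : ℝ) ≤ n)])] at h2
      simp only [perturbedForm] at h1
      linarith
    have h2 := ge_of_tendsto hKl.neg (Eventually.of_forall h1)
    rw [hf₀] at h2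
    norm_num at h2
  set E := sSup S with hE
  have hEpos : 0 < E := by
    obtain ⟨e, he⟩ := hSne
    exact he.1.trans_le (le_csSup hbdd he)
  obtain ⟨e, -, htend, hmem⟩ := exists_seq_tendsto_sSup hSne hbdd
  choose hepos f hf hQ using hmem
  obtain ⟨f₀, hw, hKl⟩ := hweak f hf
  have htend' : Tendsto e (hyperfilter ℕ) (𝓝 E) := htend.mono_left hle
  have hP : ∀ n, perturbedForm R 0 E (f n) ≤ -(inner ℂ (f n) (K (f n))).re + (E - e n) := by
    intro n
    have h1 := hQ n
    have h2 := hR2 (f n)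
    have h3 : e n ≤ E := le_csSup hbdd ⟨hepos n, f n, hf n, hQ n⟩
    rw [hf n] at h2
    simp only [perturbedForm, zero_apply, inner_zero_right, Complex.zero_re] at h1 ⊢
    nlinarith [sq_nonneg ‖R (f n)‖]
  have hrhs : Tendsto (fun n => -(inner ℂ (f n) (K (f n))).re + (E - e n)) (hyperfilter ℕ)
      (𝓝 (-(inner ℂ f₀ (K f₀)).re)) := by
    simpa using hKl.neg.add (htend'.const_sub E)
  have hne : f₀ ≠ 0 := by
    intro h
    have h1 : min 1 E ≤ -(inner ℂ f₀ (K f₀)).re := by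
      refine ge_of_tendsto hrhs (Eventually.of_forall fun n => ?_)
      refine le_trans ?_ (hP n)
      simpa [perturbedForm] using hlow E (f n) (hf n)
    rw [h] at h1
    have : 0 < min 1 E := lt_min one_pos hEpos
    rw [inner_zero_left, Complex.zero_re, neg_zero] at h1
    linarith
  -- Weak lower semicontinuity of a nonnegative form: expanding it at f n - f₀ bounds its value at f
  -- n from below by an expression affine in f n, which passes to the weak limit.
  have hlsc : perturbedForm R 0 E f₀ ≤ -(inner ℂ f₀ (K f₀)).re := by
    have hpos : ∀ n, 2 * (inner ℂ (f n) (perturbedOp R 0 E f₀)).re - perturbedForm R 0 E f₀ ≤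
        perturbedForm R 0 E (f n) := by
      intro n
      have h1 : 0 ≤ perturbedForm R 0 E (f n - f₀) := by
        simp only [perturbedForm, zero_apply, inner_zero_right, Complex.zero_re]
        nlinarith [hR2 (f n - f₀), sq_nonneg ‖R (f n - f₀)‖]
      have h2 : (inner ℂ f₀ (perturbedOp R 0 E (f n))).re =
          (inner ℂ (f n) (perturbedOp R 0 E f₀)).re := by
        rw [inner_perturbedOp, inner_perturbedOp]
        have hc (x y : H) : (inner ℂ x y).re = (inner ℂ y x).re := inner_re_symm (𝕜 := ℂ) x y
        simp [hc f₀, hc (R f₀)]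
      rw [perturbedForm_eq, map_sub, inner_sub_left, inner_sub_right, inner_sub_right] at h1
      rw [perturbedForm_eq, perturbedForm_eq]
      simp only [Complex.sub_re] at h1
      linarith
    have hlim : Tendsto (fun n => 2 * (inner ℂ (f n) (perturbedOp R 0 E f₀)).re
        - perturbedForm R 0 E f₀) (hyperfilter ℕ) (𝓝 (perturbedForm R 0 E f₀)) := by
      have h3 : Tendsto (fun n => (inner ℂ (f n) (perturbedOp R 0 E f₀)).re) (hyperfilter ℕ)
          (𝓝 (perturbedForm R 0 E f₀)) := by
        rw [perturbedForm_eq]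
        exact (Complex.continuous_re.tendsto _).comp (hw (perturbedOp R 0 E f₀))
      have h4 := (h3.const_mul 2).sub_const (perturbedForm R 0 E f₀)
      rwa [two_mul, add_sub_cancel_right] at h4
    exact le_of_tendsto_of_tendsto' hlim hrhs (fun n => (hpos n).trans (hP n))
  -- A negative value at the shift E would survive a slightly larger shift, against the choice of E
  -- as supremum.
  have hnn : ∀ g, 0 ≤ (inner ℂ g (perturbedOp R K E g)).re := by
    intro g
    by_contra hlt
    rw [not_le, ← perturbedForm_eq] at hlt
    set a := perturbedForm R K E g with ha
    set δ := -a / (2 * (‖R g‖ ^ 2 + 1)) with hδ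
    have hδpos : 0 < δ := div_pos (by linarith) (by positivity)
    have h1 : δ * (2 * (‖R g‖ ^ 2 + 1)) = -a := by
      rw [hδ]; field_simp
    have h2 : perturbedForm R K (E + δ) g < 0 := by
      have : perturbedForm R K (E + δ) g = a + δ * ‖R g‖ ^ 2 := by
        simp only [ha, perturbedForm]; ring
      rw [this]
      nlinarith [sq_nonneg ‖R g‖]
    have h3 : E + δ ≤ E := le_csSup hbdd ⟨by linarith, exists_unit_of_perturbedForm_neg ⟨g, h2⟩⟩
    linarith
  have hker := eq_zero_of_forall_re_inner_nonneg (A := perturbedOp R K E) (f := f₀) (fun g h => by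
      rw [inner_perturbedOp, ← inner_conj_symm (perturbedOp R K E g) h, inner_perturbedOp]
      simp [hKs, inner_conj_symm]) hnn (by
      rw [← perturbedForm_eq]
      simp only [perturbedForm, zero_apply, inner_zero_right, Complex.zero_re]
        at hlsc ⊢
      linarith)
  refine ⟨E, hEpos, f₀, hne, fun g => ?_⟩
  have := inner_perturbedOp R K E g f₀
  rw [hker, inner_zero_right] at this
  linear_combination -this

end GroundState

/-! ### Fourier multipliers and the form domain -/

section FourierMultipliers

variable {d : ℕ}

theorem ae_eq_of_fourier_ae_eq {φ ψ : L2 d} (h : (𝓕 φ : L2 d) =ᵐ[volume] (𝓕 ψ : L2 d)) : φ = ψ :=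
  (Lp.fourierTransformₗᵢ (RSpace d) ℂ).injective (Lp.ext h)

theorem exists_fourier_eq {h : RSpace d → ℂ} (hh : MemLp h 2 volume) :
    ∃ ψ : L2 d, (𝓕 ψ : L2 d) =ᵐ[volume] h := by
  refine ⟨𝓕⁻ (hh.toLp h), ?_⟩
  rw [FourierTransform.fourier_fourierInv_eq]
  exact hh.coeFn_toLp

theorem coeFn_fourier_add (f g : L2 d) :
    (𝓕 (f + g) : L2 d) =ᵐ[volume] fun ξ => (𝓕 f : L2 d) ξ + (𝓕 g : L2 d) ξ := by
  rw [FourierTransform.fourier_add]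
  exact Lp.coeFn_add _ _

theorem coeFn_fourier_sub (f g : L2 d) :
    (𝓕 (f - g) : L2 d) =ᵐ[volume] fun ξ => (𝓕 f : L2 d) ξ - (𝓕 g : L2 d) ξ := by
  have : (𝓕 (f - g) : L2 d) = 𝓕 f - 𝓕 g := (Lp.fourierTransformₗᵢ (RSpace d) ℂ).map_sub f g
  rw [this]
  exact Lp.coeFn_sub _ _

theorem coeFn_fourier_smul (c : ℂ) (f : L2 d) :
    (𝓕 (c • f) : L2 d) =ᵐ[volume] fun ξ => c * (𝓕 f : L2 d) ξ := by
  rw [FourierTransform.fourier_smul]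
  exact Lp.coeFn_smul _ _

/-- Fourier multipliers with symbol bounded by `1` are contractions of `L²`. -/
theorem exists_fourierMultiplier {m : RSpace d → ℂ} (hm : Measurable m) (hb : ∀ ξ, ‖m ξ‖ ≤ 1) :
    ∃ M : L2 d →L[ℂ] L2 d, (∀ f, ‖M f‖ ≤ ‖f‖) ∧
      ∀ f, (𝓕 (M f) : L2 d) =ᵐ[volume] fun ξ => m ξ * (𝓕 f : L2 d) ξ := by
  have hmem : ∀ f : L2 d, MemLp (fun ξ => m ξ * (𝓕 f : L2 d) ξ) 2 volume := by
    intro f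
    refine (Lp.memLp (𝓕 f : L2 d)).of_le
      (hm.aestronglyMeasurable.mul (Lp.aestronglyMeasurable _)) (Eventually.of_forall fun ξ => ?_)
    rw [norm_mul]
    exact mul_le_of_le_one_left (norm_nonneg _) (hb ξ)
  choose M hM using fun f => exists_fourier_eq (hmem f)
  have hadd : ∀ f g, M (f + g) = M f + M g := by
    intro f g
    apply ae_eq_of_fourier_ae_eq
    filter_upwards [hM (f + g), hM f, hM g, coeFn_fourier_add (M f) (M g), coeFn_fourier_add f g]
      with ξ h1 h2 h3 h4 h5
    rw [h1, h4, h2, h3, h5, mul_add]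
  have hsmul : ∀ (c : ℂ) f, M (c • f) = c • M f := by
    intro c f
    apply ae_eq_of_fourier_ae_eq
    filter_upwards [hM (c • f), hM f, coeFn_fourier_smul c (M f), coeFn_fourier_smul c f]
      with ξ h1 h2 h3 h4
    rw [h1, h3, h2, h4]
    ring
  have hnorm : ∀ f, ‖M f‖ ≤ ‖f‖ := by
    intro f
    rw [← Lp.norm_fourier_eq (M f), ← Lp.norm_fourier_eq f]
    refine Lp.norm_le_norm_of_ae_le ?_
    filter_upwards [hM f] with ξ h
    rw [h, norm_mul]
    exact mul_le_of_le_one_left (norm_nonneg _) (hb ξ)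
  exact ⟨LinearMap.mkContinuous ⟨⟨M, hadd⟩, hsmul⟩ 1 (fun f => by simpa using hnorm f), hnorm, hM⟩

/-- The symbol of `T(p)` in the variable of Mathlib's Fourier transform. -/
noncomputable abbrev freqSymbol (T : RSpace d → ℝ≥0) (ξ : RSpace d) : ℝ≥0 := T ((2 * Real.pi) • ξ)

theorem measurable_freqSymbol {T : RSpace d → ℝ≥0} (hT : Measurable T) :
    Measurable (freqSymbol T) := hT.comp (measurable_const_smul _)

theorem inv_sqrt_sq (t : ℝ≥0) : ((Real.sqrt ((t : ℝ) + 1))⁻¹) ^ 2 = ((t : ℝ) + 1)⁻¹ := by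
  rw [inv_pow, Real.sq_sqrt (by positivity)]

theorem exists_invSqrt {T : RSpace d → ℝ≥0} (hT : Measurable T) :
    ∃ R : L2 d →L[ℂ] L2 d, (∀ f, ‖R f‖ ≤ ‖f‖) ∧ ∀ f, IsInvSqrtApply T f (R f) := by
  have h := measurable_freqSymbol hT
  refine exists_fourierMultiplier (m := fun ξ =>
    (((Real.sqrt ((T ((2 * Real.pi) • ξ) : ℝ) + 1))⁻¹ : ℝ) : ℂ)) ?_ fun ξ => ?_
  · exact Complex.measurable_ofReal.comp
      ((Real.continuous_sqrt.measurable.comp (h.coe_nnreal_real.add_const 1)).inv)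
  · rw [Complex.norm_real, Real.norm_of_nonneg (by positivity)]
    apply inv_le_one_of_one_le₀
    rw [Real.one_le_sqrt]
    have := (T ((2 * Real.pi) • ξ)).2
    linarith

theorem IsInvSqrtApply.unique {T : RSpace d → ℝ≥0} {f φ φ' : L2 d} (h : IsInvSqrtApply T f φ)
    (h' : IsInvSqrtApply T f φ') : φ = φ' := by
  apply ae_eq_of_fourier_ae_eq
  filter_upwards [h, h'] with ξ h1 h2
  rw [h1, h2]

theorem IsInvSqrtApply.unique_left {T : RSpace d → ℝ≥0} {f f' φ : L2 d} (h : IsInvSqrtApply T f φ)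
    (h' : IsInvSqrtApply T f' φ) : f = f' := by
  apply ae_eq_of_fourier_ae_eq
  filter_upwards [h, h'] with ξ h1 h2
  rw [h1] at h2
  refine mul_left_cancel₀ ?_ h2
  have : 0 < Real.sqrt ((T ((2 * Real.pi) • ξ) : ℝ) + 1) := Real.sqrt_pos.2 (by positivity)
  exact_mod_cast (inv_pos.2 this).ne'

theorem IsInvSqrtApply.norm_sq_eq {T : RSpace d → ℝ≥0} {f φ : L2 d} (h : IsInvSqrtApply T f φ) :
    ∀ᵐ ξ, ‖(𝓕 f : L2 d) ξ‖ₑ ^ 2 =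
      (T ((2 * Real.pi) • ξ) : ℝ≥0∞) * ‖(𝓕 φ : L2 d) ξ‖ₑ ^ 2 + ‖(𝓕 φ : L2 d) ξ‖ₑ ^ 2 := by
  filter_upwards [h] with ξ h1
  rw [h1]
  set t := T ((2 * Real.pi) • ξ)
  have h2 : ‖(((Real.sqrt ((t : ℝ) + 1))⁻¹ : ℝ) : ℂ)‖ₑ ^ 2 = ((t + 1)⁻¹ : ℝ≥0) := by
    rw [enorm_eq_nnnorm, ← ENNReal.coe_pow]
    congr 1
    rw [← NNReal.coe_inj]
    rw [NNReal.coe_pow, coe_nnnorm, Complex.norm_real, Real.norm_of_nonneg (by positivity),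
      inv_sqrt_sq]
    push_cast
    rfl
  rw [enorm_mul, mul_pow, h2, ← add_one_mul, ← mul_assoc]
  norm_cast
  rw [mul_inv_cancel₀ (by positivity)]
  simp

theorem lintegral_enorm_sq_lt_top (f : L2 d) : ∫⁻ x, ‖f x‖ₑ ^ 2 < ∞ := by
  have h := (Lp.memLp f).2
  rw [eLpNorm_lt_top_iff_lintegral_rpow_enorm_lt_top (by norm_num) (by norm_num)] at h
  simpa using h

theorem memLp_two_of_lintegral {h : RSpace d → ℂ} (hm : AEStronglyMeasurable h volume)
    (hf : ∫⁻ x, ‖h x‖ₑ ^ 2 < ∞) : MemLp h 2 volume := by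
  refine ⟨hm, ?_⟩
  rw [eLpNorm_lt_top_iff_lintegral_rpow_enorm_lt_top (by norm_num) (by norm_num)]
  simpa using hf

/-- The form domain is the range of `(T(p) + 1)^{-1/2}`. -/
theorem mem_kinFormDomain_iff {T : RSpace d → ℝ≥0} (hT : Measurable T) {ψ : L2 d} :
    ψ ∈ kinFormDomain T ↔ ∃ f, IsInvSqrtApply T f ψ := by
  constructor
  · intro h
    have hm : AEStronglyMeasurable (fun ξ =>
        ((Real.sqrt ((T ((2 * Real.pi) • ξ) : ℝ) + 1) : ℝ) : ℂ) * (𝓕 ψ : L2 d) ξ) volume :=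
      (Complex.measurable_ofReal.comp (Real.continuous_sqrt.measurable.comp
        ((measurable_freqSymbol hT).coe_nnreal_real.add_const 1))).aestronglyMeasurable.mul
        (Lp.aestronglyMeasurable _)
    have key : ∫⁻ ξ, ‖((Real.sqrt ((T ((2 * Real.pi) • ξ) : ℝ) + 1) : ℝ) : ℂ) *
        (𝓕 ψ : L2 d) ξ‖ₑ ^ 2 < ∞ := ?_
    · obtain ⟨f, hf⟩ := exists_fourier_eq (memLp_two_of_lintegral hm key)
      refine ⟨f, ?_⟩
      filter_upwards [hf] with ξ h1
      rw [h1, ← mul_assoc]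
      have : 0 < Real.sqrt ((T ((2 * Real.pi) • ξ) : ℝ) + 1) := Real.sqrt_pos.2 (by positivity)
      rw [← Complex.ofReal_mul, inv_mul_cancel₀ this.ne']
      simp
    · have h2 : ∀ ξ, ‖((Real.sqrt ((T ((2 * Real.pi) • ξ) : ℝ) + 1) : ℝ) : ℂ) * (𝓕 ψ : L2 d) ξ‖ₑ ^ 2 =
          (T ((2 * Real.pi) • ξ) : ℝ≥0∞) * ‖(𝓕 ψ : L2 d) ξ‖ₑ ^ 2 + ‖(𝓕 ψ : L2 d) ξ‖ₑ ^ 2 := by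
        intro ξ
        rw [enorm_mul, mul_pow, ← add_one_mul]
        congr 1
        rw [enorm_eq_nnnorm, ← ENNReal.coe_pow]
        rw [← ENNReal.coe_one, ← ENNReal.coe_add]
        congr 1
        rw [← NNReal.coe_inj]
        push_cast
        rw [Complex.norm_real, Real.norm_of_nonneg (by positivity), Real.sq_sqrt (by positivity)]
      simp_rw [h2]
      rw [lintegral_add_right' _ ((Lp.aestronglyMeasurable _).enorm.pow_const 2)]
      exact ENNReal.add_lt_top.2 ⟨h, lintegral_enorm_sq_lt_top _⟩
  · rintro ⟨f, hf⟩
    refine lt_of_le_of_lt (lintegral_mono_ae ?_) (lintegral_enorm_sq_lt_top (𝓕 f : L2 d))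
    filter_upwards [hf.norm_sq_eq] with ξ h
    rw [h]
    exact le_self_add

/-- On the Fourier side this is T/(T+1) = 1 - 1/(T+1). It replaces the unbounded kinetic form by
bounded ones on the side of f and g. -/
theorem kinForm_eq {T : RSpace d → ℝ≥0} {f g φ ψ : L2 d}
    (hf : IsInvSqrtApply T f φ) (hg : IsInvSqrtApply T g ψ) :
    kinForm T φ ψ = inner ℂ f g - inner ℂ φ ψ := by
  rw [← Lp.inner_fourier_eq f g, ← Lp.inner_fourier_eq φ ψ, L2.inner_def, L2.inner_def,
    ← integral_sub (L2.integrable_inner _ _) (L2.integrable_inner _ _)]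
  refine integral_congr_ae ?_
  filter_upwards [hf, hg] with ξ h1 h2
  set t := T ((2 * Real.pi) • ξ)
  have h3 : ((((Real.sqrt ((t : ℝ) + 1))⁻¹ : ℝ) : ℂ)) ^ 2 * ((t : ℝ) + 1 : ℂ) = 1 := by
    rw [← Complex.ofReal_pow, inv_sqrt_sq]
    have : t + 1 ≠ 0 := by positivity
    norm_cast
    exact inv_mul_cancel₀ this
  simp only [RCLike.inner_apply, h1, h2, map_mul, Complex.conj_ofReal]
  linear_combination ((starRingEnd ℂ) ((𝓕 f : L2 d) ξ) * (𝓕 g : L2 d) ξ) * h3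

end FourierMultipliers

/-! ### Relatively form compact potentials and the variational criterion -/

section FormBounds

variable {d : ℕ} {T : RSpace d → ℝ≥0}

theorem RelFormCompact.integrable {V : RSpace d → ℝ} (hT : Measurable T) (hV : RelFormCompact T V)
    {φ ψ : L2 d} (hφ : φ ∈ kinFormDomain T) (hψ : ψ ∈ kinFormDomain T) :
    Integrable (fun x => |V x| * (‖φ x‖ * ‖ψ x‖)) := by
  obtain ⟨f, hf⟩ := (mem_kinFormDomain_iff hT).1 hφ
  obtain ⟨g, hg⟩ := (mem_kinFormDomain_iff hT).1 hψ
  obtain ⟨K, -, hK⟩ := hV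
  exact (hK f g φ ψ hf hg).1

theorem RelFormCompact.integrable_sq {V : RSpace d → ℝ} (hT : Measurable T)
    (hV : RelFormCompact T V) {φ : L2 d} (hφ : φ ∈ kinFormDomain T) :
    Integrable (fun x => |V x| * ‖φ x‖ ^ 2) := by
  simpa only [sq] using hV.integrable hT hφ hφ

theorem potForm_conj (V : RSpace d → ℝ) (φ ψ : L2 d) :
    conj (potForm V φ ψ) = potForm V ψ φ := by
  rw [potForm, potForm, ← integral_conj]
  refine integral_congr_ae (Eventually.of_forall fun x => ?_)
  simp only [map_mul, Complex.conj_ofReal, Complex.conj_conj]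
  ring

theorem kinForm_conj (φ ψ : L2 d) :
    conj (kinForm T φ ψ) = kinForm T ψ φ := by
  rw [kinForm, kinForm, ← integral_conj]
  refine integral_congr_ae (Eventually.of_forall fun x => ?_)
  simp only [map_mul, Complex.conj_ofReal, Complex.conj_conj]
  ring

theorem potForm_self (V : RSpace d → ℝ) (φ : L2 d) :
    potForm V φ φ = ((∫ x, V x * ‖φ x‖ ^ 2 : ℝ) : ℂ) := by
  rw [potForm, ← integral_complex_ofReal]
  refine integral_congr_ae (Eventually.of_forall fun x => ?_)
  simp only [Complex.conj_mul']
  push_cast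
  rfl

theorem kinForm_self (φ : L2 d) :
    kinForm T φ φ = ((∫ ξ, (T ((2 * Real.pi) • ξ) : ℝ) * ‖(𝓕 φ : L2 d) ξ‖ ^ 2 : ℝ) : ℂ) := by
  rw [kinForm, ← integral_complex_ofReal]
  refine integral_congr_ae (Eventually.of_forall fun x => ?_)
  simp only [Complex.conj_mul']
  push_cast
  rfl

/-- Multiplication by `w` composed with `(T(p) + 1)^{-1/2}` is bounded if `|w|² ≤ |V|`. -/
theorem exists_weighted_invSqrt {V w : RSpace d → ℝ} (hw : Measurable w)
    {R : L2 d →L[ℂ] L2 d} (hR : ∀ f, IsInvSqrtApply T f (R f)) {K : L2 d →L[ℂ] L2 d}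
    (hK : ∀ f g φ ψ : L2 d, IsInvSqrtApply T f φ → IsInvSqrtApply T g ψ →
      Integrable (fun x => |V x| * (‖φ x‖ * ‖ψ x‖)) ∧
      inner ℂ f (K g) = potForm (fun x => |V x|) φ ψ)
    (hle : ∀ᵐ x, w x ^ 2 ≤ |V x|) :
    ∃ J : L2 d →L[ℂ] L2 d, (∀ f, J f =ᵐ[volume] fun x => (w x : ℂ) * R f x) ∧
      ∀ f, ‖J f‖ ^ 2 ≤ (inner ℂ f (K f)).re := by
  have hmeas : ∀ f, AEStronglyMeasurable (fun x => (w x : ℂ) * R f x) volume := fun f =>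
    (Complex.measurable_ofReal.comp hw).aestronglyMeasurable.mul (Lp.aestronglyMeasurable _)
  have hint : ∀ f, Integrable (fun x => |V x| * ‖R f x‖ ^ 2) := fun f => by
    simpa only [sq] using (hK f f (R f) (R f) (hR f) (hR f)).1
  have hsq : ∀ f, Integrable (fun x => ‖(w x : ℂ) * R f x‖ ^ 2) := by
    intro f
    refine (hint f).mono' ((hmeas f).norm.pow 2) ?_
    filter_upwards [hle] with x hx
    rw [Real.norm_of_nonneg (by positivity), norm_mul, mul_pow, Complex.norm_real,
      Real.norm_eq_abs, sq_abs]
    gcongr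
  have hmem : ∀ f, MemLp (fun x => (w x : ℂ) * R f x) 2 volume := fun f =>
    (memLp_two_iff_integrable_sq_norm (hmeas f)).2 (hsq f)
  set J : L2 d → L2 d := fun f => (hmem f).toLp _
  have hJ : ∀ f, J f =ᵐ[volume] fun x => (w x : ℂ) * R f x := fun f => (hmem f).coeFn_toLp
  have hnorm : ∀ f, ‖J f‖ ^ 2 ≤ (inner ℂ f (K f)).re := by
    intro f
    rw [(hK f f (R f) (R f) (hR f) (hR f)).2, potForm_self, Complex.ofReal_re]
    have h1 : ‖J f‖ ^ 2 = ∫ x, ‖(w x : ℂ) * R f x‖ ^ 2 := by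
      have h2 : ‖J f‖ ^ 2 = (inner ℂ (J f) (J f)).re := by
        rw [inner_self_eq_norm_sq_to_K]; norm_cast
      rw [h2, L2.inner_def, ← RCLike.re_eq_complex_re, ← integral_re (L2.integrable_inner _ _)]
      refine integral_congr_ae ?_
      filter_upwards [hJ f] with x hx
      rw [hx, inner_self_eq_norm_sq_to_K]
      norm_cast
    rw [h1]
    refine integral_mono_ae (hsq f) (hint f) ?_
    filter_upwards [hle] with x hx
    simp only [norm_mul, mul_pow, Complex.norm_real, Real.norm_eq_abs, sq_abs]
    gcongr
  have hadd : ∀ f g, J (f + g) = J f + J g := by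
    intro f g
    apply Lp.ext
    filter_upwards [hJ (f + g), hJ f, hJ g, Lp.coeFn_add (J f) (J g), Lp.coeFn_add (R f) (R g)]
      with x h1 h2 h3 h4 h5
    rw [h1, h4, Pi.add_apply, h2, h3, map_add, h5, Pi.add_apply, mul_add]
  have hsmul : ∀ (c : ℂ) f, J (c • f) = c • J f := by
    intro c f
    apply Lp.ext
    filter_upwards [hJ (c • f), hJ f, Lp.coeFn_smul c (J f), Lp.coeFn_smul c (R f)]
      with x h1 h2 h3 h4
    rw [h1, h3, Pi.smul_apply, h2, map_smul, h4, Pi.smul_apply, smul_eq_mul, smul_eq_mul]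
    ring
  refine ⟨LinearMap.mkContinuous ⟨⟨J, hadd⟩, hsmul⟩ (Real.sqrt ‖K‖) (fun f => ?_), hJ, hnorm⟩
  refine abs_le_of_sq_le_sq' ?_ (by positivity) |>.2
  refine (hnorm f).trans ?_
  rw [mul_pow, Real.sq_sqrt (norm_nonneg _)]
  calc (inner ℂ f (K f)).re ≤ ‖inner ℂ f (K f)‖ := Complex.re_le_norm _
    _ ≤ ‖f‖ * ‖K f‖ := norm_inner_le_norm _ _
    _ ≤ ‖f‖ * (‖K‖ * ‖f‖) := by gcongr; exact K.le_opNorm f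
    _ = ‖K‖ * ‖f‖ ^ 2 := by ring

/-- Potentials dominated by a relatively form compact one define compact forms. -/
theorem RelFormCompact.exists_compact {V V' : RSpace d → ℝ} (hT : Measurable T)
    (hV : RelFormCompact T V) (hV' : Measurable V') (hle : ∀ᵐ x, |V' x| ≤ |V x|) :
    ∃ K : L2 d →L[ℂ] L2 d, IsCompactOperator K ∧
      ∀ f g φ ψ : L2 d, IsInvSqrtApply T f φ → IsInvSqrtApply T g ψ →
        Integrable (fun x => |V' x| * (‖φ x‖ * ‖ψ x‖)) ∧ inner ℂ f (K g) = potForm V' φ ψ := by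
  obtain ⟨K, hKc, hK⟩ := hV
  obtain ⟨R, -, hR⟩ := exists_invSqrt hT
  have habs : Measurable fun x => Real.sqrt |V' x| :=
    Real.continuous_sqrt.measurable.comp (continuous_abs.measurable.comp hV')
  obtain ⟨J, hJ, hJn⟩ := exists_weighted_invSqrt (w := fun x => Real.sqrt |V' x|) habs hR hK (by
    filter_upwards [hle] with x hx
    rwa [Real.sq_sqrt (abs_nonneg _)])
  -- V' is factored as √|V'| times sgn(V') √|V'|, so that the signed form is J† J'.
  have hsgn : Measurable fun x => if 0 ≤ V' x then Real.sqrt |V' x| else -Real.sqrt |V' x| :=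
    Measurable.ite (measurableSet_le measurable_const hV') habs habs.neg
  obtain ⟨J', hJ', hJn'⟩ := exists_weighted_invSqrt
    (w := fun x => if 0 ≤ V' x then Real.sqrt |V' x| else -Real.sqrt |V' x|) hsgn hR hK (by
    filter_upwards [hle] with x hx
    split_ifs <;> simpa [Real.sq_sqrt (abs_nonneg _)] using hx)
  -- Compactness comes from J' alone: ‖J' f‖² is dominated by the compact form of |V|, and J† is
  -- bounded.
  refine ⟨ContinuousLinearMap.adjoint J ∘L J', hKc.of_sq_norm_le
    (C := ‖ContinuousLinearMap.adjoint J‖ ^ 2) fun f => ?_, fun f g φ ψ hf hg => ⟨?_, ?_⟩⟩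
  · calc ‖(ContinuousLinearMap.adjoint J ∘L J') f‖ ^ 2
        ≤ (‖ContinuousLinearMap.adjoint J‖ * ‖J' f‖) ^ 2 := by
          gcongr
          exact (ContinuousLinearMap.adjoint J).le_opNorm (J' f)
      _ ≤ _ := by rw [mul_pow]; gcongr; exact hJn' f
  · refine (hK f g φ ψ hf hg).1.mono' ?_ ?_
    · exact (continuous_abs.measurable.comp hV').aestronglyMeasurable.mul
        ((Lp.aestronglyMeasurable φ).norm.mul (Lp.aestronglyMeasurable ψ).norm)
    · filter_upwards [hle] with x hx
      rw [Real.norm_of_nonneg (by positivity)]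
      gcongr
  · rw [hf.unique (hR f), hg.unique (hR g), ContinuousLinearMap.comp_apply,
      ContinuousLinearMap.adjoint_inner_right, L2.inner_def, potForm]
    refine integral_congr_ae ?_
    filter_upwards [hJ f, hJ' g] with x h1 h2
    rw [RCLike.inner_apply, h1, h2, map_mul, Complex.conj_ofReal]
    have h3 : ((if 0 ≤ V' x then Real.sqrt |V' x| else -Real.sqrt |V' x|) : ℝ) * Real.sqrt |V' x| =
        V' x := by
      split_ifs with h
      · rw [Real.mul_self_sqrt (abs_nonneg _), abs_of_nonneg h]
      · rw [neg_mul, Real.mul_self_sqrt (abs_nonneg _), abs_of_neg (not_le.1 h), neg_neg]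
    have h4 : (((if 0 ≤ V' x then Real.sqrt |V' x| else -Real.sqrt |V' x|) : ℝ) : ℂ) *
        (Real.sqrt |V' x| : ℂ) = V' x := by exact_mod_cast h3
    linear_combination ((starRingEnd ℂ) (R f x) * R g x) * h4

theorem RelFormCompact.mono {V V' : RSpace d → ℝ} (hT : Measurable T)
    (hV : RelFormCompact T V) (hV' : Measurable V') (hle : ∀ᵐ x, |V' x| ≤ |V x|) :
    RelFormCompact T V' := by
  obtain ⟨K, hK, h⟩ := hV.exists_compact hT (V' := fun x => |V' x|)
    (continuous_abs.measurable.comp hV') (by simpa using hle)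
  exact ⟨K, hK, by simpa using h⟩

/-- Variational criterion for the existence of a negative eigenvalue. -/
theorem hasNegEigenvalue_of_neg {V : RSpace d → ℝ} (hT : Measurable T) (hVm : Measurable V)
    (hV : RelFormCompact T V) {ψ : L2 d} (hψ : ψ ∈ kinFormDomain T)
    (hneg : (kinForm T ψ ψ + potForm V ψ ψ).re < 0) : HasNegEigenvalue T V := by
  obtain ⟨K, hKc, hK⟩ := hV.exists_compact hT hVm (Eventually.of_forall fun _ => le_rfl)
  obtain ⟨R, hR1, hR⟩ := exists_invSqrt hT
  have hinj : Function.Injective R := fun f f' h =>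
    (hR f).unique_left (h ▸ hR f')
  have hn (x : L2 d) : (inner ℂ x x).re = ‖x‖ ^ 2 := by
    rw [inner_self_eq_norm_sq_to_K]; norm_cast
  obtain ⟨f₁, hf₁⟩ := (mem_kinFormDomain_iff hT).1 hψ
  obtain ⟨e, he, f, hf, h⟩ := exists_ground_state hinj hR1 hKc (fun f g => by
      rw [(hK f g _ _ (hR f) (hR g)).2, ← inner_conj_symm, (hK g f _ _ (hR g) (hR f)).2,
        potForm_conj]) ⟨f₁, by
      rw [kinForm_eq hf₁ hf₁, ← (hK f₁ f₁ _ _ hf₁ hf₁).2, hf₁.unique (hR f₁)] at hneg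
      simpa only [Complex.add_re, Complex.sub_re, hn] using hneg⟩
  refine ⟨-e, by linarith, R f, fun h0 => hf (hinj (by rw [h0, map_zero])),
    (mem_kinFormDomain_iff hT).2 ⟨f, hR f⟩, fun φ hφ => ?_⟩
  obtain ⟨g, hg⟩ := (mem_kinFormDomain_iff hT).1 hφ
  obtain rfl := hg.unique (hR g)
  rw [kinForm_eq (hR g) (hR f), ← (hK g f _ _ (hR g) (hR f)).2, inner_smul_right]
  simpa using h g

end FormBounds

/-! ### Fourier integrals and the pointwise Bessel inequality -/

section FourierIntegral

variable {d : ℕ}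

/-- Fubini with the symmetric kernel exp(2πi⟨ξ, x⟩). The inverse transform is the Fourier integral
for the pairing -⟨ξ, x⟩. -/
theorem integral_fourierInv_smul_eq (g : SchwartzMap (RSpace d) ℂ) {h : RSpace d → ℂ}
    (hh : Integrable h) : ∫ ξ, (𝓕⁻ g : SchwartzMap (RSpace d) ℂ) ξ * h ξ = ∫ x, g x * 𝓕⁻ h x := by
  have h1 := VectorFourier.integral_fourierIntegral_smul_eq_flip (μ := volume) (ν := volume)
    (L := -innerₗ (RSpace d)) (f := g) (g := h) Real.continuous_fourierChar (by
      simp only [LinearMap.neg_apply, innerₗ_apply_apply]; fun_prop) g.integrable hh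
  simp only [smul_eq_mul] at h1
  rw [SchwartzMap.fourierInv_coe]
  convert! h1 using 3 with x x
  simp only [Real.fourierInv_eq, VectorFourier.fourierIntegral, LinearMap.flip_apply,
    LinearMap.neg_apply, innerₗ_apply_apply, neg_neg, real_inner_comm]

theorem integral_fourier_mul_eq {g h : RSpace d → ℂ} (hg : Integrable g) (hh : Integrable h) :
    ∫ ξ, 𝓕 g ξ * h ξ = ∫ x, g x * 𝓕 h x := by
  have h1 := VectorFourier.integral_fourierIntegral_smul_eq_flip (μ := volume) (ν := volume)
    (L := innerₗ (RSpace d)) (f := g) (g := h) Real.continuous_fourierChar (by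
      simp only [innerₗ_apply_apply]; fun_prop) hg hh
  simp only [smul_eq_mul] at h1
  convert! h1 using 3 with x x
  simp only [Real.fourier_eq, VectorFourier.fourierIntegral, LinearMap.flip_apply,
    innerₗ_apply_apply, real_inner_comm]

/-- A real test function as a complex valued Schwartz function. -/
theorem exists_schwartz_of_contDiff {g : RSpace d → ℝ} (hg : ContDiff ℝ (⊤ : ℕ∞) g)
    (hc : HasCompactSupport g) : ∃ G : SchwartzMap (RSpace d) ℂ, ∀ x, G x = (g x : ℂ) := by
  have h1 : HasCompactSupport fun x => (g x : ℂ) :=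
    hc.comp_left (g := fun t : ℝ => (t : ℂ)) Complex.ofReal_zero
  have h2 : ContDiff ℝ (⊤ : ℕ∞) fun x => (g x : ℂ) := Complex.ofRealCLM.contDiff.comp hg
  exact ⟨h1.toSchwartzMap h2, fun x => rfl⟩

theorem continuous_fourierInv {h : RSpace d → ℂ} (hh : Integrable h) : Continuous (𝓕⁻ h) := by
  have h1 := VectorFourier.fourierIntegral_continuous (μ := volume) (L := -innerₗ (RSpace d))
    Real.continuous_fourierChar (by
      simp only [LinearMap.neg_apply, innerₗ_apply_apply]; fun_prop) hh
  exact h1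

/-- The `L²` Fourier inverse of an integrable function is given by the Fourier integral. -/
theorem ae_eq_fourierInv_of_integrable {ψ : L2 d} {h : RSpace d → ℂ}
    (hψ : (𝓕 ψ : L2 d) =ᵐ[volume] h) (hh : Integrable h) : ψ =ᵐ[volume] 𝓕⁻ h := by
  refine ae_eq_of_integral_contDiff_smul_eq ((Lp.memLp ψ).locallyIntegrable (by norm_num))
    (continuous_fourierInv hh).locallyIntegrable fun g hg hc => ?_
  obtain ⟨G, hG⟩ := exists_schwartz_of_contDiff hg hc
  have h1 := Lp.fourierInv_toTemperedDistribution_eq (𝓕 ψ : L2 d)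
  rw [FourierTransform.fourierInv_fourier_eq] at h1
  have h2 := DFunLike.congr_fun h1 G
  rw [TemperedDistribution.fourierInv_apply, Lp.toTemperedDistribution_apply,
    Lp.toTemperedDistribution_apply] at h2
  have h3 : ∫ ξ, (𝓕⁻ G : SchwartzMap (RSpace d) ℂ) ξ • (𝓕 ψ : L2 d) ξ =
      ∫ ξ, (𝓕⁻ G : SchwartzMap (RSpace d) ℂ) ξ * h ξ := by
    refine integral_congr_ae ?_
    filter_upwards [hψ] with ξ hξ
    rw [hξ, smul_eq_mul]
  rw [h3, integral_fourierInv_smul_eq G hh] at h2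
  simp only [Complex.real_smul, ← hG]
  exact h2.symm

/-- Every test function is the Fourier transform of a Schwartz function, so moving the transform
onto f makes all integrals against test functions vanish. -/
theorem ae_eq_zero_of_fourier_eq_zero {f : RSpace d → ℂ} (hf : Integrable f)
    (h : ∀ ξ, 𝓕 f ξ = 0) : f =ᵐ[volume] 0 := by
  refine ae_eq_of_integral_contDiff_smul_eq (f' := (0 : RSpace d → ℂ)) hf.locallyIntegrable
    continuous_zero.locallyIntegrable fun g hg hc => ?_
  obtain ⟨G, hG⟩ := exists_schwartz_of_contDiff hg hc
  have h1 := integral_fourier_mul_eq (𝓕⁻ G : SchwartzMap (RSpace d) ℂ).integrable hf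
  rw [← SchwartzMap.fourier_coe, FourierTransform.fourier_fourierInv_eq] at h1
  simp only [Complex.real_smul, ← hG, h1, h, Pi.zero_apply, mul_zero]

theorem enorm_sq_eq_lintegral (f : L2 d) : ‖f‖ₑ ^ 2 = ∫⁻ x, ‖f x‖ₑ ^ 2 := by
  rw [Lp.enorm_def, eLpNorm_eq_lintegral_rpow_enorm_toReal (by norm_num) (by norm_num)]
  simp only [ENNReal.toReal_ofNat, ENNReal.rpow_ofNat]
  rw [← ENNReal.rpow_natCast, ← ENNReal.rpow_mul]
  norm_num

/-- Pointwise Bessel inequality for functions whose Fourier transforms are `k` times an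
orthonormal system. -/
theorem sum_enorm_sq_le_of_orthonormal {ι : Type*} [Fintype ι] {u b : ι → L2 d}
    (hu : Orthonormal ℂ u) {k : RSpace d → ℂ} (hk : Measurable k)
    (hb : ∀ i, (𝓕 (b i) : L2 d) =ᵐ[volume] fun ξ => k ξ * u i ξ) :
    ∀ᵐ x, ∑ i, ‖b i x‖ₑ ^ 2 ≤ ∫⁻ ξ, ‖k ξ‖ₑ ^ 2 := by
  rcases eq_or_ne (∫⁻ ξ, ‖k ξ‖ₑ ^ 2) ∞ with htop | htop
  · exact Eventually.of_forall fun x => htop ▸ le_top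
  have hmem := memLp_two_of_lintegral hk.aestronglyMeasurable htop.lt_top
  have hint : ∀ i, Integrable fun ξ => k ξ * u i ξ := fun i => hmem.integrable_mul (Lp.memLp (u i))
  filter_upwards [ae_all_iff.2 fun i => ae_eq_fourierInv_of_integrable (hb i) (hint i)] with x hx
  have hmx : MemLp (fun ξ => conj (Real.fourierChar (inner ℝ ξ x) * k ξ : ℂ)) 2 volume := by
    refine hmem.of_le ?_ (Eventually.of_forall fun ξ => by
      rw [RCLike.norm_conj, norm_mul, Circle.norm_coe, one_mul])
    refine Complex.continuous_conj.comp_aestronglyMeasurable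
      (AEStronglyMeasurable.mul (Continuous.aestronglyMeasurable ?_) hk.aestronglyMeasurable)
    exact continuous_subtype_val.comp (Real.continuous_fourierChar.comp (by fun_prop))
  -- Fourier inversion at the fixed point x is an inner product of u i with a vector of squared norm
  -- ∫ |k|², whatever x is. Bessel's inequality then applies.
  have hinner : ∀ i, b i x = inner ℂ (hmx.toLp _) (u i) := by
    intro i
    rw [hx i, Real.fourierInv_eq, L2.inner_def]
    refine integral_congr_ae ?_
    filter_upwards [hmx.coeFn_toLp] with ξ h1
    rw [h1, RCLike.inner_apply, Complex.conj_conj, Circle.smul_def, smul_eq_mul]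
    ring
  have hbess := hu.sum_inner_products_le (s := Finset.univ) (hmx.toLp _)
  have h2 : ∫⁻ ξ, ‖k ξ‖ₑ ^ 2 = ‖hmx.toLp _‖ₑ ^ 2 := by
    rw [enorm_sq_eq_lintegral]
    refine lintegral_congr_ae ?_
    filter_upwards [hmx.coeFn_toLp] with ξ h1
    rw [h1, enorm_eq_nnnorm, enorm_eq_nnnorm]
    congr 2
    ext
    rw [coe_nnnorm, coe_nnnorm, RCLike.norm_conj, norm_mul, Circle.norm_coe, one_mul]
  rw [h2]
  have h3 : ∀ i, ‖b i x‖ₑ ^ 2 = ENNReal.ofReal (‖inner ℂ (u i) (hmx.toLp _)‖ ^ 2) := by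
    intro i
    rw [hinner i, ← norm_inner_symm, ENNReal.ofReal_pow (norm_nonneg _), ofReal_norm]
  simp_rw [h3]
  rw [← ENNReal.ofReal_sum_of_nonneg (fun _ _ => by positivity), ← ofReal_norm,
    ← ENNReal.ofReal_pow (norm_nonneg _)]
  exact ENNReal.ofReal_le_ofReal hbess

end FourierIntegral

/-! ### Cwikel's dyadic decomposition -/

section CwikelBound

variable {d : ℕ}

theorem lintegral_comp_two_pi_smul {F : RSpace d → ℝ≥0∞} (hF : Measurable F) :
    ∫⁻ ξ, F ((2 * Real.pi) • ξ) = (∫⁻ η, F η) / ENNReal.ofReal ((2 * Real.pi) ^ d) := by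
  have hpi : (0 : ℝ) < 2 * Real.pi := by positivity
  rw [← lintegral_map hF (measurable_const_smul _),
    Measure.map_addHaar_smul volume hpi.ne', lintegral_smul_measure, finrank_euclideanSpace_fin,
    abs_of_pos (by positivity), ENNReal.ofReal_inv_of_pos (by positivity), smul_eq_mul, mul_comm,
    div_eq_mul_inv]

/-- If 2^m ≤ y < 2^(m+1), only k ≤ m contribute, and the geometric series sums to 2^(m+2) ≤ 4y. -/
theorem tsum_zpow_le (y : ℝ≥0) :
    ∑' k : ℤ, (if (2 : ℝ≥0∞) ^ k ≤ y then (2 : ℝ≥0∞) ^ (k + 1) else 0) ≤ 4 * y := by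
  rcases eq_or_ne y 0 with rfl | hy
  · have h0 : ∀ k : ℤ, (2 : ℝ≥0∞) ^ k ≠ 0 := fun k =>
      (ENNReal.zpow_pos (a := 2) (by norm_num) (by norm_num) k).ne'
    simp [h0]
  obtain ⟨m, hm1, hm2⟩ := ENNReal.exists_mem_Ico_zpow (x := (y : ℝ≥0∞)) (y := 2)
    (by exact_mod_cast hy) ENNReal.coe_ne_top (by norm_num) (by norm_num)
  have hinj : Function.Injective fun j : ℕ => m - (j : ℤ) := fun i j h => by
    simpa using h
  rw [← hinj.tsum_eq]
  · have h1 : ∀ j : ℕ, (if (2 : ℝ≥0∞) ^ (m - (j : ℤ)) ≤ y then (2 : ℝ≥0∞) ^ (m - (j : ℤ) + 1) else 0)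
        ≤ (2 : ℝ≥0∞) ^ (m + 1) * (2 : ℝ≥0∞)⁻¹ ^ j := by
      intro j
      split_ifs
      · rw [show m - (j : ℤ) + 1 = (m + 1) + (-(j : ℤ)) by ring,
          ENNReal.zpow_add (by norm_num) (by norm_num), ENNReal.zpow_neg, zpow_natCast, ENNReal.inv_pow]
      · exact zero_le
    refine (ENNReal.tsum_le_tsum h1).trans ?_
    rw [ENNReal.tsum_mul_left, ENNReal.tsum_geometric, ENNReal.one_sub_inv_two, inv_inv,
      ENNReal.zpow_add (by norm_num) (by norm_num), zpow_one]
    calc (2 : ℝ≥0∞) ^ m * 2 * 2 = 4 * 2 ^ m := by ring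
      _ ≤ 4 * y := by gcongr
  · intro k hk
    rw [Function.mem_support] at hk
    have hk' : (2 : ℝ≥0∞) ^ k ≤ y := by
      by_contra h
      simp [h] at hk
    have : k ≤ m := by
      by_contra hlt
      have h2 : (2 : ℝ≥0∞) ^ (m + 1) ≤ 2 ^ k := ENNReal.zpow_le_of_le (by norm_num) (by omega)
      exact absurd (h2.trans hk') (not_le.2 hm2)
    exact ⟨(m - k).toNat, by simp [Int.toNat_of_nonneg (sub_nonneg.2 this)]⟩

theorem enorm_sqrt_sq (s : ℝ≥0) : ‖((Real.sqrt (s : ℝ) : ℝ) : ℂ)‖ₑ ^ 2 = s := by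
  rw [enorm_eq_nnnorm, ← ENNReal.coe_pow]
  congr 1
  rw [← NNReal.coe_inj]
  rw [NNReal.coe_pow, coe_nnnorm, Complex.norm_real, Real.norm_of_nonneg (by positivity),
    Real.sq_sqrt (by positivity)]

/-- The dyadic layers of a nonnegative function. -/
def dyadicLayer (W : RSpace d → ℝ≥0∞) (k : ℤ) : Set (RSpace d) :=
  W ⁻¹' Ico ((2 : ℝ≥0∞) ^ k) ((2 : ℝ≥0∞) ^ (k + 1))

theorem measurableSet_dyadicLayer {W : RSpace d → ℝ≥0∞} (hW : Measurable W) (k : ℤ) :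
    MeasurableSet (dyadicLayer W k) := hW measurableSet_Ico

theorem lintegral_eq_tsum_dyadicLayer {W : RSpace d → ℝ≥0∞} (hW : Measurable W)
    (hfin : ∀ x, W x ≠ ∞) (f : RSpace d → ℝ≥0∞) :
    ∫⁻ x, W x * f x = ∑' k, ∫⁻ x in dyadicLayer W k, W x * f x := by
  have hd : Pairwise (Function.onFun Disjoint (dyadicLayer W)) := by
    have key : ∀ k l : ℤ, k < l → Disjoint (dyadicLayer W k) (dyadicLayer W l) := by
      intro k l hkl
      refine Set.disjoint_left.2 fun x hx hx' => ?_
      have h2 : (2 : ℝ≥0∞) ^ (k + 1) ≤ 2 ^ l := ENNReal.zpow_le_of_le (by norm_num) (by omega)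
      exact absurd (h2.trans hx'.1) (not_le.2 hx.2)
    intro k l hkl
    rcases lt_or_gt_of_ne hkl with h | h
    · exact key k l h
    · exact (key l k h).symm
  rw [← lintegral_iUnion (measurableSet_dyadicLayer hW) hd,
    ← lintegral_indicator (MeasurableSet.iUnion (measurableSet_dyadicLayer hW))]
  congr 1
  ext x
  by_cases hx : x ∈ ⋃ k, dyadicLayer W k
  · rw [indicator_of_mem hx]
  · rw [indicator_of_notMem hx]
    have : W x = 0 := by
      by_contra h0
      obtain ⟨k, hk⟩ := ENNReal.exists_mem_Ico_zpow (y := 2) h0 (hfin x) (by norm_num) (by norm_num)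
      exact hx (mem_iUnion.2 ⟨k, hk⟩)
    rw [this, zero_mul]

/-- Cauchy–Schwarz with weights t and 1 - t: for the norms, the deficit is ((1-t)‖x‖ -
t‖y‖)²/(t(1-t)). -/
theorem enorm_add_sq_le (x y : ℂ) {t : ℝ} (h0 : 0 < t) (h1 : t < 1) :
    ‖x + y‖ₑ ^ 2 ≤ ENNReal.ofReal t⁻¹ * ‖x‖ₑ ^ 2 + ENNReal.ofReal (1 - t)⁻¹ * ‖y‖ₑ ^ 2 := by
  have h1' : 0 < 1 - t := by linarith
  simp only [← ofReal_norm]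
  rw [← ENNReal.ofReal_pow (norm_nonneg _), ← ENNReal.ofReal_pow (norm_nonneg _),
    ← ENNReal.ofReal_pow (norm_nonneg _), ← ENNReal.ofReal_mul (by positivity),
    ← ENNReal.ofReal_mul (by positivity), ← ENNReal.ofReal_add (by positivity) (by positivity)]
  apply ENNReal.ofReal_le_ofReal
  have h2 : ‖x + y‖ ^ 2 ≤ (‖x‖ + ‖y‖) ^ 2 := by
    gcongr
    exact norm_add_le _ _
  refine h2.trans ?_
  have h3 : t⁻¹ * ‖x‖ ^ 2 + (1 - t)⁻¹ * ‖y‖ ^ 2 - (‖x‖ + ‖y‖) ^ 2 =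
      ((1 - t) * ‖x‖ - t * ‖y‖) ^ 2 / (t * (1 - t)) := by
    field_simp
    ring
  have : 0 ≤ ((1 - t) * ‖x‖ - t * ‖y‖) ^ 2 / (t * (1 - t)) := by positivity
  linarith

variable {T : RSpace d → ℝ≥0}

/-- The high frequency part in the dyadic decomposition is small. -/
theorem tsum_lintegral_highpass_le (hT : Measurable T) {W : RSpace d → ℝ≥0∞} (hW : Measurable W)
    {a : ℝ≥0} {ψ u : L2 d}
    (hu : ∀ᵐ ξ, u ξ = ((Real.sqrt (T ((2 * Real.pi) • ξ) : ℝ) : ℝ) : ℂ) * (𝓕 ψ : L2 d) ξ)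
    {p : ℤ → L2 d}
    (hp : ∀ k, ∀ᵐ ξ, (𝓕 (p k) : L2 d) ξ =
      (if (2 : ℝ≥0∞) ^ k ≤ a * T ((2 * Real.pi) • ξ) then 1 else 0) * (𝓕 ψ : L2 d) ξ) :
    ∑' k, ∫⁻ x in dyadicLayer W k, W x * ‖p k x‖ₑ ^ 2 ≤ 4 * a * ‖u‖ₑ ^ 2 := by
  have hτ := measurable_freqSymbol hT
  have h1 : ∀ k, ∫⁻ x in dyadicLayer W k, W x * ‖p k x‖ₑ ^ 2 ≤
      ∫⁻ ξ, (if (2 : ℝ≥0∞) ^ k ≤ ((a * T ((2 * Real.pi) • ξ) : ℝ≥0) : ℝ≥0∞)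
        then (2 : ℝ≥0∞) ^ (k + 1) else 0) * ‖(𝓕 ψ : L2 d) ξ‖ₑ ^ 2 := by
    intro k
    calc ∫⁻ x in dyadicLayer W k, W x * ‖p k x‖ₑ ^ 2
        ≤ ∫⁻ x in dyadicLayer W k, (2 : ℝ≥0∞) ^ (k + 1) * ‖p k x‖ₑ ^ 2 := by
          refine setLIntegral_mono' (measurableSet_dyadicLayer hW k) fun x hx => ?_
          gcongr
          exact hx.2.le
      _ ≤ ∫⁻ x, (2 : ℝ≥0∞) ^ (k + 1) * ‖p k x‖ₑ ^ 2 := setLIntegral_le_lintegral _ _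
      _ = (2 : ℝ≥0∞) ^ (k + 1) * ∫⁻ ξ, ‖(𝓕 (p k) : L2 d) ξ‖ₑ ^ 2 := by
          rw [lintegral_const_mul' _ _ (ENNReal.zpow_ne_top (by norm_num) (by norm_num) _),
            ← enorm_sq_eq_lintegral, ← enorm_sq_eq_lintegral, ← ofReal_norm, ← ofReal_norm,
            Lp.norm_fourier_eq]
      _ = ∫⁻ ξ, (2 : ℝ≥0∞) ^ (k + 1) * ‖(𝓕 (p k) : L2 d) ξ‖ₑ ^ 2 := by
          rw [lintegral_const_mul' _ _ (ENNReal.zpow_ne_top (by norm_num) (by norm_num) _)]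
      _ ≤ _ := by
          refine lintegral_mono_ae ?_
          filter_upwards [hp k] with ξ hξ
          rw [hξ, ENNReal.coe_mul]
          split_ifs <;> simp
  refine (ENNReal.tsum_le_tsum h1).trans ?_
  rw [← lintegral_tsum]
  · rw [enorm_sq_eq_lintegral, ← lintegral_const_mul' _ _ (by finiteness)]
    refine lintegral_mono_ae ?_
    filter_upwards [hu] with ξ hξ
    rw [ENNReal.tsum_mul_right, hξ, enorm_mul, mul_pow]
    rw [enorm_sqrt_sq, ← mul_assoc]
    gcongr
    refine (tsum_zpow_le _).trans ?_
    push_cast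
    rw [mul_assoc]
  · intro k
    refine AEMeasurable.mul (Measurable.aemeasurable ?_)
      ((Lp.aestronglyMeasurable _).enorm.pow_const 2)
    exact Measurable.ite (measurableSet_le measurable_const (hτ.const_mul a).coe_nnreal_ennreal)
      measurable_const measurable_const

/-- Cwikel's argument: the size of an orthonormal system (in the kinetic energy inner product) on
which the potential energy dominates. -/
theorem card_le_of_orthonormal (hT : Measurable T) (hpos : ∀ᵐ ξ, T ((2 * Real.pi) • ξ) ≠ 0)
    {W : RSpace d → ℝ≥0∞} (hW : Measurable W) (hfin : ∀ x, W x ≠ ∞)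
    {ι : Type*} [Fintype ι] {u ψ : ι → L2 d} (hu : Orthonormal ℂ u)
    (huψ : ∀ i, ∀ᵐ ξ, u i ξ =
      ((Real.sqrt (T ((2 * Real.pi) • ξ) : ℝ) : ℝ) : ℂ) * (𝓕 (ψ i) : L2 d) ξ)
    (h1 : ∀ i, 1 ≤ ∫⁻ x, W x * ‖ψ i x‖ₑ ^ 2) {α : ℝ} (hα : 0 < α) (hα' : α < 1 / 4) :
    (Fintype.card ι : ℝ≥0∞) ≤ ∫⁻ x, ENNReal.ofReal (α ^ 2 / (1 - 4 * α) ^ 2) *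
      bigG T (W x / ENNReal.ofReal (α ^ 2)) := by
  have hτ := measurable_freqSymbol hT
  -- With a = α² the high frequencies cost t⁻¹ · 4α² = α. What is left for the low frequencies is
  -- (1-α)(1-t), which is at least (1-t)²; this is where (1-4α)² comes from.
  set t := 4 * α with ht
  have ht0 : 0 < t := by linarith
  have ht1 : t < 1 := by linarith
  have ht1' : 0 < 1 - t := by linarith
  set a : ℝ≥0 := Real.toNNReal (α ^ 2) with ha
  have haR : (a : ℝ) = α ^ 2 := Real.coe_toNNReal _ (by positivity)
  have ha0 : a ≠ 0 := by
    rw [← NNReal.coe_ne_zero, haR]; positivity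
  have hP : ∀ k : ℤ, ∃ P : L2 d →L[ℂ] L2 d, (∀ f, ‖P f‖ ≤ ‖f‖) ∧
      ∀ f, (𝓕 (P f) : L2 d) =ᵐ[volume] fun ξ =>
        (if (2 : ℝ≥0∞) ^ k ≤ a * T ((2 * Real.pi) • ξ) then 1 else 0) * (𝓕 f : L2 d) ξ := by
    intro k
    refine exists_fourierMultiplier ?_ fun ξ => by split_ifs <;> simp
    exact Measurable.ite (measurableSet_le measurable_const
      (hτ.coe_nnreal_ennreal.const_mul (a : ℝ≥0∞))) measurable_const measurable_const
  choose P _ hP using hP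
  -- The symbol that recovers the low frequency part of ψ i from the orthonormal vector u i = √T ψ̂
  -- i; the squared norm of κ k is ∫ 1/T over {a T < 2^k}.
  set κ : ℤ → RSpace d → ℂ := fun k ξ =>
    if (2 : ℝ≥0∞) ^ k ≤ a * T ((2 * Real.pi) • ξ) then 0 else
      (((Real.sqrt (T ((2 * Real.pi) • ξ) : ℝ))⁻¹ : ℝ) : ℂ) with hκ
  have hκm : ∀ k, Measurable (κ k) := fun k =>
    Measurable.ite (measurableSet_le measurable_const
      (hτ.coe_nnreal_ennreal.const_mul (a : ℝ≥0∞))) measurable_const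
      (Complex.measurable_ofReal.comp
        ((Real.continuous_sqrt.measurable.comp hτ.coe_nnreal_real).inv))
  have hκ2 : ∀ k, ∀ᵐ ξ, ‖κ k ξ‖ₑ ^ 2 = if (2 : ℝ≥0∞) ^ k ≤ a * T ((2 * Real.pi) • ξ) then 0 else
      (T ((2 * Real.pi) • ξ) : ℝ≥0∞)⁻¹ := by
    intro k
    filter_upwards [hpos] with ξ hξ
    simp only [hκ]
    split_ifs
    · simp
    · rw [← Real.sqrt_inv, ← NNReal.coe_inv, enorm_sqrt_sq, ENNReal.coe_inv hξ]
  have hb : ∀ k i, (𝓕 (ψ i - P k (ψ i)) : L2 d) =ᵐ[volume] fun ξ => κ k ξ * u i ξ := by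
    intro k i
    filter_upwards [coeFn_fourier_sub (ψ i) (P k (ψ i)), hP k (ψ i), huψ i, hpos] with ξ h1 h2 h3 h4
    rw [h1, h2, h3]
    simp only [hκ]
    have h5 : (((Real.sqrt (T ((2 * Real.pi) • ξ) : ℝ))⁻¹ : ℝ) : ℂ) *
        ((Real.sqrt (T ((2 * Real.pi) • ξ) : ℝ) : ℝ) : ℂ) = 1 := by
      have : Real.sqrt (T ((2 * Real.pi) • ξ) : ℝ) ≠ 0 := by
        rw [Real.sqrt_ne_zero (by positivity)]
        exact_mod_cast h4
      rw [← Complex.ofReal_mul, inv_mul_cancel₀ this, Complex.ofReal_one]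
    split_ifs
    · simp
    · rw [← mul_assoc, h5]; ring
  set c : ℝ≥0∞ → ℝ≥0∞ := fun w => ∫⁻ ξ, if (a * T ((2 * Real.pi) • ξ) : ℝ≥0∞) < w then
      (T ((2 * Real.pi) • ξ) : ℝ≥0∞)⁻¹ else 0 with hc
  set Hs : ι → ℝ≥0∞ := fun i => ∑' k, ∫⁻ x in dyadicLayer W k, W x * ‖(ψ i - P k (ψ i)) x‖ₑ ^ 2
  have hHlow : ∀ i, ENNReal.ofReal ((1 - t) ^ 2) ≤ Hs i := by
    intro i
    have hsplit : ∀ k, ∫⁻ x in dyadicLayer W k, W x * ‖ψ i x‖ₑ ^ 2 ≤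
        ENNReal.ofReal t⁻¹ * (∫⁻ x in dyadicLayer W k, W x * ‖P k (ψ i) x‖ₑ ^ 2) +
        ENNReal.ofReal (1 - t)⁻¹ *
          ∫⁻ x in dyadicLayer W k, W x * ‖(ψ i - P k (ψ i)) x‖ₑ ^ 2 := by
      intro k
      rw [← lintegral_const_mul' _ _ (by finiteness), ← lintegral_const_mul' _ _ (by finiteness),
        ← lintegral_add_left']
      · refine lintegral_mono_ae (ae_restrict_of_ae ?_)
        filter_upwards [Lp.coeFn_sub (ψ i) (P k (ψ i))] with x hx
        have h2 : ψ i x = P k (ψ i) x + (ψ i - P k (ψ i)) x := by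
          rw [hx, Pi.sub_apply]; ring
        calc W x * ‖ψ i x‖ₑ ^ 2 ≤ W x * (ENNReal.ofReal t⁻¹ * ‖P k (ψ i) x‖ₑ ^ 2 +
              ENNReal.ofReal (1 - t)⁻¹ * ‖(ψ i - P k (ψ i)) x‖ₑ ^ 2) := by
              gcongr
              conv_lhs => rw [h2]
              exact enorm_add_sq_le _ _ ht0 ht1
          _ = _ := by ring
      · exact ((hW.aemeasurable.mul
          ((Lp.aestronglyMeasurable _).enorm.pow_const 2)).const_mul _).restrict
    have hsum : (1 : ℝ≥0∞) ≤ ENNReal.ofReal t⁻¹ * (4 * a * ‖u i‖ₑ ^ 2) +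
        ENNReal.ofReal (1 - t)⁻¹ * Hs i := by
      refine (h1 i).trans ?_
      rw [lintegral_eq_tsum_dyadicLayer hW hfin]
      refine (ENNReal.tsum_le_tsum hsplit).trans ?_
      rw [ENNReal.tsum_add, ENNReal.tsum_mul_left, ENNReal.tsum_mul_left]
      gcongr
      exact tsum_lintegral_highpass_le hT hW (huψ i) (fun k => hP k (ψ i))
    rcases eq_or_ne (Hs i) ∞ with htop | htop
    · rw [htop]; exact le_top
    have hn : ‖u i‖ₑ = 1 := by
      rw [← ofReal_norm, hu.1 i, ENNReal.ofReal_one]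
    rw [hn, one_pow, mul_one] at hsum
    rw [← ENNReal.ofReal_toReal htop] at hsum ⊢
    apply ENNReal.ofReal_le_ofReal
    have h4 : (4 * a : ℝ≥0∞) = ENNReal.ofReal (4 * α ^ 2) := by
      rw [ENNReal.ofReal_mul (by norm_num), ha]
      simp [ENNReal.ofReal]
    rw [h4, ← ENNReal.ofReal_mul (by positivity), ← ENNReal.ofReal_mul (by positivity),
      ← ENNReal.ofReal_add (by positivity) (by positivity), ← ENNReal.ofReal_one,
      ENNReal.ofReal_le_ofReal_iff (by positivity)] at hsum
    have h5 : t⁻¹ * (4 * α ^ 2) = α := by rw [ht]; field_simp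
    rw [h5] at hsum
    have h6 : (1 - α) * (1 - t) ≤ (Hs i).toReal := by
      have : (1 - t)⁻¹ * (Hs i).toReal * (1 - t) = (Hs i).toReal := by field_simp
      nlinarith
    nlinarith
  -- On the layer k one has 2^k ≤ W x, so the low frequency region {a T < 2^k} lies in {a T < W x}
  -- and the Bessel bound there is at most c (W x).
  have hHup : ∑ i, Hs i ≤ ∫⁻ x, W x * c (W x) := by
    rw [lintegral_eq_tsum_dyadicLayer hW hfin, ← Summable.tsum_finsetSum (fun _ _ => ENNReal.summable)]
    refine ENNReal.tsum_le_tsum fun k => ?_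
    rw [← lintegral_finsetSum']
    · refine lintegral_mono_ae ?_
      filter_upwards [ae_restrict_of_ae (sum_enorm_sq_le_of_orthonormal hu (hκm k) (hb k)),
        ae_restrict_mem (measurableSet_dyadicLayer hW k)] with x hx hxk
      rw [← Finset.mul_sum]
      gcongr
      refine hx.trans ?_
      rw [lintegral_congr_ae (hκ2 k), hc]
      refine lintegral_mono fun ξ => ?_
      by_cases h : (2 : ℝ≥0∞) ^ k ≤ a * T ((2 * Real.pi) • ξ)
      · simp [h]
      · simp only [h, if_false]
        rw [if_pos ((not_le.1 h).trans_le hxk.1)]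
    · intro i _
      exact (hW.aemeasurable.mul ((Lp.aestronglyMeasurable _).enorm.pow_const 2)).restrict
  have hcG : ∀ w : ℝ≥0∞, c w = intInv T {η | (T η : ℝ≥0∞) < w / ENNReal.ofReal (α ^ 2)} /
      ENNReal.ofReal ((2 * Real.pi) ^ d) := by
    intro w
    have haE : ENNReal.ofReal (α ^ 2) = a := rfl
    have hms : MeasurableSet {η | (T η : ℝ≥0∞) < w / a} :=
      measurableSet_lt hT.coe_nnreal_ennreal measurable_const
    rw [haE, intInv, ← lintegral_indicator hms, ← lintegral_comp_two_pi_smul]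
    · rw [hc]
      refine lintegral_congr fun ξ => ?_
      simp only [indicator_apply, mem_ofPred_eq]
      simp only [ENNReal.lt_div_iff_mul_lt (Or.inl (by exact_mod_cast ha0)) (Or.inl ENNReal.coe_ne_top),
        mul_comm (a : ℝ≥0∞)]
    · exact Measurable.indicator hT.coe_nnreal_ennreal.inv hms
  have hfinal : ENNReal.ofReal ((1 - t) ^ 2) * (Fintype.card ι : ℝ≥0∞) ≤ ∫⁻ x, W x * c (W x) := by
    refine le_trans ?_ hHup
    calc ENNReal.ofReal ((1 - t) ^ 2) * (Fintype.card ι : ℝ≥0∞)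
        = ∑ i : ι, ENNReal.ofReal ((1 - t) ^ 2) := by simp [mul_comm]
      _ ≤ _ := Finset.sum_le_sum fun i _ => hHlow i
  -- The prefactor u = W/α² inside G cancels the factor α² in front.
  have hpt : ∀ x, ENNReal.ofReal (α ^ 2 / (1 - t) ^ 2) * bigG T (W x / ENNReal.ofReal (α ^ 2)) =
      ENNReal.ofReal (((1 - t) ^ 2)⁻¹) * (W x * c (W x)) := by
    intro x
    have haE : ENNReal.ofReal (α ^ 2) ≠ 0 := by simpa using hα.ne'
    rw [bigG, hcG, div_eq_inv_mul (α ^ 2), ENNReal.ofReal_mul (by positivity), mul_assoc,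
      ← mul_assoc (ENNReal.ofReal (α ^ 2)), ENNReal.mul_div_cancel haE ENNReal.ofReal_ne_top]
  simp_rw [hpt]
  rw [lintegral_const_mul' _ _ (by finiteness), ENNReal.ofReal_inv_of_pos (by positivity)]
  rw [← ENNReal.mul_le_iff_le_inv (by simpa using ht1'.ne') ENNReal.ofReal_ne_top]
  exact hfinal

end CwikelBound

/-! ### Counting negative eigenvalues -/

section EigenvalueCount

/-- Orthonormalization that keeps track of coefficients: the basis vectors of the range are returned
through preimages, which can be fed into another linear map. -/
theorem exists_orthonormal_range {H : Type*} [NormedAddCommGroup H] [InnerProductSpace ℂ H]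
    {ι : Type*} [Fintype ι] (f : (ι → ℂ) →ₗ[ℂ] H) (hf : Function.Injective f) :
    ∃ c : Fin (Fintype.card ι) → (ι → ℂ), Orthonormal ℂ fun i => f (c i) := by
  have hrank : Module.finrank ℂ (LinearMap.range f) = Fintype.card ι := by
    rw [LinearMap.finrank_range_of_inj hf, Module.finrank_fintype_fun_eq_card]
  let b := (stdOrthonormalBasis ℂ (LinearMap.range f)).reindex (finCongr hrank)
  choose c hc using fun i => (b i).2
  refine ⟨c, ?_⟩
  simp_rw [hc]
  exact b.orthonormal.comp_linearIsometry (LinearMap.range f).subtypeₗᵢ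

theorem ofReal_integral_le_lintegral_ofReal {X : Type*} [MeasurableSpace X] {μ : Measure X}
    {f : X → ℝ} (hf : Integrable f μ) :
    ENNReal.ofReal (∫ x, f x ∂μ) ≤ ∫⁻ x, ENNReal.ofReal (f x) ∂μ := by
  rw [integral_eq_lintegral_pos_part_sub_lintegral_neg_part hf]
  exact (ENNReal.ofReal_le_ofReal (sub_le_self _ ENNReal.toReal_nonneg)).trans
    ENNReal.ofReal_toReal_le

variable {d : ℕ} {T : RSpace d → ℝ≥0} {V : RSpace d → ℝ}

/-- The operator `T(p) + V` in terms of bounded operators. -/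
theorem opApply_iff (hT : Measurable T) {R : L2 d →L[ℂ] L2 d} (hR : ∀ f, IsInvSqrtApply T f (R f))
    {K : L2 d →L[ℂ] L2 d} (hK : ∀ f g φ ψ : L2 d, IsInvSqrtApply T f φ → IsInvSqrtApply T g ψ →
      Integrable (fun x => |V x| * (‖φ x‖ * ‖ψ x‖)) ∧ inner ℂ f (K g) = potForm V φ ψ)
    {ψ χ : L2 d} : OpApply T V ψ χ ↔ ∃ g, R g = ψ ∧
      ∀ f, inner ℂ f g - inner ℂ (R f) (R g) + inner ℂ f (K g) = inner ℂ (R f) χ := by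
  constructor
  · rintro ⟨hψ, h⟩
    obtain ⟨g, hg⟩ := (mem_kinFormDomain_iff hT).1 hψ
    obtain rfl := hg.unique (hR g)
    refine ⟨g, rfl, fun f => ?_⟩
    rw [← h _ ((mem_kinFormDomain_iff hT).2 ⟨f, hR f⟩), kinForm_eq (hR f) (hR g),
      (hK f g _ _ (hR f) (hR g)).2]
  · rintro ⟨g, rfl, h⟩
    refine ⟨(mem_kinFormDomain_iff hT).2 ⟨g, hR g⟩, fun φ hφ => ?_⟩
    obtain ⟨f, hf⟩ := (mem_kinFormDomain_iff hT).1 hφ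
    obtain rfl := hf.unique (hR f)
    rw [← h f, kinForm_eq (hR f) (hR g), (hK f g _ _ (hR f) (hR g)).2]

/-- Both forms are Hermitian, so testing each eigenvalue equation with the other eigenfunction gives
(E' - E)⟨ψ', ψ⟩ = 0. -/
theorem OpApply.orthogonal {ψ ψ' : L2 d} {E E' : ℝ} (hE : E ≠ E')
    (h : OpApply T V ψ ((E : ℂ) • ψ)) (h' : OpApply T V ψ' ((E' : ℂ) • ψ')) :
    inner ℂ ψ ψ' = 0 := by
  have h1 := h.2 ψ' h'.1
  have h2 := h'.2 ψ h.1
  rw [← potForm_conj, ← kinForm_conj, ← map_add, h2, inner_smul_right, inner_smul_right, map_mul,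
    Complex.conj_ofReal, inner_conj_symm] at h1
  have h3 : ((E' : ℂ) - E) * inner ℂ ψ' ψ = 0 := by linear_combination h1
  rcases mul_eq_zero.1 h3 with h4 | h4
  · exact absurd (by exact_mod_cast (sub_eq_zero.1 h4).symm) hE
  · rw [← inner_conj_symm, h4, map_zero]

/-- The eigenspace is already a subspace, so the span in `eigMult` adds nothing. Allowing every n up
to the multiplicity covers infinite multiplicity too. -/
theorem exists_orthonormal_of_le_eigMult (hT : Measurable T) (hVm : Measurable V)
    (hV : RelFormCompact T V) {E : ℝ} {n : ℕ} (hn : (n : ℕ∞) ≤ eigMult T V E) :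
    ∃ e : Fin n → L2 d, Orthonormal ℂ e ∧ ∀ i, OpApply T V (e i) ((E : ℂ) • e i) := by
  obtain ⟨K, -, hK⟩ := hV.exists_compact hT hVm (Eventually.of_forall fun _ => le_rfl)
  obtain ⟨R, -, hR⟩ := exists_invSqrt hT
  let S : Submodule ℂ (L2 d) :=
    { carrier := {ψ | OpApply T V ψ ((E : ℂ) • ψ)}
      zero_mem' := (opApply_iff hT hR hK).2 ⟨0, by simp, by simp⟩
      add_mem' := by
        intro ψ ψ' h h'
        obtain ⟨g, rfl, h⟩ := (opApply_iff hT hR hK).1 h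
        obtain ⟨g', rfl, h'⟩ := (opApply_iff hT hR hK).1 h'
        refine (opApply_iff hT hR hK).2 ⟨g + g', map_add _ _ _, fun f => ?_⟩
        have h1 := h f
        have h2 := h' f
        simp only [map_add, inner_add_right, smul_add] at h1 h2 ⊢
        linear_combination h1 + h2
      smul_mem' := by
        intro c ψ h
        obtain ⟨g, rfl, h⟩ := (opApply_iff hT hR hK).1 h
        refine (opApply_iff hT hR hK).2 ⟨c • g, map_smul _ _ _, fun f => ?_⟩
        have h1 := h f
        simp only [map_smul, inner_smul_right] at h1 ⊢
        linear_combination c * h1 }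
  have hS : Submodule.span ℂ {ψ : L2 d | OpApply T V ψ ((E : ℂ) • ψ)} = S := Submodule.span_eq S
  rw [eigMult, hS, Cardinal.natCast_le_toENat, Module.le_rank_iff_exists_linearMap] at hn
  obtain ⟨f, hf⟩ := hn
  obtain ⟨c, hc⟩ := exists_orthonormal_range (S.subtype ∘ₗ f) (S.injective_subtype.comp hf)
  have hcard : n = Fintype.card (Fin n) := (Fintype.card_fin n).symm
  exact ⟨fun i => f (c (finCongr hcard i)), hc.comp _ (finCongr hcard).injective,
    fun i => (f (c (finCongr hcard i))).2⟩

/-- The bound on the number of members of an orthonormal family of eigenfunctions. -/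
theorem card_eigenfunctions_le (hT : Measurable T) (hpos : ∀ᵐ ξ, T ((2 * Real.pi) • ξ) ≠ 0)
    (hVm : Measurable V) (hV : RelFormCompact T V) {ι : Type*} [Fintype ι] {e : ι → L2 d}
    (he : Orthonormal ℂ e) {E : ι → ℝ} (hE : ∀ i, E i < 0)
    (hop : ∀ i, OpApply T V (e i) ((E i : ℂ) • e i)) {α : ℝ} (hα : 0 < α) (hα' : α < 1 / 4) :
    (Fintype.card ι : ℝ≥0∞) ≤ ∫⁻ x, ENNReal.ofReal (α ^ 2 / (1 - 4 * α) ^ 2) *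
      bigG T (ENNReal.ofReal (max 0 (-V x)) / ENNReal.ofReal (α ^ 2)) := by
  have hτ := measurable_freqSymbol hT
  obtain ⟨K, -, hK⟩ := hV.exists_compact hT hVm (Eventually.of_forall fun _ => le_rfl)
  obtain ⟨R, -, hR⟩ := exists_invSqrt hT
  choose g hg hgop using fun i => (opApply_iff hT hR hK).1 (hop i)
  -- M has symbol √(T/(T+1)), so M f is √T(p) applied to R f and the squared norm of M f is the
  -- kinetic energy of R f.
  obtain ⟨M, -, hM⟩ := exists_fourierMultiplier (d := d) (m := fun ξ =>
      ((Real.sqrt (T ((2 * Real.pi) • ξ) : ℝ) *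
        (Real.sqrt ((T ((2 * Real.pi) • ξ) : ℝ) + 1))⁻¹ : ℝ) : ℂ))
    (Complex.measurable_ofReal.comp ((Real.continuous_sqrt.measurable.comp hτ.coe_nnreal_real).mul
      ((Real.continuous_sqrt.measurable.comp (hτ.coe_nnreal_real.add_const 1)).inv)))
    (fun ξ => by
      rw [Complex.norm_real, Real.norm_of_nonneg (by positivity), ← div_eq_mul_inv]
      exact div_le_one_of_le₀ (Real.sqrt_le_sqrt (by linarith)) (by positivity))
  have hMR : ∀ f, ∀ᵐ ξ, (𝓕 (M f) : L2 d) ξ =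
      ((Real.sqrt (T ((2 * Real.pi) • ξ) : ℝ) : ℝ) : ℂ) * (𝓕 (R f) : L2 d) ξ := by
    intro f
    filter_upwards [hM f, hR f] with ξ h1 h2
    rw [h1, h2]
    push_cast
    ring
  have hMnorm : ∀ f, inner ℂ (𝓕 (M f) : L2 d) (𝓕 (M f)) = kinForm T (R f) (R f) := by
    intro f
    rw [L2.inner_def, kinForm]
    refine integral_congr_ae ?_
    filter_upwards [hMR f] with ξ h1
    rw [RCLike.inner_apply, h1, map_mul, Complex.conj_ofReal]
    have h2 : ((Real.sqrt (T ((2 * Real.pi) • ξ) : ℝ) : ℝ) : ℂ) *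
        ((Real.sqrt (T ((2 * Real.pi) • ξ) : ℝ) : ℝ) : ℂ) = ((T ((2 * Real.pi) • ξ) : ℝ) : ℂ) := by
      rw [← Complex.ofReal_mul, Real.mul_self_sqrt (by positivity)]
    linear_combination ((𝓕 (R f) : L2 d) ξ * conj ((𝓕 (R f) : L2 d) ξ)) * h2
  -- On the span of the eigenfunctions the total energy is ∑ |c i|² E i ≤ 0.
  have hneg : ∀ c : ι → ℂ, (kinForm T (R (∑ i, c i • g i)) (R (∑ i, c i • g i)) +
      potForm V (R (∑ i, c i • g i)) (R (∑ i, c i • g i))).re ≤ 0 := by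
    intro c
    set G := ∑ i, c i • g i with hG
    have hRG : R G = ∑ i, c i • e i := by simp [hG, hg]
    have h1 : kinForm T (R G) (R G) + potForm V (R G) (R G) =
        inner ℂ (R G) (∑ i, c i • ((E i : ℂ) • e i)) := by
      rw [kinForm_eq (hR G) (hR G), ← (hK G G _ _ (hR G) (hR G)).2]
      have e1 : ∀ i, inner ℂ (R G) (c i • ((E i : ℂ) • e i)) = c i * inner ℂ G (g i) -
          c i * inner ℂ (R G) (R (g i)) + c i * inner ℂ G (K (g i)) := fun i => by
        rw [inner_smul_right, ← hgop]; ring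
      have e2 : ∀ x, inner ℂ x G = ∑ i, c i * inner ℂ x (g i) := fun x => by
        rw [hG, inner_sum]; simp_rw [inner_smul_right]
      have e3 : ∀ (A : L2 d →L[ℂ] L2 d) x, inner ℂ x (A G) = ∑ i, c i * inner ℂ x (A (g i)) :=
        fun A x => by rw [hG, map_sum, inner_sum]; simp_rw [map_smul, inner_smul_right]
      have e4 : inner ℂ (R G) (∑ i, c i • ((E i : ℂ) • e i)) =
          ∑ i, inner ℂ (R G) (c i • ((E i : ℂ) • e i)) := inner_sum _ _ _
      rw [e4, Finset.sum_congr rfl fun i _ => e1 i, Finset.sum_add_distrib, Finset.sum_sub_distrib, e2, e3 R, e3 K]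
    rw [h1, hRG]
    have h2 : ∑ i, c i • ((E i : ℂ) • e i) = ∑ i, (c i * E i) • e i :=
      Finset.sum_congr rfl fun i _ => (mul_smul (c i) (E i : ℂ) (e i)).symm
    rw [h2, he.inner_sum, Complex.re_sum]
    refine Finset.sum_nonpos fun i _ => ?_
    have h3 : conj (c i) * (c i * E i) = ((‖c i‖ ^ 2 * E i : ℝ) : ℂ) := by
      rw [← mul_assoc, Complex.conj_mul']
      push_cast
      ring
    rw [h3, Complex.ofReal_re]
    exact mul_nonpos_of_nonneg_of_nonpos (by positivity) (hE i).le
  let Φ : (ι → ℂ) →ₗ[ℂ] L2 d := (Lp.fourierTransformₗᵢ (RSpace d) ℂ).toLinearEquiv.toLinearMap ∘ₗ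
    M.toLinearMap ∘ₗ Fintype.linearCombination ℂ g
  have hΦ : ∀ c, Φ c = 𝓕 (M (∑ i, c i • g i)) := fun c => rfl
  -- Since T ≠ 0 almost everywhere, vanishing kinetic energy means a vanishing function; hence the
  -- kinetic inner product is definite on the span and can be orthonormalized.
  have hinj : Function.Injective Φ := by
    rw [← LinearMap.ker_eq_bot, LinearMap.ker_eq_bot']
    intro c hc
    rw [hΦ] at hc
    have h1 : R (∑ i, c i • g i) = 0 := by
      apply ae_eq_of_fourier_ae_eq
      have h0 : (𝓕 (0 : L2 d) : L2 d) = 0 := (Lp.fourierTransformₗᵢ (RSpace d) ℂ).map_zero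
      filter_upwards [hMR (∑ i, c i • g i), hpos, Lp.coeFn_zero ℂ 2 (volume : Measure (RSpace d))]
        with ξ h2 h3 h4
      rw [hc, h4] at h2
      rw [h0, h4]
      rcases mul_eq_zero.1 h2.symm with h5 | h5
      · rw [Complex.ofReal_eq_zero, Real.sqrt_eq_zero (by positivity)] at h5
        exact absurd (by exact_mod_cast h5) h3
      · exact h5
    have h2 : ∑ i, c i • e i = 0 := by simpa [hg] using h1
    ext i
    exact Fintype.linearIndependent_iff.1 he.linearIndependent c h2 i
  obtain ⟨c, hc⟩ := exists_orthonormal_range Φ hinj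
  have hmain := card_le_of_orthonormal hT hpos (W := fun x => ENNReal.ofReal (max 0 (-V x)))
    (measurable_const.max hVm.neg).ennreal_ofReal (fun x => ENNReal.ofReal_ne_top) hc
    (ψ := fun j => R (∑ i, c j i • g i)) (fun j => hMR _) (fun j => ?_) hα hα'
  · simpa using hmain
  · set ψ := R (∑ i, c j i • g i) with hψ
    have hdom : ψ ∈ kinFormDomain T := (mem_kinFormDomain_iff hT).2 ⟨_, hR _⟩
    have h1 := hneg (c j)
    have h2 := hMnorm (∑ i, c j i • g i)
    have h3 : inner ℂ (𝓕 (M (∑ i, c j i • g i)) : L2 d) (𝓕 (M (∑ i, c j i • g i))) = 1 := by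
      rw [inner_self_eq_norm_sq_to_K, ← hΦ, hc.1 j]
      simp
    rw [← h2, h3, ← hψ, potForm_self, Complex.add_re, Complex.ofReal_re, Complex.one_re] at h1
    have hint : Integrable fun x => -(V x * ‖ψ x‖ ^ 2) := by
      refine ((hV.integrable_sq hT hdom).mono' ?_ (Eventually.of_forall fun x => ?_)).neg
      · exact hVm.aestronglyMeasurable.mul ((Lp.aestronglyMeasurable ψ).norm.pow 2)
      · simp
    calc (1 : ℝ≥0∞) ≤ ENNReal.ofReal (∫ x, -(V x * ‖ψ x‖ ^ 2)) := by
          rw [ENNReal.one_le_ofReal, integral_neg]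
          linarith
      _ ≤ ∫⁻ x, ENNReal.ofReal (-(V x * ‖ψ x‖ ^ 2)) := ofReal_integral_le_lintegral_ofReal hint
      _ ≤ _ := by
          refine lintegral_mono fun x => ?_
          simp only [← ofReal_norm]
          rw [← ENNReal.ofReal_pow (norm_nonneg _), ← ENNReal.ofReal_mul (by positivity)]
          apply ENNReal.ofReal_le_ofReal
          rw [← neg_mul]
          gcongr
          exact le_max_right _ _

/-- The sum over all negative reals is the supremum of its finite partial sums, and each of these
counts a finite orthonormal family of eigenfunctions. -/
theorem numNegEig_le (hT : Measurable T) (hpos : ∀ᵐ ξ, T ((2 * Real.pi) • ξ) ≠ 0)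
    (hVm : Measurable V) (hV : RelFormCompact T V) {α : ℝ} (hα : 0 < α) (hα' : α < 1 / 4) :
    numNegEig T V ≤ ∫⁻ x, ENNReal.ofReal (α ^ 2 / (1 - 4 * α) ^ 2) *
      bigG T (ENNReal.ofReal (max 0 (-V x)) / ENNReal.ofReal (α ^ 2)) := by
  set C := ∫⁻ x, ENNReal.ofReal (α ^ 2 / (1 - 4 * α) ^ 2) *
      bigG T (ENNReal.ofReal (max 0 (-V x)) / ENNReal.ofReal (α ^ 2)) with hC
  have key : ∀ (s : Finset (Set.Iio (0 : ℝ))) (n : s → ℕ),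
      (∀ E : s, (n E : ℕ∞) ≤ eigMult T V (E : Set.Iio (0 : ℝ))) → ((∑ E, n E : ℕ) : ℝ≥0∞) ≤ C := by
    intro s n hn
    choose e he hop using fun E : s => exists_orthonormal_of_le_eigMult hT hVm hV (hn E)
    have horth : Orthonormal ℂ fun p : (Σ E : s, Fin (n E)) => e p.1 p.2 := by
      refine ⟨fun p => (he p.1).1 p.2, ?_⟩
      rintro ⟨E, i⟩ ⟨E', i'⟩ hne
      by_cases h : E = E'
      · subst h
        exact (he E).2 fun h' => hne (congrArg (Sigma.mk E) h')
      · refine (hop E i).orthogonal (fun h' => h ?_) (hop E' i')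
        exact Subtype.ext (Subtype.ext h')
    have h1 := card_eigenfunctions_le hT hpos hVm hV horth
      (E := fun p => ((p.1 : Set.Iio (0 : ℝ)) : ℝ)) (fun p => (p.1 : Set.Iio (0 : ℝ)).2)
      (fun p => hop p.1 p.2) hα hα'
    rw [Fintype.card_sigma] at h1
    simpa only [Fintype.card_fin] using h1
  rw [numNegEig, ENNReal.tsum_eq_iSup_sum]
  refine iSup_le fun s => ?_
  -- An infinite multiplicity bounds every natural number by C, so C = ∞ and nothing is left to
  -- prove.
  by_cases htop : ∃ E ∈ s, eigMult T V (E : Set.Iio (0 : ℝ)) = ⊤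
  · obtain ⟨E, -, hE⟩ := htop
    have h1 : ∀ n : ℕ, (n : ℝ≥0∞) ≤ C := by
      intro n
      have := key {E} (fun _ => n) (fun E' => by
        have : (E' : Set.Iio (0 : ℝ)) = E := Finset.mem_singleton.1 E'.2
        rw [this, hE]
        exact le_top)
      simpa using this
    have : C = ∞ := ENNReal.eq_top_of_forall_nnreal_le fun r => by
      obtain ⟨n, hn⟩ := exists_nat_ge r
      exact le_trans (by exact_mod_cast hn) (h1 n)
    rw [this]
    exact le_top
  · push Not at htop
    have h1 := key s (fun E => (eigMult T V (E : Set.Iio (0 : ℝ))).toNat) (fun E => by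
      rw [ENat.natCast_toNat (htop E E.2)])
    refine le_trans (le_of_eq ?_) h1
    rw [← Finset.sum_coe_sort s]
    push_cast
    refine Finset.sum_congr rfl fun E _ => ?_
    conv_lhs => rw [← ENat.natCast_toNat (htop E E.2)]
    simp

theorem one_le_numNegEig (h : HasNegEigenvalue T V) : 1 ≤ numNegEig T V := by
  obtain ⟨E, hE, ψ, hψ, hop⟩ := h
  refine le_trans ?_ (ENNReal.le_tsum (⟨E, hE⟩ : Set.Iio (0 : ℝ)))
  have h1 : ((1 : ℕ) : ℕ∞) ≤ eigMult T V E := by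
    rw [eigMult, Cardinal.natCast_le_toENat, Nat.cast_one, Cardinal.one_le_iff_ne_zero,
      Ne, rank_zero_iff, not_subsingleton_iff_nontrivial]
    exact ⟨⟨⟨ψ, Submodule.subset_span hop⟩, 0, fun h0 => hψ (congrArg Subtype.val h0)⟩⟩
  exact_mod_cast h1

end EigenvalueCount

/-! ### Convergence of the integral and its consequences -/

section QuantitativeBound

variable {d : ℕ} {T : RSpace d → ℝ≥0}

theorem intInv_mono {A B : Set (RSpace d)} (h : A ⊆ B) : intInv T A ≤ intInv T B :=
  lintegral_mono_set h

theorem intInv_union_le (A B : Set (RSpace d)) : intInv T (A ∪ B) ≤ intInv T A + intInv T B :=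
  lintegral_union_le _ _ _

/-- With 1/0 = ∞, a zero set of positive measure makes the integral infinite. -/
theorem volume_zeroSet_eq_zero (hT : Measurable T) {A : Set (RSpace d)} (hA : zeroSet T ⊆ A)
    (h : intInv T A < ∞) : volume (zeroSet T) = 0 := by
  have hm : MeasurableSet (zeroSet T) := hT (measurableSet_singleton 0)
  by_contra h0
  have h1 : intInv T (zeroSet T) = ∞ := by
    rw [intInv, setLIntegral_congr_fun (g := fun _ => ∞) hm fun x hx => by
      rw [show T x = 0 from hx]; simp]
    rw [setLIntegral_const, ENNReal.top_mul h0]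
  exact absurd (h1 ▸ intInv_mono hA) (not_le.2 h)

theorem ae_ne_zero_of_volume_zeroSet (h : volume (zeroSet T) = 0) :
    ∀ᵐ ξ : RSpace d, T ((2 * Real.pi) • ξ) ≠ 0 := by
  have h1 : ∀ᵐ η, T η ≠ 0 := by
    rw [ae_iff]
    simpa [zeroSet] using h
  have hq : Measure.QuasiMeasurePreserving ((2 * Real.pi) • · : RSpace d → RSpace d) volume volume := by
    refine ⟨measurable_const_smul _, ?_⟩
    rw [Measure.map_addHaar_smul volume (by positivity)]
    exact Measure.smul_absolutelyContinuous
  exact hq.ae h1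

theorem bigG_mono : Monotone (bigG T) := fun u v h => by
  unfold bigG
  gcongr
  exact intInv_mono fun η hη => lt_of_lt_of_le hη h

/-- The set {T < u₁} is covered by Z_δ and {T < u₁} outside Z_δ, and both integrals of 1/T are
finite. Hence G(u) is at most linear in u near 0, which gives finiteness and the limit; the
eigenvalue bound is `numNegEig_le`. -/
theorem isQuantBound_bigG (hT : Measurable T)
    (hfin : ∀ δ : ℝ, 0 < δ → ∃ u : ℝ≥0, 0 < u ∧
      intInv T ({η | T η < u} ∩ (Metric.cthickening δ (zeroSet T))ᶜ) < ∞)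
    {δ : ℝ} (hδ : 0 < δ) (h : intInv T (Metric.cthickening δ (zeroSet T)) < ∞)
    {α : ℝ} (hα : 0 < α) (hα' : α < 1 / 4) :
    IsQuantBound T (fun u => ENNReal.ofReal (α ^ 2 / (1 - 4 * α) ^ 2) *
      bigG T (u / ENNReal.ofReal (α ^ 2))) := by
  obtain ⟨u₁, hu₁, hu₁'⟩ := hfin δ hδ
  have haE : ENNReal.ofReal (α ^ 2) ≠ 0 := by simpa using hα.ne'
  have hI : intInv T {η | (T η : ℝ≥0∞) < u₁} < ∞ := by
    refine lt_of_le_of_lt ((intInv_mono fun η hη => ?_).trans (intInv_union_le _ _))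
      (ENNReal.add_lt_top.2 ⟨h, hu₁'⟩)
    by_cases hm : η ∈ Metric.cthickening δ (zeroSet T)
    · exact Or.inl hm
    · exact Or.inr ⟨by simpa using hη, hm⟩
  set I := intInv T {η | (T η : ℝ≥0∞) < u₁} / ENNReal.ofReal ((2 * Real.pi) ^ d) with hIdef
  have hItop : I < ∞ := ENNReal.div_lt_top hI.ne (by
    simp only [ne_eq, ENNReal.ofReal_eq_zero, not_le]
    positivity)
  have hbound : ∀ u, u < u₁ * ENNReal.ofReal (α ^ 2) →
      ENNReal.ofReal (α ^ 2 / (1 - 4 * α) ^ 2) * bigG T (u / ENNReal.ofReal (α ^ 2)) ≤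
        ENNReal.ofReal (α ^ 2 / (1 - 4 * α) ^ 2) * (u / ENNReal.ofReal (α ^ 2) * I) := by
    intro u hu
    have h1 : u / ENNReal.ofReal (α ^ 2) ≤ u₁ := (ENNReal.div_le_of_le_mul hu.le)
    unfold bigG
    rw [hIdef]
    gcongr
    exact intInv_mono fun η hη => lt_of_lt_of_le hη h1
  have hpos : 0 < (u₁ : ℝ≥0∞) * ENNReal.ofReal (α ^ 2) :=
    ENNReal.mul_pos (by exact_mod_cast hu₁.ne') haE
  refine ⟨?_, ⟨_, hpos, fun u _ hu => ?_⟩, ?_, fun V hVm hV => ?_⟩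
  · exact ((bigG_mono.measurable).comp (measurable_id.div_const _)).const_mul _
  · refine lt_of_le_of_lt (hbound u hu) ?_
    have hut : u ≠ ∞ := (hu.trans (by finiteness)).ne
    have := hItop.ne
    have := ENNReal.div_ne_top hut haE
    finiteness
  · have hlim : Tendsto (fun u : ℝ≥0∞ => ENNReal.ofReal (α ^ 2 / (1 - 4 * α) ^ 2) *
        (u / ENNReal.ofReal (α ^ 2) * I)) (𝓝 0) (𝓝 0) := by
      have hc : Continuous fun u : ℝ≥0∞ => u * ((ENNReal.ofReal (α ^ 2))⁻¹ *
          (ENNReal.ofReal (α ^ 2 / (1 - 4 * α) ^ 2) * I)) :=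
        ENNReal.continuous_mul_const (ENNReal.mul_ne_top (ENNReal.inv_ne_top.2 haE)
          (ENNReal.mul_ne_top ENNReal.ofReal_ne_top hItop.ne))
      have := hc.tendsto 0
      rw [zero_mul] at this
      refine this.congr fun u => ?_
      rw [div_eq_mul_inv u]
      ring
    refine tendsto_of_tendsto_of_tendsto_of_le_of_le' tendsto_const_nhds
      (hlim.mono_left nhdsWithin_le_nhds) (Eventually.of_forall fun _ => zero_le) ?_
    exact (eventually_lt_nhds hpos).filter_mono nhdsWithin_le_nhds |>.mono hbound
  · exact numNegEig_le hT (ae_ne_zero_of_volume_zeroSet (volume_zeroSet_eq_zero hT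
      (Metric.self_subset_cthickening _) h)) hVm hV hα hα'

/-- A quantitative bound without constant term excludes weakly coupled bound states. -/
theorem exists_no_negEigenvalue (hT : Measurable T) {G₀ : ℝ≥0∞ → ℝ≥0∞} (hG : IsQuantBound T G₀)
    (hG0 : G₀ 0 = 0)
    (hpot : ∃ V : RSpace d → ℝ, Measurable V ∧ NonTrivial V ∧ RelFormCompact T V) :
    ∃ V : RSpace d → ℝ, Measurable V ∧ Integrable V ∧ RelFormCompact T V ∧ NonTrivial V ∧
      (∀ x, V x ≤ 0) ∧ ¬ HasNegEigenvalue T V := by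
  obtain ⟨V₀, hV₀m, hV₀, hV₀c⟩ := hpot
  obtain ⟨-, -, hG1, hG2⟩ := hG
  have hex : ∃ n : ℕ, ¬ ∀ᵐ x, x ∈ Metric.ball (0 : RSpace d) n → V₀ x = 0 := by
    by_contra hcon
    push Not at hcon
    refine hV₀ ?_
    filter_upwards [ae_all_iff.2 hcon] with x hx
    obtain ⟨n, hn⟩ := exists_nat_gt ‖x‖
    exact hx n (by simpa using hn)
  obtain ⟨n, hn⟩ := hex
  set B := Metric.ball (0 : RSpace d) n with hB
  have hBfin : volume B ≠ ∞ := measure_ball_lt_top.ne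
  -- The threshold makes the integral of G₀ over B at most |B|/(2(|B|+1)) < 1.
  obtain ⟨ε, hε, hεb⟩ : ∃ ε : ℝ, 0 < ε ∧ ∀ u : ℝ, 0 < u → u ≤ ε →
      G₀ (ENNReal.ofReal u) ≤ (2 * (volume B + 1))⁻¹ := by
    have h1 : ∀ᶠ u in 𝓝[>] (0 : ℝ≥0∞), G₀ u < (2 * (volume B + 1))⁻¹ :=
      hG1.eventually (gt_mem_nhds (by
        rw [ENNReal.inv_pos]
        finiteness))
    have h2 : Tendsto ENNReal.ofReal (𝓝[>] 0) (𝓝[>] 0) := by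
      refine tendsto_nhdsWithin_iff.2 ⟨?_, ?_⟩
      · have := (ENNReal.continuous_ofReal.tendsto 0).mono_left
          (nhdsWithin_le_nhds (s := Ioi (0 : ℝ)))
        simpa using this
      · filter_upwards [self_mem_nhdsWithin] with u hu
        simpa using hu
    obtain ⟨ε, hε, h3⟩ := mem_nhdsGT_iff_exists_Ioc_subset.1 (h2.eventually h1)
    exact ⟨ε, hε, fun u hu hu' => (h3 ⟨hu, hu'⟩).le⟩
  -- Domination by |V₀| keeps V relatively form compact. Outside B the bound contributes nothing
  -- because G₀ vanishes at 0.
  set V : RSpace d → ℝ := B.indicator fun x => -min |V₀ x| ε with hVdef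
  have hVm : Measurable V :=
    (((continuous_abs.measurable.comp hV₀m).min measurable_const).neg).indicator measurableSet_ball
  have habs : ∀ x, |V x| ≤ min |V₀ x| ε := by
    intro x
    have h0 : 0 ≤ min |V₀ x| ε := le_min (abs_nonneg _) hε.le
    by_cases hx : x ∈ B
    · rw [hVdef, indicator_of_mem hx, abs_neg, abs_of_nonneg h0]
    · rw [hVdef, indicator_of_notMem hx, abs_zero]
      exact h0
  have hVc : RelFormCompact T V := hV₀c.mono hT hVm
    (Eventually.of_forall fun x => (habs x).trans (min_le_left _ _))
  refine ⟨V, hVm, ?_, hVc, ?_, fun x => ?_, fun hneg => ?_⟩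
  · have h1 : IntegrableOn (fun x => -min |V₀ x| ε) B := by
      refine Measure.integrableOn_of_bounded (M := ε) hBfin
        ((continuous_abs.measurable.comp hV₀m).min measurable_const).neg.aestronglyMeasurable
        (Eventually.of_forall fun x => ?_)
      rw [norm_neg, Real.norm_of_nonneg (le_min (abs_nonneg _) hε.le)]
      exact min_le_right _ _
    exact (integrable_indicator_iff measurableSet_ball).2 h1
  · intro h0
    refine hn ?_
    filter_upwards [h0] with x hx hxB
    rw [hVdef, indicator_of_mem hxB, neg_eq_zero] at hx
    rcases min_choice |V₀ x| ε with h | h <;> rw [h] at hx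
    · exact abs_eq_zero.1 hx
    · exact absurd hx hε.ne'
  · rw [hVdef]
    refine indicator_apply_nonpos fun _ => neg_nonpos.2 (le_min (abs_nonneg _) hε.le)
  · have h1 := (one_le_numNegEig hneg).trans (hG2 V hVm hVc)
    have h2 : ∀ x, G₀ (ENNReal.ofReal (max 0 (-V x))) ≤
        B.indicator (fun _ => (2 * (volume B + 1))⁻¹) x := by
      intro x
      by_cases hx : x ∈ B
      · rw [indicator_of_mem hx]
        have hnn : 0 ≤ min |V₀ x| ε := le_min (abs_nonneg _) hε.le
        rw [hVdef, indicator_of_mem hx, neg_neg, max_eq_right hnn]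
        rcases hnn.eq_or_lt with h | h
        · rw [← h, ENNReal.ofReal_zero, hG0]
          exact zero_le
        · exact hεb _ h (min_le_right _ _)
      · simp [hVdef, hx, hG0]
    have h3 := h1.trans (lintegral_mono h2)
    rw [lintegral_indicator measurableSet_ball, setLIntegral_const] at h3
    have h4 : (2 * (volume B + 1))⁻¹ * volume B < 1 := by
      rw [mul_comm, ← div_eq_mul_inv]
      refine ENNReal.div_lt_of_lt_mul ?_
      rw [one_mul]
      lift volume B to ℝ≥0 using hBfin with v
      norm_cast
      have : (0 : ℝ≥0) ≤ v := zero_le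
      rw [← NNReal.coe_lt_coe]
      push_cast
      have := v.2
      linarith
    exact absurd h3 (not_le.2 h4)

end QuantitativeBound

/-! ### Localizing the divergence and constructing densities -/

section Concentration

variable {d : ℕ} {T : RSpace d → ℝ≥0}

/-- If the integral of `1/T` near its compact zero set diverges, it diverges near a point. -/
theorem exists_point_intInv_ball_eq_top (hZ : IsCompact (zeroSet T))
    (hfin : ∀ δ : ℝ, 0 < δ → ∃ u : ℝ≥0, 0 < u ∧
      intInv T ({η | T η < u} ∩ (Metric.cthickening δ (zeroSet T))ᶜ) < ∞)
    {δ : ℝ} (h : intInv T (Metric.cthickening δ (zeroSet T)) = ∞) :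
    ∃ η₀, ∀ r : ℝ, 0 < r → intInv T (Metric.ball η₀ r) = ∞ := by
  by_contra hcon
  push Not at hcon
  choose r hr hI using hcon
  obtain ⟨t, -, ht⟩ := hZ.elim_nhds_subcover (fun η => Metric.ball η (r η))
    (fun η _ => Metric.ball_mem_nhds η (hr η))
  obtain ⟨δ', hδ', hsub⟩ := hZ.exists_cthickening_subset_open
    (isOpen_biUnion fun η _ => Metric.isOpen_ball) ht
  obtain ⟨u, hu, hufin⟩ := hfin δ' hδ'
  -- If each point had a ball with finite integral, finitely many balls would cover a whole
  -- neighbourhood of Z.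
  have h1 : intInv T (Metric.cthickening δ' (zeroSet T)) < ∞ := by
    refine lt_of_le_of_lt (intInv_mono hsub) ?_
    have h0 : ⋃ η ∈ (t : Set (RSpace d)), Metric.ball η (r η) = ⋃ η : t, Metric.ball (η : RSpace d) (r η) := by
      ext; simp
    rw [h0]
    refine lt_of_le_of_lt (lintegral_iUnion_le _ _) ?_
    rw [tsum_fintype]
    exact ENNReal.sum_lt_top.2 fun η _ => (hI η).lt_top
  -- Here 1/T ≤ 1/u on a bounded set. The remaining part of Z_δ, off Z_δ' and with T < u, is covered
  -- by the standing assumption.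
  have h2 : intInv T (Metric.cthickening δ (zeroSet T) ∩ {η | u ≤ T η}) < ∞ := by
    have hvol : volume (Metric.cthickening δ (zeroSet T)) < ∞ := hZ.isBounded.cthickening.measure_lt_top
    calc intInv T (Metric.cthickening δ (zeroSet T) ∩ {η | u ≤ T η})
        ≤ ∫⁻ η in Metric.cthickening δ (zeroSet T) ∩ {η | u ≤ T η}, (u : ℝ≥0∞)⁻¹ := by
          refine setLIntegral_mono measurable_const fun η hη => ?_
          rw [ENNReal.inv_le_inv]
          exact_mod_cast hη.2
      _ ≤ (u : ℝ≥0∞)⁻¹ * volume (Metric.cthickening δ (zeroSet T)) := by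
          rw [setLIntegral_const]
          gcongr
          exact inter_subset_left
      _ < ∞ := ENNReal.mul_lt_top (ENNReal.inv_lt_top.2 (by exact_mod_cast hu)) hvol
  have h3 : intInv T (Metric.cthickening δ (zeroSet T)) < ∞ := by
    refine lt_of_le_of_lt ((intInv_mono ?_).trans ((intInv_union_le
      (Metric.cthickening δ' (zeroSet T)) _).trans (add_le_add_right (intInv_union_le
      ({η | T η < u} ∩ (Metric.cthickening δ' (zeroSet T))ᶜ)
      (Metric.cthickening δ (zeroSet T) ∩ {η | u ≤ T η})) _)))
      (ENNReal.add_lt_top.2 ⟨h1, ENNReal.add_lt_top.2 ⟨hufin, h2⟩⟩)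
    intro η hη
    by_cases hm : η ∈ Metric.cthickening δ' (zeroSet T)
    · exact Or.inl hm
    · rcases lt_or_ge (T η) u with h' | h'
      · exact Or.inr (Or.inl ⟨h', hm⟩)
      · exact Or.inr (Or.inr ⟨hη, h'⟩)
  exact h3.ne h

/-- The substitution η = 2πξ turns the ball of radius 2πr around η₀ into one of radius r; the
Jacobian is finite, so divergence is preserved. -/
theorem lintegral_inv_freqSymbol_ball (hT : Measurable T) {η₀ : RSpace d}
    (h : ∀ r : ℝ, 0 < r → intInv T (Metric.ball η₀ r) = ∞) {r : ℝ} (hr : 0 < r) :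
    ∫⁻ ξ in Metric.ball ((2 * Real.pi)⁻¹ • η₀) r, (T ((2 * Real.pi) • ξ) : ℝ≥0∞)⁻¹ = ∞ := by
  have hpi : (0 : ℝ) < 2 * Real.pi := by positivity
  have h1 := lintegral_comp_two_pi_smul (F := (Metric.ball η₀ (2 * Real.pi * r)).indicator
    fun η => (T η : ℝ≥0∞)⁻¹) (hT.coe_nnreal_ennreal.inv.indicator measurableSet_ball)
  rw [lintegral_indicator measurableSet_ball] at h1
  have h2 := h (2 * Real.pi * r) (by positivity)
  rw [intInv] at h2
  rw [h2, ENNReal.top_div_of_ne_top ENNReal.ofReal_ne_top] at h1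
  rw [← h1, ← lintegral_indicator measurableSet_ball]
  refine lintegral_congr fun ξ => ?_
  have h3 : ξ ∈ Metric.ball ((2 * Real.pi)⁻¹ • η₀) r ↔
      (2 * Real.pi) • ξ ∈ Metric.ball η₀ (2 * Real.pi * r) := by
    rw [mem_ball_iff_norm, mem_ball_iff_norm]
    have h4 : (2 * Real.pi) • ξ - η₀ = (2 * Real.pi) • (ξ - (2 * Real.pi)⁻¹ • η₀) := by
      rw [smul_sub, smul_inv_smul₀ hpi.ne']
    rw [h4, norm_smul, Real.norm_of_nonneg hpi.le]
    exact (mul_lt_mul_iff_right₀ hpi).symm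
  by_cases hξ : ξ ∈ Metric.ball ((2 * Real.pi)⁻¹ • η₀) r
  · rw [indicator_of_mem hξ, indicator_of_mem (h3.1 hξ)]
  · rw [indicator_of_notMem hξ, indicator_of_notMem (fun h' => hξ (h3.2 h'))]

/-- Normalized densities on a small ball with small kinetic energy. -/
theorem exists_density {τ : RSpace d → ℝ≥0} (hτ : Measurable τ) {ξ₀ : RSpace d} {r : ℝ}
    (h : ∫⁻ ξ in Metric.ball ξ₀ r, (τ ξ : ℝ≥0∞)⁻¹ = ∞) {ε : ℝ≥0} (hε : 0 < ε) :
    ∃ w : RSpace d → ℝ≥0, Measurable w ∧ (∃ C : ℝ≥0, ∀ ξ, w ξ ≤ C) ∧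
      (∀ ξ, ξ ∉ Metric.ball ξ₀ r → w ξ = 0) ∧ ∫⁻ ξ, (w ξ : ℝ≥0∞) = 1 ∧
      ∫⁻ ξ, (τ ξ : ℝ≥0∞) * (w ξ : ℝ≥0∞) ^ 2 ≤ ε := by
  -- Truncations of 1/τ, whose integrals I increase to ∞. For w = g/I the inequality τ g ≤ 1 gives ∫
  -- τ w² ≤ 1/I, so I > 1/ε is enough.
  set g : ℕ → RSpace d → ℝ≥0∞ := fun m => (Metric.ball ξ₀ r).indicator
    fun ξ => min (τ ξ : ℝ≥0∞)⁻¹ m with hg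
  have hgm : ∀ m, Measurable (g m) := fun m =>
    (hτ.coe_nnreal_ennreal.inv.min measurable_const).indicator measurableSet_ball
  have hgmono : Monotone g := fun m n hmn ξ =>
    indicator_le_indicator (min_le_min_left _ (by exact_mod_cast hmn))
  have hsup : ⨆ m, ∫⁻ ξ, g m ξ = ∞ := by
    rw [← lintegral_iSup hgm hgmono, ← h, ← lintegral_indicator measurableSet_ball]
    refine lintegral_congr fun ξ => ?_
    by_cases hξ : ξ ∈ Metric.ball ξ₀ r
    · simp only [hg, indicator_of_mem hξ]
      rw [← inf_iSup_eq, ENNReal.iSup_natCast, inf_top_eq]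
    · simp [hg, hξ]
  have hlt : ((ε⁻¹ : ℝ≥0) : ℝ≥0∞) < ⨆ m, ∫⁻ ξ, g m ξ := by
    rw [hsup]; exact ENNReal.coe_lt_top
  obtain ⟨m, hm⟩ := lt_iSup_iff.1 hlt
  set I := ∫⁻ ξ, g m ξ with hI
  have hgle : ∀ ξ, g m ξ ≤ m := fun ξ => by
    by_cases hξ : ξ ∈ Metric.ball ξ₀ r
    · simp [hg, indicator_of_mem hξ]
    · simp [hg, hξ]
  have hI0 : I ≠ 0 := (lt_of_le_of_lt zero_le hm).ne'
  have hItop : I ≠ ∞ := by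
    have : I ≤ ∫⁻ ξ in Metric.ball ξ₀ r, (m : ℝ≥0∞) := by
      rw [hI, ← lintegral_indicator measurableSet_ball]
      refine lintegral_mono fun ξ => ?_
      exact indicator_le_indicator (min_le_right _ _)
    refine (lt_of_le_of_lt this ?_).ne
    rw [setLIntegral_const]
    exact ENNReal.mul_lt_top (ENNReal.natCast_lt_top m) measure_ball_lt_top
  have hfin : ∀ ξ, I⁻¹ * g m ξ ≠ ∞ := fun ξ => ENNReal.mul_ne_top (ENNReal.inv_ne_top.2 hI0)
    ((hgle ξ).trans_lt (ENNReal.natCast_lt_top m)).ne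
  have hcoe : ∀ ξ, (((I⁻¹ * g m ξ).toNNReal : ℝ≥0) : ℝ≥0∞) = I⁻¹ * g m ξ := fun ξ =>
    ENNReal.coe_toNNReal (hfin ξ)
  refine ⟨fun ξ => (I⁻¹ * g m ξ).toNNReal, ((hgm m).const_mul _).ennreal_toNNReal,
    ⟨(I⁻¹ * m).toNNReal, fun ξ => ?_⟩, fun ξ hξ => ?_, ?_, ?_⟩
  · refine ENNReal.toNNReal_mono (ENNReal.mul_ne_top (ENNReal.inv_ne_top.2 hI0)
      (ENNReal.natCast_ne_top m)) ?_
    gcongr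
    exact hgle ξ
  · simp [hg, hξ]
  · simp_rw [hcoe]
    rw [lintegral_const_mul _ (hgm m), ← hI, ENNReal.inv_mul_cancel hI0 hItop]
  · simp_rw [hcoe]
    have h1 : ∀ ξ, (τ ξ : ℝ≥0∞) * (I⁻¹ * g m ξ) ^ 2 ≤ I⁻¹ * I⁻¹ * g m ξ := by
      intro ξ
      have h2 : (τ ξ : ℝ≥0∞) * g m ξ ≤ 1 := by
        by_cases hξ : ξ ∈ Metric.ball ξ₀ r
        · simp only [hg, indicator_of_mem hξ]
          exact (mul_le_mul_right (min_le_left _ _) _).trans (ENNReal.mul_inv_le_one _)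
        · simp [hg, hξ]
      calc (τ ξ : ℝ≥0∞) * (I⁻¹ * g m ξ) ^ 2 = (τ ξ * g m ξ) * (I⁻¹ * I⁻¹ * g m ξ) := by ring
        _ ≤ 1 * (I⁻¹ * I⁻¹ * g m ξ) := by gcongr
        _ = _ := one_mul _
    refine (lintegral_mono h1).trans ?_
    rw [lintegral_const_mul _ (hgm m), ← hI, mul_assoc, ENNReal.inv_mul_cancel hI0 hItop, mul_one]
    rw [ENNReal.inv_le_iff_inv_le, ← ENNReal.coe_inv hε.ne']
    exact hm.le

end Concentration

/-! ### Plane wave trial functions and nonpositive potentials -/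

section WeaklyCoupled

variable {d : ℕ} {T : RSpace d → ℝ≥0}

theorem norm_fourierChar_sub_le (a b : ℝ) :
    ‖(Real.fourierChar a : ℂ) - Real.fourierChar b‖ ≤ 2 * Real.pi * |a - b| := by
  have h1 : (Real.fourierChar a : ℂ) - Real.fourierChar b =
      Real.fourierChar b * (Complex.exp (Complex.I * (2 * Real.pi * (a - b) : ℝ)) - 1) := by
    rw [Real.fourierChar_apply, Real.fourierChar_apply, mul_sub, ← Complex.exp_add, mul_one]
    congr 2
    push_cast
    ring
  rw [h1, norm_mul, Circle.norm_coe, one_mul]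
  refine Real.norm_exp_I_mul_ofReal_sub_one_le.trans ?_
  rw [norm_mul, Real.norm_of_nonneg (by positivity), Real.norm_eq_abs]

theorem norm_fourierInv_le {h : RSpace d → ℂ} (x : RSpace d) : ‖𝓕⁻ h x‖ ≤ ∫ ξ, ‖h ξ‖ := by
  rw [Real.fourierInv_eq]
  refine (norm_integral_le_integral_norm _).trans (le_of_eq ?_)
  simp only [Circle.norm_smul]

theorem kinForm_self_re (hT : Measurable T) (ψ : L2 d) : (kinForm T ψ ψ).re =
    (∫⁻ ξ, (T ((2 * Real.pi) • ξ) : ℝ≥0∞) * ‖(𝓕 ψ : L2 d) ξ‖ₑ ^ 2).toReal := by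
  rw [kinForm_self, Complex.ofReal_re, integral_eq_lintegral_of_nonneg_ae]
  · congr 1
    refine lintegral_congr fun ξ => ?_
    rw [ENNReal.ofReal_mul (by positivity), ENNReal.ofReal_pow (norm_nonneg _), ofReal_norm,
      ENNReal.ofReal_coe_nnreal]
  · exact Eventually.of_forall fun ξ => by positivity
  · exact (measurable_freqSymbol hT).coe_nnreal_real.aestronglyMeasurable.mul
      ((Lp.aestronglyMeasurable _).norm.pow 2)

theorem integrable_of_lintegral_eq_one {w : RSpace d → ℝ≥0} (hw : Measurable w)
    (h1 : ∫⁻ ξ, (w ξ : ℝ≥0∞) = 1) :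
    Integrable (fun ξ => (w ξ : ℝ)) ∧ ∫ ξ, (w ξ : ℝ) = 1 := by
  refine ⟨⟨hw.coe_nnreal_real.aestronglyMeasurable, ?_⟩, ?_⟩
  · simp [HasFiniteIntegral, h1]
  · rw [integral_eq_lintegral_of_nonneg_ae (Eventually.of_forall fun ξ => by positivity)
      hw.coe_nnreal_real.aestronglyMeasurable]
    simp [h1]

theorem memLp_two_of_integrable_of_bounded {h : RSpace d → ℂ} (hh : Integrable h) {C : ℝ}
    (hC : ∀ ξ, ‖h ξ‖ ≤ C) : MemLp h 2 volume := by
  rw [memLp_two_iff_integrable_sq_norm hh.1]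
  refine (hh.norm.const_mul C).mono' (hh.1.norm.pow 2) (Eventually.of_forall fun ξ => ?_)
  rw [Real.norm_of_nonneg (by positivity), sq]
  gcongr
  exact hC ξ

/-- Functions with vanishing kinetic energy that converge to a plane wave. -/
theorem exists_planeWave_seq (hT : Measurable T) {ξ₀ : RSpace d}
    (h : ∀ r : ℝ, 0 < r →
      ∫⁻ ξ in Metric.ball ξ₀ r, (T ((2 * Real.pi) • ξ) : ℝ≥0∞)⁻¹ = ∞) :
    ∃ (ψ : ℕ → L2 d) (Ψ : ℕ → RSpace d → ℂ), (∀ n, ψ n =ᵐ[volume] Ψ n) ∧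
      (∀ n, Continuous (Ψ n)) ∧ (∀ n x, ‖Ψ n x‖ ≤ 1) ∧
      (∀ x, Tendsto (fun n => Ψ n x) atTop (𝓝 (Real.fourierChar (inner ℝ ξ₀ x) : ℂ))) ∧
      ∀ n : ℕ, ∫⁻ ξ, (T ((2 * Real.pi) • ξ) : ℝ≥0∞) * ‖(𝓕 (ψ n) : L2 d) ξ‖ₑ ^ 2 ≤
        ((1 / ((n : ℝ≥0) + 1) : ℝ≥0) : ℝ≥0∞) := by
  have hτ := measurable_freqSymbol hT
  have hr : ∀ n : ℕ, (0 : ℝ) < 1 / ((n : ℝ) + 1) := fun n => by positivity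
  choose w hwm hwb hw0 hw1 hwk using fun n : ℕ => exists_density hτ (h _ (hr n))
    (ε := 1 / ((n : ℝ≥0) + 1)) (by positivity)
  have hint := fun n => integrable_of_lintegral_eq_one (hwm n) (hw1 n)
  have hintC : ∀ n, Integrable fun ξ => ((w n ξ : ℝ) : ℂ) := fun n => (hint n).1.ofReal
  have hmem : ∀ n, MemLp (fun ξ => ((w n ξ : ℝ) : ℂ)) 2 volume := by
    intro n
    obtain ⟨C, hC⟩ := hwb n
    exact memLp_two_of_integrable_of_bounded (hintC n) (C := C) fun ξ => by simpa using hC ξ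
  choose ψ hψ using fun n => exists_fourier_eq (hmem n)
  refine ⟨ψ, fun n => 𝓕⁻ fun ξ => ((w n ξ : ℝ) : ℂ),
    fun n => ae_eq_fourierInv_of_integrable (hψ n) (hintC n),
    fun n => continuous_fourierInv (hintC n), fun n x => ?_, fun x => ?_, fun n => ?_⟩
  · refine (norm_fourierInv_le x).trans (le_of_eq ?_)
    rw [← (hint n).2]
    simp
  · rw [tendsto_iff_norm_sub_tendsto_zero]
    have hlim : Tendsto (fun n : ℕ => 2 * Real.pi * ‖x‖ * (1 / ((n : ℝ) + 1))) atTop (𝓝 0) := by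
      simpa using tendsto_one_div_add_atTop_nhds_zero_nat.const_mul (2 * Real.pi * ‖x‖)
    refine squeeze_zero (fun _ => norm_nonneg _) (fun n => ?_) hlim
    -- Since w n has mass one, the difference is an average of differences of characters over a ball
    -- of radius 1/(n+1).
    have h1 : (Real.fourierChar (inner ℝ ξ₀ x) : ℂ) =
        ∫ ξ, (Real.fourierChar (inner ℝ ξ₀ x) : ℂ) * ((w n ξ : ℝ) : ℂ) := by
      rw [integral_const_mul, integral_complex_ofReal, (hint n).2]
      simp
    have h2 : Integrable fun ξ => (Real.fourierChar (inner ℝ ξ x)) • ((w n ξ : ℝ) : ℂ) := by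
      refine (hint n).1.mono' ?_ (Eventually.of_forall fun ξ => by simp)
      refine AEStronglyMeasurable.mul (Continuous.aestronglyMeasurable ?_) (hintC n).1
      exact continuous_subtype_val.comp (Real.continuous_fourierChar.comp (by fun_prop))
    change ‖𝓕⁻ (fun ξ => ((w n ξ : ℝ) : ℂ)) x - _‖ ≤ _
    rw [Real.fourierInv_eq, h1, ← integral_sub h2 ((hintC n).const_mul _)]
    refine (norm_integral_le_integral_norm _).trans ?_
    have h3 : ∀ ξ, ‖(Real.fourierChar (inner ℝ ξ x)) • ((w n ξ : ℝ) : ℂ) -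
        (Real.fourierChar (inner ℝ ξ₀ x) : ℂ) * ((w n ξ : ℝ) : ℂ)‖ ≤
        2 * Real.pi * ‖x‖ * (1 / ((n : ℝ) + 1)) * (w n ξ : ℝ) := by
      intro ξ
      by_cases hξ : ξ ∈ Metric.ball ξ₀ (1 / ((n : ℝ) + 1))
      · rw [Circle.smul_def, smul_eq_mul, ← sub_mul, norm_mul, Complex.norm_real,
          Real.norm_of_nonneg (by positivity)]
        gcongr
        refine (norm_fourierChar_sub_le _ _).trans ?_
        rw [← inner_sub_left, mul_assoc (2 * Real.pi)]
        gcongr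
        refine (abs_real_inner_le_norm _ _).trans ?_
        rw [mul_comm]
        gcongr
        exact (mem_ball_iff_norm.1 hξ).le
      · rw [hw0 n ξ hξ]
        simp
    refine (integral_mono_of_nonneg (Eventually.of_forall fun _ => norm_nonneg _)
      ((hint n).1.const_mul _) (Eventually.of_forall h3)).trans (le_of_eq ?_)
    rw [integral_const_mul, (hint n).2, mul_one]
  · refine le_trans (le_of_eq (lintegral_congr_ae ?_)) (hwk n)
    filter_upwards [hψ n] with ξ hξ
    rw [hξ]
    congr 2
    rw [enorm_eq_nnnorm]
    congr 1
    ext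
    simp

/-- Attractive potentials create negative eigenvalues if `1/T` is not integrable near a point. -/
theorem hasNegEigenvalue_of_nonpos (hT : Measurable T) {ξ₀ : RSpace d}
    (h : ∀ r : ℝ, 0 < r →
      ∫⁻ ξ in Metric.ball ξ₀ r, (T ((2 * Real.pi) • ξ) : ℝ≥0∞)⁻¹ = ∞)
    {V : RSpace d → ℝ} (hVm : Measurable V) (hV : RelFormCompact T V) (hne : NonTrivial V)
    (hle : ∀ᵐ x, V x ≤ 0) : HasNegEigenvalue T V := by
  obtain ⟨ψ, Ψ, hψΨ, hΨc, hΨ1, hΨlim, hkin⟩ := exists_planeWave_seq hT h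
  by_contra hcon
  have hdom : ∀ n, ψ n ∈ kinFormDomain T := fun n => (hkin n).trans_lt ENNReal.coe_lt_top
  -- Without negative eigenvalues the energy of each trial function is nonnegative, so its potential
  -- part is bounded by its kinetic part.
  have hpot : ∀ n, ∫⁻ x, ‖V x‖ₑ * ‖Ψ n x‖ₑ ^ 2 ≤ ((1 / ((n : ℝ≥0) + 1) : ℝ≥0) : ℝ≥0∞) := by
    intro n
    have h1 : 0 ≤ (kinForm T (ψ n) (ψ n) + potForm V (ψ n) (ψ n)).re := by
      by_contra hlt
      exact hcon (hasNegEigenvalue_of_neg hT hVm hV (hdom n) (not_le.1 hlt))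
    have hint : Integrable fun x => |V x| * ‖ψ n x‖ ^ 2 := hV.integrable_sq hT (hdom n)
    have h2 : potForm V (ψ n) (ψ n) = ((-∫ x, |V x| * ‖ψ n x‖ ^ 2 : ℝ) : ℂ) := by
      rw [potForm_self, ← integral_neg]
      congr 1
      refine integral_congr_ae ?_
      filter_upwards [hle] with x hx
      rw [abs_of_nonpos hx]
      ring
    rw [Complex.add_re, h2, Complex.ofReal_re, kinForm_self_re hT] at h1
    have h3 : ∫⁻ x, ‖V x‖ₑ * ‖Ψ n x‖ₑ ^ 2 = ENNReal.ofReal (∫ x, |V x| * ‖ψ n x‖ ^ 2) := by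
      rw [ofReal_integral_eq_lintegral_ofReal hint (Eventually.of_forall fun x => by positivity)]
      refine lintegral_congr_ae ?_
      filter_upwards [hψΨ n] with x hx
      rw [hx, ENNReal.ofReal_mul (abs_nonneg _), ENNReal.ofReal_pow (norm_nonneg _), ofReal_norm,
        ← Real.norm_eq_abs, ofReal_norm]
    rw [h3]
    refine le_trans ?_ (hkin n)
    rw [← ENNReal.ofReal_toReal (hdom n).ne]
    exact ENNReal.ofReal_le_ofReal (by linarith)
  have hzero : ∫⁻ x, ‖V x‖ₑ = 0 := by
    have h1 : ∀ x, Tendsto (fun n => ‖V x‖ₑ * ‖Ψ n x‖ₑ ^ 2) atTop (𝓝 ‖V x‖ₑ) := by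
      intro x
      have h2 : Tendsto (fun n => ‖Ψ n x‖ₑ ^ 2) atTop (𝓝 1) := by
        have := ENNReal.tendsto_ofReal ((hΨlim x).norm.pow 2)
        rw [Circle.norm_coe, one_pow, ENNReal.ofReal_one] at this
        refine this.congr fun n => ?_
        rw [ENNReal.ofReal_pow (norm_nonneg _), ofReal_norm]
      simpa using ENNReal.Tendsto.const_mul h2 (Or.inl one_ne_zero)
    -- Fatou's lemma rather than dominated convergence, as V need not be integrable.
    have h2 : ∫⁻ x, ‖V x‖ₑ ≤ liminf (fun n => ∫⁻ x, ‖V x‖ₑ * ‖Ψ n x‖ₑ ^ 2) atTop := by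
      calc ∫⁻ x, ‖V x‖ₑ = ∫⁻ x, liminf (fun n => ‖V x‖ₑ * ‖Ψ n x‖ₑ ^ 2) atTop :=
            lintegral_congr fun x => (h1 x).liminf_eq.symm
        _ ≤ _ := lintegral_liminf_le fun n => hVm.enorm.mul ((hΨc n).measurable.enorm.pow_const 2)
    have h3 : Tendsto (fun n : ℕ => ((1 / ((n : ℝ≥0) + 1) : ℝ≥0) : ℝ≥0∞)) atTop (𝓝 0) := by
      rw [← ENNReal.coe_zero, ENNReal.tendsto_coe, ← NNReal.tendsto_coe]
      simpa using (tendsto_one_div_add_atTop_nhds_zero_nat (𝕜 := ℝ))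
    have h4 := tendsto_of_tendsto_of_tendsto_of_le_of_le tendsto_const_nhds h3
      (fun n => zero_le) hpot
    rw [h4.liminf_eq] at h2
    exact le_antisymm h2 zero_le
  rw [lintegral_eq_zero_iff hVm.enorm] at hzero
  refine hne ?_
  filter_upwards [hzero] with x hx
  simpa using hx

end WeaklyCoupled

/-! ### Integrable potentials with nonpositive integral -/

section IntegrablePotentials

variable {d : ℕ} {T : RSpace d → ℝ≥0}

theorem continuous_fourier {h : RSpace d → ℂ} (hh : Integrable h) : Continuous (𝓕 h) :=
  VectorFourier.fourierIntegral_continuous (μ := volume) (L := innerₗ (RSpace d))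
    Real.continuous_fourierChar (by simp only [innerₗ_apply_apply]; fun_prop) hh

theorem norm_fourier_le {h : RSpace d → ℂ} (x : RSpace d) : ‖𝓕 h x‖ ≤ ∫ ξ, ‖h ξ‖ := by
  rw [Real.fourier_eq]
  refine (norm_integral_le_integral_norm _).trans (le_of_eq ?_)
  simp only [Circle.norm_smul]

theorem fourier_conj (h : RSpace d → ℂ) (x : RSpace d) :
    𝓕 (fun ξ => conj (h ξ)) x = conj (𝓕⁻ h x) := by
  rw [Real.fourier_eq, Real.fourierInv_eq, ← integral_conj]
  refine integral_congr_ae (Eventually.of_forall fun ξ => ?_)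
  simp only [Circle.smul_def, smul_eq_mul, map_mul]
  rw [AddChar.map_neg_eq_inv, Circle.coe_inv_eq_conj]

theorem norm_add_smul_sq (a b : ℂ) (t : ℝ) :
    ‖a + t * b‖ ^ 2 = ‖a‖ ^ 2 + 2 * t * (a * conj b).re + t ^ 2 * ‖b‖ ^ 2 := by
  rw [← Complex.normSq_eq_norm_sq, ← Complex.normSq_eq_norm_sq, ← Complex.normSq_eq_norm_sq,
    Complex.normSq_add]
  simp only [map_mul, Complex.conj_ofReal, Complex.normSq_ofReal]
  have : (a * ((t : ℂ) * conj b)).re = t * (a * conj b).re := by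
    rw [mul_left_comm, Complex.re_ofReal_mul]
  rw [this]
  ring

/-- Avoids the cross term. The lost factors 2 are harmless: the kinetic energy of ψ tends to 0 in
the application, and the term in φ is of order t². -/
theorem kinetic_add_smul_le (hT : Measurable T) (ψ φ : L2 d) (t : ℝ) :
    ∫⁻ ξ, (T ((2 * Real.pi) • ξ) : ℝ≥0∞) * ‖(𝓕 (ψ + (t : ℂ) • φ) : L2 d) ξ‖ₑ ^ 2 ≤
      2 * (∫⁻ ξ, (T ((2 * Real.pi) • ξ) : ℝ≥0∞) * ‖(𝓕 ψ : L2 d) ξ‖ₑ ^ 2) +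
      ENNReal.ofReal (2 * t ^ 2) *
        ∫⁻ ξ, (T ((2 * Real.pi) • ξ) : ℝ≥0∞) * ‖(𝓕 φ : L2 d) ξ‖ₑ ^ 2 := by
  rw [← lintegral_const_mul' _ _ (by finiteness), ← lintegral_const_mul' _ _ (by finiteness),
    ← lintegral_add_left']
  · refine lintegral_mono_ae ?_
    filter_upwards [coeFn_fourier_add ψ ((t : ℂ) • φ), coeFn_fourier_smul (t : ℂ) φ] with ξ h1 h2
    rw [h1, h2]
    have h3 := enorm_add_sq_le ((𝓕 ψ : L2 d) ξ) ((t : ℂ) * (𝓕 φ : L2 d) ξ)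
      (t := 1 / 2) (by norm_num) (by norm_num)
    have h4 : ‖(t : ℂ) * (𝓕 φ : L2 d) ξ‖ₑ ^ 2 =
        ENNReal.ofReal (t ^ 2) * ‖(𝓕 φ : L2 d) ξ‖ₑ ^ 2 := by
      rw [enorm_mul, mul_pow, ← ofReal_norm (t : ℂ), ← ENNReal.ofReal_pow (norm_nonneg _),
        Complex.norm_real, Real.norm_eq_abs, sq_abs]
    rw [h4] at h3
    norm_num at h3
    rw [ENNReal.ofReal_mul (by norm_num), ENNReal.ofReal_ofNat]
    calc (T ((2 * Real.pi) • ξ) : ℝ≥0∞) * ‖(𝓕 ψ : L2 d) ξ + t * (𝓕 φ : L2 d) ξ‖ₑ ^ 2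
        ≤ (T ((2 * Real.pi) • ξ) : ℝ≥0∞) * (2 * ‖(𝓕 ψ : L2 d) ξ‖ₑ ^ 2 +
          2 * (ENNReal.ofReal (t ^ 2) * ‖(𝓕 φ : L2 d) ξ‖ₑ ^ 2)) := by gcongr
      _ = _ := by ring
  · exact ((measurable_freqSymbol hT).coe_nnreal_ennreal.aemeasurable.mul
      ((Lp.aestronglyMeasurable _).enorm.pow_const 2)).const_mul _

/-- A function correlated with `V` along a plane wave. -/
theorem exists_correlated (hloc : ∀ K : Set (RSpace d), IsCompact K → BddAbove (T '' K))
    {V : RSpace d → ℝ} (hVi : Integrable V) (hne : NonTrivial V) (ξ₀ : RSpace d) :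
    ∃ (φ : L2 d) (Φ : RSpace d → ℂ), φ =ᵐ[volume] Φ ∧ Continuous Φ ∧ (∃ C, ∀ x, ‖Φ x‖ ≤ C) ∧
      φ ∈ kinFormDomain T ∧
      (∫ x, (V x : ℂ) * ((Real.fourierChar (inner ℝ ξ₀ x) : ℂ) * conj (Φ x))).re < 0 := by
  set e : RSpace d → ℂ := fun x => (Real.fourierChar (inner ℝ ξ₀ x) : ℂ) with he
  have hec : Continuous e :=
    continuous_subtype_val.comp (Real.continuous_fourierChar.comp (by fun_prop))
  have hen : ∀ x, ‖e x‖ = 1 := fun x => Circle.norm_coe _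
  set f : RSpace d → ℂ := fun x => (V x : ℂ) * e x with hf
  have hfi : Integrable f := by
    refine hVi.mono (hVi.ofReal.1.mul hec.aestronglyMeasurable)
      (Eventually.of_forall fun x => ?_)
    simp [hf, hen]
  set F := 𝓕 f with hF
  have hFc : Continuous F := continuous_fourier hfi
  obtain ⟨ξ₁, hξ₁⟩ : ∃ ξ₁, F ξ₁ ≠ 0 := by
    by_contra hcon
    push Not at hcon
    refine hne ?_
    filter_upwards [ae_eq_zero_of_fourier_eq_zero hfi hcon] with x hx
    have h1 : ‖f x‖ = |V x| := by simp [hf, hen]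
    rw [hx] at h1
    exact abs_eq_zero.1 (by simpa using h1.symm)
  set B := Metric.closedBall ξ₁ 1 with hB
  have hBm : MeasurableSet B := measurableSet_closedBall
  have hBc : IsCompact B := isCompact_closedBall _ _
  -- The choice φ̂ = -F on a ball where F, the transform of V times the plane wave, is not
  -- identically 0 makes the correlation equal to -∫ |F|² over the ball, hence negative.
  set H : RSpace d → ℂ := B.indicator fun ξ => -F ξ with hH
  have hHi : Integrable H :=
    (integrable_indicator_iff hBm).2 (hFc.neg.continuousOn.integrableOn_compact hBc)
  set A := ∫ x, ‖f x‖ with hA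
  have hHb : ∀ ξ, ‖H ξ‖ ≤ A := by
    intro ξ
    rw [hH, norm_indicator_eq_indicator_norm]
    refine indicator_le_self' (fun _ _ => norm_nonneg _) ξ |>.trans ?_
    rw [norm_neg]
    exact norm_fourier_le ξ
  obtain ⟨φ, hφ⟩ := exists_fourier_eq (memLp_two_of_integrable_of_bounded hHi hHb)
  refine ⟨φ, 𝓕⁻ H, ae_eq_fourierInv_of_integrable hφ hHi, continuous_fourierInv hHi,
    ⟨_, fun x => norm_fourierInv_le x⟩, ?_, ?_⟩
  · obtain ⟨M, hM⟩ := hloc _ (hBc.image (continuous_const_smul (2 * Real.pi)))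
    have h1 : ∀ᵐ ξ, (T ((2 * Real.pi) • ξ) : ℝ≥0∞) * ‖(𝓕 φ : L2 d) ξ‖ₑ ^ 2 ≤
        B.indicator (fun _ => (M : ℝ≥0∞) * ENNReal.ofReal A ^ 2) ξ := by
      filter_upwards [hφ] with ξ hξ
      rw [hξ]
      by_cases hξB : ξ ∈ B
      · rw [indicator_of_mem hξB]
        gcongr
        · exact hM ⟨_, ⟨ξ, hξB, rfl⟩, rfl⟩
        · rw [← ofReal_norm]
          exact ENNReal.ofReal_le_ofReal (hHb ξ)
      · rw [hH, indicator_of_notMem hξB]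
        simp
    refine (lintegral_mono_ae h1).trans_lt ?_
    rw [lintegral_indicator hBm, setLIntegral_const]
    exact ENNReal.mul_lt_top (by finiteness) hBc.measure_lt_top
  · have h1 : ∫ x, (V x : ℂ) * (e x * conj (𝓕⁻ H x)) = ∫ ξ, F ξ * conj (H ξ) := by
      have hHi' : Integrable fun ξ => conj (H ξ) :=
        hHi.mono (Complex.continuous_conj.comp_aestronglyMeasurable hHi.1)
          (Eventually.of_forall fun ξ => by simp)
      rw [hF, integral_fourier_mul_eq hfi hHi']
      refine integral_congr_ae (Eventually.of_forall fun x => ?_)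
      simp only [fourier_conj, hf]
      ring
    have h2 : ∀ ξ, F ξ * conj (H ξ) = ((-(B.indicator (fun ξ => ‖F ξ‖ ^ 2) ξ) : ℝ) : ℂ) := by
      intro ξ
      by_cases hξ : ξ ∈ B
      · simp only [hH, indicator_of_mem hξ]
        rw [map_neg, mul_neg, Complex.mul_conj']
        push_cast
        rfl
      · simp [hH, hξ]
    rw [h1]
    simp_rw [h2]
    rw [integral_complex_ofReal, Complex.ofReal_re, integral_neg, neg_lt_zero,
      integral_pos_iff_support_of_nonneg]
    · have hopen : IsOpen (Metric.ball ξ₁ 1 ∩ F ⁻¹' {0}ᶜ) :=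
        Metric.isOpen_ball.inter (isOpen_compl_singleton.preimage hFc)
      refine (hopen.measure_pos volume ⟨ξ₁, Metric.mem_ball_self one_pos, hξ₁⟩).trans_le
        (measure_mono fun ξ hξ => ?_)
      rw [Function.mem_support, indicator_of_mem (Metric.ball_subset_closedBall hξ.1)]
      have : F ξ ≠ 0 := hξ.2
      positivity
    · exact fun ξ => indicator_nonneg (fun _ _ => by positivity) ξ
    · exact (integrable_indicator_iff hBm).2
        ((hFc.norm.pow 2).continuousOn.integrableOn_compact hBc)

/-- Integrable potentials with nonpositive integral create negative eigenvalues if `1/T` is not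
integrable near a point and `T` is locally bounded. -/
theorem hasNegEigenvalue_of_integral_nonpos (hT : Measurable T)
    (hloc : ∀ K : Set (RSpace d), IsCompact K → BddAbove (T '' K)) {ξ₀ : RSpace d}
    (h : ∀ r : ℝ, 0 < r →
      ∫⁻ ξ in Metric.ball ξ₀ r, (T ((2 * Real.pi) • ξ) : ℝ≥0∞)⁻¹ = ∞)
    {V : RSpace d → ℝ} (hVm : Measurable V) (hVi : Integrable V) (hV : RelFormCompact T V)
    (hne : NonTrivial V) (hle : ∫ x, V x ≤ 0) : HasNegEigenvalue T V := by
  obtain ⟨ψ, Ψ, hψΨ, hΨc, hΨ1, hΨlim, hkin⟩ := exists_planeWave_seq hT h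
  obtain ⟨φ, Φ, hφΦ, hΦc, ⟨C, hC⟩, hφ, hb⟩ := exists_correlated hloc hVi hne ξ₀
  set e : RSpace d → ℂ := fun x => (Real.fourierChar (inner ℝ ξ₀ x) : ℂ) with he
  have hec : Continuous e :=
    continuous_subtype_val.comp (Real.continuous_fourierChar.comp (by fun_prop))
  have hen : ∀ x, ‖e x‖ = 1 := fun x => Circle.norm_coe _
  set k := ∫⁻ ξ, (T ((2 * Real.pi) • ξ) : ℝ≥0∞) * ‖(𝓕 φ : L2 d) ξ‖ₑ ^ 2 with hk
  have hktop : k ≠ ∞ := (show k < ∞ from hφ).ne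
  set b := (∫ x, (V x : ℂ) * (e x * conj (Φ x))).re with hbdef
  set c := ∫ x, V x * ‖Φ x‖ ^ 2 with hc
  have hC0 : 0 ≤ C := (norm_nonneg _).trans (hC 0)
  have hcross : Integrable fun x => (V x : ℂ) * (e x * conj (Φ x)) := by
    refine (hVi.norm.mul_const C).mono' (hVi.ofReal.1.mul
      (hec.mul (Complex.continuous_conj.comp hΦc)).aestronglyMeasurable)
      (Eventually.of_forall fun x => ?_)
    rw [norm_mul, norm_mul, hen, one_mul, RCLike.norm_conj, Complex.norm_real]
    gcongr
    exact hC x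
  have hquad : Integrable fun x => V x * ‖Φ x‖ ^ 2 := by
    refine (hVi.norm.mul_const (C ^ 2)).mono' (hVi.1.mul (hΦc.norm.pow 2).aestronglyMeasurable)
      (Eventually.of_forall fun x => ?_)
    rw [norm_mul, norm_pow, norm_norm]
    gcongr
    exact hC x
  have hexpand : ∀ t : ℝ, ∫ x, V x * ‖e x + t * Φ x‖ ^ 2 =
      (∫ x, V x) + 2 * t * b + t ^ 2 * c := by
    intro t
    have h1 : ∀ x, V x * ‖e x + t * Φ x‖ ^ 2 =
        V x + 2 * t * ((V x : ℂ) * (e x * conj (Φ x))).re + t ^ 2 * (V x * ‖Φ x‖ ^ 2) := by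
      intro x
      rw [norm_add_smul_sq, hen, Complex.re_ofReal_mul]
      ring
    have hre : Integrable fun x => ((V x : ℂ) * (e x * conj (Φ x))).re := hcross.re
    simp_rw [h1]
    have hs : Integrable fun x => V x + 2 * t * ((V x : ℂ) * (e x * conj (Φ x))).re :=
      hVi.add (hre.const_mul _)
    rw [integral_add hs (hquad.const_mul _),
      integral_add hVi (hre.const_mul _), integral_const_mul, integral_const_mul]
    have h2 : ∫ x, ((V x : ℂ) * (e x * conj (Φ x))).re = b := integral_re hcross
    rw [h2]
  set D := 2 * k.toReal + |c| with hD
  have hD0 : 0 ≤ D := by positivity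
  -- With ∫ V ≤ 0 the limiting energy bound is at most 2tb + t²D, and this t gives t²D ≤ -tb, so the
  -- bound is at most tb < 0.
  set t := -b / (D + 1) with ht
  have ht0 : 0 < t := div_pos (by linarith) (by linarith)
  have htD : t * (D + 1) = -b := by rw [ht]; field_simp
  have hlimneg : 2 * t ^ 2 * k.toReal + ∫ x, V x * ‖e x + t * Φ x‖ ^ 2 < 0 := by
    rw [hexpand]
    have h1 : t ^ 2 * c ≤ t ^ 2 * |c| := by gcongr; exact le_abs_self c
    have h2 : t ^ 2 * D ≤ t * -b := by rw [← htD]; nlinarith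
    nlinarith
  have hpotlim : Tendsto (fun n => ∫ x, V x * ‖Ψ n x + t * Φ x‖ ^ 2) atTop
      (𝓝 (∫ x, V x * ‖e x + t * Φ x‖ ^ 2)) := by
    refine tendsto_integral_of_dominated_convergence (fun x => ‖V x‖ * (1 + t * C) ^ 2)
      (fun n => ?_) (hVi.norm.mul_const _) (fun n => Eventually.of_forall fun x => ?_)
      (Eventually.of_forall fun x => ?_)
    · have := hΨc n
      exact hVi.1.mul (Continuous.aestronglyMeasurable (by fun_prop))
    · rw [norm_mul, norm_pow, norm_norm]
      gcongr
      refine (norm_add_le _ _).trans ?_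
      rw [norm_mul, Complex.norm_real, Real.norm_of_nonneg ht0.le]
      gcongr
      · exact hΨ1 n x
      · exact hC x
    · exact (((hΨlim x).add_const _).norm.pow 2).const_mul _
  have hseq : Tendsto (fun n : ℕ => 2 * (1 / ((n : ℝ) + 1)) + 2 * t ^ 2 * k.toReal +
      ∫ x, V x * ‖Ψ n x + t * Φ x‖ ^ 2) atTop
      (𝓝 (2 * 0 + 2 * t ^ 2 * k.toReal + ∫ x, V x * ‖e x + t * Φ x‖ ^ 2)) :=
    (((tendsto_one_div_add_atTop_nhds_zero_nat (𝕜 := ℝ)).const_mul 2).add_const _).add hpotlim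
  rw [mul_zero, zero_add] at hseq
  obtain ⟨n, hn⟩ := (hseq.eventually (gt_mem_nhds hlimneg)).exists
  have hkn := (kinetic_add_smul_le hT (ψ n) φ t).trans
    (add_le_add_left (mul_le_mul_right (hkin n) 2) _)
  have hrhs : 2 * ((1 / ((n : ℝ≥0) + 1) : ℝ≥0) : ℝ≥0∞) + ENNReal.ofReal (2 * t ^ 2) * k ≠ ∞ := by
    finiteness
  refine hasNegEigenvalue_of_neg hT hVm hV (ψ := ψ n + (t : ℂ) • φ)
    (hkn.trans_lt hrhs.lt_top) ?_
  rw [Complex.add_re, kinForm_self_re hT, potForm_self, Complex.ofReal_re]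
  have h1 : ∫ x, V x * ‖(ψ n + (t : ℂ) • φ) x‖ ^ 2 = ∫ x, V x * ‖Ψ n x + t * Φ x‖ ^ 2 := by
    refine integral_congr_ae ?_
    filter_upwards [Lp.coeFn_add (ψ n) ((t : ℂ) • φ), Lp.coeFn_smul (t : ℂ) φ, hψΨ n, hφΦ]
      with x h1 h2 h3 h4
    rw [h1, Pi.add_apply, h2, Pi.smul_apply, h3, h4, smul_eq_mul]
  rw [h1]
  have h2 := ENNReal.toReal_mono hrhs hkn
  rw [ENNReal.toReal_add (by finiteness) (by finiteness), ENNReal.toReal_mul, ENNReal.toReal_mul,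
    ENNReal.toReal_ofReal (by positivity)] at h2
  have h3 : (((1 / ((n : ℝ≥0) + 1) : ℝ≥0) : ℝ≥0∞)).toReal = 1 / ((n : ℝ) + 1) := by
    rw [ENNReal.coe_toReal]
    push_cast
    rfl
  rw [h3, ENNReal.toReal_ofNat] at h2
  linarith

end IntegrablePotentials

/-! ### Translates of potentials and of sets of positive measure -/

section Translation

variable {d : ℕ} {T : RSpace d → ℝ≥0}

theorem fourierInv_fourierChar_mul (h : RSpace d → ℂ) (a x : RSpace d) :
    𝓕⁻ (fun ξ => (Real.fourierChar (inner ℝ ξ a) : ℂ) * h ξ) x = 𝓕⁻ h (x + a) := by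
  rw [Real.fourierInv_eq, Real.fourierInv_eq]
  refine integral_congr_ae (Eventually.of_forall fun ξ => ?_)
  simp only [Circle.smul_def, smul_eq_mul, inner_add_right, AddChar.map_add_eq_mul, Circle.coe_mul]
  ring

/-- Translations of `L²` are the Fourier multipliers with symbol `exp (2πi ⟨ξ, a⟩)`. -/
theorem exists_translation (a : RSpace d) :
    ∃ M : L2 d →L[ℂ] L2 d, (∀ f, ‖M f‖ ≤ ‖f‖) ∧ (∀ f, M f =ᵐ[volume] fun x => f (x + a)) ∧
      ∀ f, (𝓕 (M f) : L2 d) =ᵐ[volume]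
        fun ξ => (Real.fourierChar (inner ℝ ξ a) : ℂ) * (𝓕 f : L2 d) ξ := by
  have hc : Continuous fun ξ : RSpace d => (Real.fourierChar (inner ℝ ξ a) : ℂ) :=
    continuous_subtype_val.comp (Real.continuous_fourierChar.comp (by fun_prop))
  obtain ⟨M, hM1, hM⟩ := exists_fourierMultiplier hc.measurable
    fun ξ => (Circle.norm_coe (Real.fourierChar (inner ℝ ξ a))).le
  refine ⟨M, hM1, ?_, hM⟩
  have hmp : MeasurePreserving (fun x : RSpace d => x + a) volume volume :=
    measurePreserving_add_right _ a
  -- Both sides are continuous, so it suffices to compare them on Schwartz functions, where the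
  -- Fourier integral converges.
  have key : (M : L2 d → L2 d) = Lp.compMeasurePreservingₗᵢ ℂ (fun x : RSpace d => x + a) hmp := by
    refine (SchwartzMap.denseRange_toLpCLM (E := RSpace d) (F := ℂ) (p := 2) (μ := volume)
      ENNReal.ofNat_ne_top).equalizer M.continuous (LinearIsometry.continuous _) ?_
    funext g
    simp only [Function.comp_apply, SchwartzMap.toLpCLM_apply]
    refine Lp.ext ?_
    set G : SchwartzMap (RSpace d) ℂ := 𝓕 g with hG
    have h1 : (𝓕 (g.toLp 2 : L2 d) : L2 d) =ᵐ[volume] G := by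
      rw [SchwartzMap.toLp_fourier_eq]
      exact G.coeFn_toLp 2
    have h2 : (𝓕 (M (g.toLp 2)) : L2 d) =ᵐ[volume]
        fun ξ => (Real.fourierChar (inner ℝ ξ a) : ℂ) * G ξ := by
      filter_upwards [hM (g.toLp 2), h1] with ξ h3 h4
      rw [h3, h4]
    have h3 : Integrable fun ξ => (Real.fourierChar (inner ℝ ξ a) : ℂ) * G ξ := by
      refine G.integrable.norm.mono' (hc.aestronglyMeasurable.mul
        G.continuous.aestronglyMeasurable) (Eventually.of_forall fun ξ => ?_)
      rw [norm_mul, Circle.norm_coe, one_mul]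
    have h4 := ae_eq_fourierInv_of_integrable h2 h3
    have h5 : (Lp.compMeasurePreserving (fun x : RSpace d => x + a) hmp (g.toLp 2) : L2 d)
        =ᵐ[volume] _ := Lp.coeFn_compMeasurePreserving _ hmp
    have h6 := hmp.quasiMeasurePreserving.ae_eq (g.coeFn_toLp 2 volume)
    have h7 : 𝓕⁻ (⇑G) = g := by
      rw [hG, ← SchwartzMap.fourierInv_coe, FourierTransform.fourierInv_fourier_eq]
    refine (h4.trans ?_).trans (h5.trans h6).symm
    refine Eventually.of_forall fun x => ?_
    rw [fourierInv_fourierChar_mul, h7]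
    rfl
  intro f
  rw [key]
  exact Lp.coeFn_compMeasurePreserving f hmp

/-- Translates of relatively form compact potentials, with a uniform bound on the operators. -/
theorem exists_compact_translate {V : RSpace d → ℝ} {K : L2 d →L[ℂ] L2 d}
    (hKc : IsCompactOperator K)
    (hK : ∀ f g φ ψ : L2 d, IsInvSqrtApply T f φ → IsInvSqrtApply T g ψ →
      Integrable (fun x => |V x| * (‖φ x‖ * ‖ψ x‖)) ∧
      inner ℂ f (K g) = potForm (fun x => |V x|) φ ψ) (a : RSpace d) :
    ∃ K' : L2 d →L[ℂ] L2 d, IsCompactOperator K' ∧ ‖K'‖ ≤ ‖K‖ ∧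
      ∀ f g φ ψ : L2 d, IsInvSqrtApply T f φ → IsInvSqrtApply T g ψ →
        inner ℂ f (K' g) = potForm (fun x => |V (x - a)|) φ ψ := by
  obtain ⟨M, hM1, hMa, hMF⟩ := exists_translation a
  have hM : ‖M‖ ≤ 1 := M.opNorm_le_bound zero_le_one fun f => by simpa using hM1 f
  have happly : ∀ f φ : L2 d, IsInvSqrtApply T f φ → IsInvSqrtApply T (M f) (M φ) := by
    intro f φ h
    rw [IsInvSqrtApply]
    filter_upwards [h, hMF f, hMF φ] with ξ h1 h2 h3
    rw [h3, h2, h1]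
    ring
  refine ⟨M.adjoint ∘L K ∘L M, (hKc.comp_clm M).clm_comp M.adjoint, ?_, ?_⟩
  · refine (M.adjoint.opNorm_comp_le _).trans ?_
    rw [LinearIsometryEquiv.norm_map]
    refine (mul_le_of_le_one_left (norm_nonneg _) hM).trans ((K.opNorm_comp_le M).trans ?_)
    exact mul_le_of_le_one_right (norm_nonneg _) hM
  · intro f g φ ψ hf hg
    rw [ContinuousLinearMap.comp_apply, ContinuousLinearMap.adjoint_inner_right,
      ContinuousLinearMap.comp_apply, (hK _ _ _ _ (happly f φ hf) (happly g ψ hg)).2, potForm,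
      potForm, ← integral_add_right_eq_self (fun x => ((|V (x - a)| : ℝ) : ℂ) * _) a]
    refine integral_congr_ae ?_
    filter_upwards [hMa φ, hMa ψ] with x h1 h2
    rw [h1, h2, add_sub_cancel_right]

/-- A countable dense set of translates of a set of positive measure covers almost everything. -/
theorem ae_exists_add_mem_of_denseRange {ι : Type*} [Countable ι] {a : ι → RSpace d}
    (ha : DenseRange a) {s : Set (RSpace d)} (hs : MeasurableSet s) (hs0 : volume s ≠ 0) :
    ∀ᵐ x, ∃ i, x - a i ∈ s := by
  wlog hfin : volume s ≠ ∞ generalizing s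
  · obtain ⟨t, ht, hts, ht0, htop⟩ := Measure.exists_subset_measure_lt_top hs
      (pos_iff_ne_zero.2 hs0)
    filter_upwards [this ht ht0.ne' htop.ne] with x hx
    exact hx.imp fun i hi => hts hi
  set A := {x | ∀ i, x - a i ∉ s} with hA
  have hAm : MeasurableSet A := by
    have : A = ⋂ i, ((fun x => x - a i) ⁻¹' s)ᶜ := by ext; simp [hA]
    rw [this]
    exact MeasurableSet.iInter fun i => (hs.preimage (measurable_id.sub_const _)).compl
  set f : RSpace d → C(RSpace d, RSpace d) := fun b => ⟨fun x => x - b, by fun_prop⟩ with hf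
  have hmp : ∀ b, MeasurePreserving (f b) (volume : Measure (RSpace d)) volume :=
    fun b => measurePreserving_sub_right _ b
  have hfc : Continuous f :=
    ContinuousMap.continuous_of_continuous_uncurry _ (by
      simp only [hf, Function.uncurry_def, ContinuousMap.coe_mk]; fun_prop)
  -- A avoids the translates of s along the dense sequence. Translation is continuous in measure, so
  -- A meets every translate in a null set.
  have hzero : ∀ b, volume (A ∩ f b ⁻¹' s) = 0 := by
    intro b
    refine le_antisymm (ENNReal.le_of_forall_pos_le_add fun ε hε _ => ?_) zero_le
    have h1 := tendsto_measure_symmDiff_preimage_nhds_zero (hfc.tendsto b)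
      (Eventually.of_forall hmp) (hmp b) hs.nullMeasurableSet hfin
    have h2 := h1.eventually (ge_mem_nhds (ENNReal.coe_pos.2 hε))
    obtain ⟨_, hi, i, rfl⟩ := mem_closure_iff_nhds.1 (ha b) _ h2
    rw [zero_add]
    refine (measure_mono fun x hx => ?_).trans hi
    exact Or.inr ⟨hx.2, hx.1 i⟩
  -- By Tonelli, almost every x in A would have {b | x - b ∈ s} null; but this set has the measure
  -- of s, so A is null.
  have hcomm : ∀ᵐ x, ∀ᵐ b : RSpace d, ¬ (x ∈ A ∧ x - b ∈ s) := by
    refine (Measure.ae_ae_comm (p := fun b x : RSpace d => ¬ (x ∈ A ∧ x - b ∈ s)) ?_).1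
      (Eventually.of_forall fun b => ?_)
    · exact ((hAm.preimage measurable_snd).inter
        (hs.preimage (measurable_snd.sub measurable_fst))).compl
    · rw [ae_iff]
      simpa using! hzero b
  filter_upwards [hcomm] with x hx
  by_contra! hcon
  have hxA : x ∈ A := hcon
  refine hs0 ?_
  have h1 : volume ((fun b => x - b) ⁻¹' s) = 0 := by
    rw [ae_iff] at hx
    simpa [hxA] using! hx
  rwa [(Measure.measurePreserving_sub_left volume x).measure_preimage hs.nullMeasurableSet] at h1

end Translation

/-! ### Almost everywhere positive potentials and the converse of the quantitative bound -/

section PositivePotential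

variable {d : ℕ} {T : RSpace d → ℝ≥0}

theorem integrable_norm_mul_norm (φ ψ : L2 d) : Integrable fun x => ‖φ x‖ * ‖ψ x‖ := by
  refine (L2.integrable_inner (𝕜 := ℂ) φ ψ).norm.congr (Eventually.of_forall fun x => ?_)
  simp only [RCLike.inner_apply, norm_mul, RCLike.norm_conj]
  ring

/-- Absolutely convergent series of uniformly bounded relatively form compact potentials. -/
theorem relFormCompact_of_hasSum {v : ℕ → RSpace d → ℝ} (hv : ∀ n, Measurable (v n))
    (hv0 : ∀ n x, 0 ≤ v n x) (hv1 : ∀ n x, v n x ≤ 1) {c : ℕ → ℝ} (hc0 : ∀ n, 0 ≤ c n)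
    (hc : Summable c) {K : ℕ → L2 d →L[ℂ] L2 d} {C : ℝ} (hKC : ∀ n, ‖K n‖ ≤ C)
    (hKc : ∀ n, IsCompactOperator (K n))
    (hK : ∀ n, ∀ f g φ ψ : L2 d, IsInvSqrtApply T f φ → IsInvSqrtApply T g ψ →
      inner ℂ f (K n g) = potForm (v n) φ ψ) :
    RelFormCompact T fun x => ∑' n, c n * v n x := by
  have hle : ∀ n x, c n * v n x ≤ c n := fun n x => mul_le_of_le_one_right (hc0 n) (hv1 n x)
  have hnn : ∀ n x, 0 ≤ c n * v n x := fun n x => mul_nonneg (hc0 n) (hv0 n x)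
  have hsum : ∀ x, Summable fun n => c n * v n x := fun x =>
    Summable.of_nonneg_of_le (fun n => hnn n x) (fun n => hle n x) hc
  have hW0 : ∀ x, 0 ≤ ∑' n, c n * v n x := fun x => tsum_nonneg fun n => hnn n x
  have hWm : Measurable fun x => ∑' n, c n * v n x :=
    Measurable.tsum fun n => (hv n).const_mul _
  have hKs : Summable fun n => (c n : ℂ) • K n := by
    refine Summable.of_norm_bounded (hc.mul_right C) fun n => ?_
    rw [norm_smul, Complex.norm_real, Real.norm_of_nonneg (hc0 n)]
    exact mul_le_mul_of_nonneg_left (hKC n) (hc0 n)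
  refine ⟨∑' n, (c n : ℂ) • K n, ?_, fun f g φ ψ hf hg => ⟨?_, ?_⟩⟩
  -- The series of operators converges in norm, and norm limits of compact operators are compact.
  · refine isCompactOperator_of_tendsto hKs.hasSum (Eventually.of_forall fun s => ?_)
    exact (compactOperator (RingHom.id ℂ) (L2 d) (L2 d)).sum_mem fun n _ => (hKc n).smul (c n : ℂ)
  · refine ((integrable_norm_mul_norm φ ψ).const_mul (∑' n, c n)).mono'
      (hWm.norm.aestronglyMeasurable.mul
        ((Lp.aestronglyMeasurable φ).norm.mul (Lp.aestronglyMeasurable ψ).norm))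
      (Eventually.of_forall fun x => ?_)
    rw [Real.norm_of_nonneg (by positivity), abs_of_nonneg (hW0 x)]
    gcongr with n
    · exact hsum x
    · exact hle n x
  · have h1 : HasSum (fun n => inner ℂ f (((c n : ℂ) • K n) g))
        (inner ℂ f ((∑' n, (c n : ℂ) • K n) g)) :=
      ((ContinuousLinearMap.apply ℂ (L2 d) g).hasSum hKs.hasSum).mapL (innerSL ℂ f)
    have h2 : HasSum (fun n => ∫ x, ((c n * v n x : ℝ) : ℂ) * (conj (φ x) * ψ x))
        (∫ x, ((∑' n, c n * v n x : ℝ) : ℂ) * (conj (φ x) * ψ x)) := by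
      refine hasSum_integral_of_dominated_convergence (fun n x => c n * (‖φ x‖ * ‖ψ x‖))
        (fun n => ?_) (fun n => Eventually.of_forall fun x => ?_)
        (Eventually.of_forall fun x => hc.mul_right _) ?_ (Eventually.of_forall fun x => ?_)
      · exact (Complex.measurable_ofReal.comp ((hv n).const_mul _)).aestronglyMeasurable.mul
          ((Complex.continuous_conj.comp_aestronglyMeasurable (Lp.aestronglyMeasurable φ)).mul
            (Lp.aestronglyMeasurable ψ))
      · rw [norm_mul, norm_mul, RCLike.norm_conj, Complex.norm_real,
          Real.norm_of_nonneg (hnn n x)]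
        gcongr
        exact hle n x
      · simp only [tsum_mul_right]
        exact (integrable_norm_mul_norm φ ψ).const_mul _
      · exact ((Complex.hasSum_ofReal.2 (hsum x).hasSum)).mul_right _
    have h3 : ∀ n, inner ℂ f (((c n : ℂ) • K n) g) =
        ∫ x, ((c n * v n x : ℝ) : ℂ) * (conj (φ x) * ψ x) := by
      intro n
      rw [smul_apply, inner_smul_right, hK n f g φ ψ hf hg, potForm,
        ← integral_const_mul]
      refine integral_congr_ae (Eventually.of_forall fun x => ?_)
      push_cast
      ring
    simp_rw [h3] at h1
    rw [h1.unique h2, potForm]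
    simp_rw [abs_of_nonneg (hW0 _)]

/-- If there is a nontrivial relatively form compact potential, there is one that is positive
almost everywhere. -/
theorem exists_pos_relFormCompact (hT : Measurable T)
    (hpot : ∃ V : RSpace d → ℝ, Measurable V ∧ NonTrivial V ∧ RelFormCompact T V) :
    ∃ W : RSpace d → ℝ, Measurable W ∧ RelFormCompact T W ∧ (∀ x, 0 ≤ W x) ∧ ∀ᵐ x, 0 < W x := by
  obtain ⟨V, hVm, hne, hV⟩ := hpot
  set v : RSpace d → ℝ := fun x => min |V x| 1 with hv
  have hvm : Measurable v := (continuous_abs.measurable.comp hVm).min measurable_const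
  have hv0 : ∀ x, 0 ≤ v x := fun x => le_min (abs_nonneg _) zero_le_one
  obtain ⟨K, hKc, hK⟩ := hV.mono hT hvm
    (Eventually.of_forall fun x => by rw [abs_of_nonneg (hv0 x)]; exact min_le_left _ _)
  set a : ℕ → RSpace d := TopologicalSpace.denseSeq (RSpace d) with ha
  choose K' hKc' hKn' hK' using fun n => exists_compact_translate hKc hK (a n)
  have hsm : ∀ n, Measurable fun x => v (x - a n) := fun n => hvm.comp (measurable_id.sub_const _)
  have hsumm : Summable fun n : ℕ => (1 / 2 : ℝ) ^ n := summable_geometric_two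
  -- T(p) commutes with translations, so all translates have operators of norm at most ‖K‖ and can
  -- be summed with geometric weights. Truncating |V| at 1 makes the pointwise series converge as
  -- well.
  have hW := relFormCompact_of_hasSum (T := T) (v := fun n x => v (x - a n)) hsm
    (fun n x => hv0 _) (fun n x => min_le_right _ _) (fun n => by positivity) hsumm hKn' hKc'
    fun n f g φ ψ hf hg => by
      rw [hK' n f g φ ψ hf hg]
      simp_rw [abs_of_nonneg (hv0 _)]
  refine ⟨_, Measurable.tsum fun n => (hsm n).const_mul _, hW,
    fun x => tsum_nonneg fun n => mul_nonneg (by positivity) (hv0 _), ?_⟩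
  have hs : volume {x | 0 < v x} ≠ 0 := by
    intro h
    refine hne (?_ : volume {x | ¬ V x = 0} = 0)
    refine measure_mono_null (fun x hx => ?_) h
    exact lt_min (abs_pos.2 hx) one_pos
  filter_upwards [ae_exists_add_mem_of_denseRange (TopologicalSpace.denseRange_denseSeq (RSpace d))
    (measurableSet_lt measurable_const hvm) hs] with x ⟨n, hn⟩
  refine Summable.tsum_pos ?_ (fun n => mul_nonneg (by positivity) (hv0 _)) n
    (mul_pos (by positivity) hn)
  exact Summable.of_nonneg_of_le (fun n => mul_nonneg (by positivity) (hv0 _))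
    (fun n => mul_le_of_le_one_right (by positivity) (min_le_right _ _)) hsumm

/-- Every almost everywhere positive function dominates an almost everywhere positive function `U`
with small `∫ G₀(U)`, if `G₀` tends to `0` at `0`. -/
theorem exists_pos_lintegral_lt_one {G₀ : ℝ≥0∞ → ℝ≥0∞} (hlim : Tendsto G₀ (𝓝[>] 0) (𝓝 0))
    {W : RSpace d → ℝ} (hWm : Measurable W) (hW : ∀ᵐ x, 0 < W x) :
    ∃ U : RSpace d → ℝ, Measurable U ∧ (∀ᵐ x, 0 < U x ∧ U x ≤ W x) ∧
      ∫⁻ x, G₀ (ENNReal.ofReal (U x)) < 1 := by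
  obtain ⟨ε, hε0, hεm, hε1⟩ := exists_pos_lintegral_lt_of_sigmaFinite
    (volume : Measure (RSpace d)) one_ne_zero
  have hδ : ∀ n : ℕ, ∃ δ : ℝ, 0 < δ ∧ ∀ u : ℝ, 0 < u → u ≤ δ →
      G₀ (ENNReal.ofReal u) ≤ (n : ℝ≥0∞)⁻¹ := by
    intro n
    have h1 : ∀ᶠ u : ℝ≥0∞ in 𝓝[>] 0, G₀ u ≤ (n : ℝ≥0∞)⁻¹ :=
      hlim.eventually (ge_mem_nhds (by simp))
    have h2 : Tendsto ENNReal.ofReal (𝓝[>] (0 : ℝ)) (𝓝[>] 0) := by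
      refine tendsto_nhdsWithin_iff.2 ⟨?_, ?_⟩
      · have := ENNReal.continuous_ofReal.tendsto 0
        rw [ENNReal.ofReal_zero] at this
        exact this.mono_left nhdsWithin_le_nhds
      · filter_upwards [self_mem_nhdsWithin] with u hu
        exact ENNReal.ofReal_pos.2 hu
    obtain ⟨δ, hδ, h⟩ := mem_nhdsGT_iff_exists_Ioc_subset.1 (h2.eventually h1)
    exact ⟨δ, hδ, fun u hu hu' => h ⟨hu, hu'⟩⟩
  choose δ hδ0 hδ using hδ
  -- ε is a positive function with integral below 1, and δ n guarantees G₀ ≤ 1/n. Taking n ≥ 1/ε(x)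
  -- gives G₀(U x) ≤ ε(x).
  refine ⟨fun x => min (W x) (δ ⌈(ε x)⁻¹⌉₊), ?_, ?_, ?_⟩
  · exact hWm.min ((measurable_from_top (f := δ)).comp (Nat.measurable_ceil.comp hεm.inv))
  · filter_upwards [hW] with x hx
    exact ⟨lt_min hx (hδ0 _), min_le_left _ _⟩
  · refine (lintegral_mono_ae ?_).trans_lt hε1
    filter_upwards [hW] with x hx
    refine (hδ _ _ (lt_min hx (hδ0 _)) (min_le_right _ _)).trans ?_
    rw [ENNReal.inv_le_iff_inv_le, ← ENNReal.coe_inv (hε0 x).ne', ← ENNReal.coe_natCast,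
      ENNReal.coe_le_coe]
    exact Nat.le_ceil _

/-- A quantitative bound on the number of negative eigenvalues excludes that all nonpositive
potentials have negative eigenvalues. -/
theorem not_isQuantBound (hT : Measurable T)
    (hpot : ∃ V : RSpace d → ℝ, Measurable V ∧ NonTrivial V ∧ RelFormCompact T V)
    (h : ∀ V : RSpace d → ℝ, Measurable V → RelFormCompact T V → NonTrivial V →
        (∀ᵐ x, V x ≤ 0) → HasNegEigenvalue T V) (G₀ : ℝ≥0∞ → ℝ≥0∞) : ¬ IsQuantBound T G₀ := by
  rintro ⟨-, -, hlim, hbound⟩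
  obtain ⟨W, hWm, hWc, hW0, hW⟩ := exists_pos_relFormCompact hT hpot
  obtain ⟨U, hUm, hU, hU1⟩ := exists_pos_lintegral_lt_one hlim hWm hW
  -- U is positive almost everywhere, so the value G₀ 0, which is unrestricted, never enters the
  -- integral.
  have hUc : RelFormCompact T fun x => -U x := by
    refine hWc.mono hT hUm.neg ?_
    filter_upwards [hU] with x hx
    rw [abs_neg, abs_of_pos hx.1, abs_of_nonneg (hW0 x)]
    exact hx.2
  have hUne : NonTrivial fun x => -U x := by
    intro h0
    have : ∀ᵐ _ : RSpace d, False := by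
      filter_upwards [h0, hU] with x h1 h2
      exact h2.1.ne' (neg_eq_zero.1 h1)
    rw [eventually_false_iff_eq_bot, ae_eq_bot] at this
    exact NeZero.ne _ this
  have h1 := one_le_numNegEig (h _ hUm.neg hUc hUne (by
    filter_upwards [hU] with x hx
    exact neg_nonpos.2 hx.1.le))
  have h2 : ∫⁻ x, G₀ (ENNReal.ofReal (max 0 (-(-U x)))) = ∫⁻ x, G₀ (ENNReal.ofReal (U x)) := by
    refine lintegral_congr_ae ?_
    filter_upwards [hU] with x hx
    rw [neg_neg, max_eq_right hx.1.le]
  exact absurd (h1.trans ((hbound (fun x => -U x) hUm.neg hUc).trans_eq h2)) (not_le.2 hU1)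

end PositivePotential

/-! ### The main theorem -/

theorem theorem1p5 (d : ℕ) (T : RSpace d → ℝ≥0) (hT : Measurable T)
    (hZ : IsCompact (zeroSet T))
    (hfin : ∀ δ : ℝ, 0 < δ → ∃ u : ℝ≥0, 0 < u ∧
      intInv T ({η | T η < u} ∩ (Metric.cthickening δ (zeroSet T))ᶜ) < ∞)
    (hpot : ∃ V : RSpace d → ℝ, Measurable V ∧ NonTrivial V ∧ RelFormCompact T V) :
    -- divergence and weakly coupled bound states
    ((∃ δ : ℝ, 0 < δ ∧ intInv T (Metric.cthickening δ (zeroSet T)) = ∞) ↔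
      ∀ V : RSpace d → ℝ, Measurable V → RelFormCompact T V → NonTrivial V →
        (∀ᵐ x, V x ≤ 0) → HasNegEigenvalue T V) ∧
    -- the same for potentials without a fixed sign, if `T` is locally bounded
    ((∀ K : Set (RSpace d), IsCompact K → BddAbove (T '' K)) →
      ((∃ δ : ℝ, 0 < δ ∧ intInv T (Metric.cthickening δ (zeroSet T)) = ∞) ↔
        ∀ V : RSpace d → ℝ, Measurable V → Integrable V → RelFormCompact T V → NonTrivial V →
          (∫ x, V x) ≤ 0 → HasNegEigenvalue T V)) ∧
    -- convergence and quantitative bounds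
    ((∃ δ : ℝ, 0 < δ ∧ intInv T (Metric.cthickening δ (zeroSet T)) < ∞) ↔
      ∃ G₀ : ℝ≥0∞ → ℝ≥0∞, IsQuantBound T G₀) ∧
    -- the explicit choice of `G₀`
    ((∃ δ : ℝ, 0 < δ ∧ intInv T (Metric.cthickening δ (zeroSet T)) < ∞) →
      ∀ α : ℝ, 0 < α → α < 1 / 4 →
        IsQuantBound T (fun u =>
          ENNReal.ofReal (α ^ 2 / (1 - 4 * α) ^ 2) *
            bigG T (u / ENNReal.ofReal (α ^ 2)))) := by
  have hexpl : (∃ δ : ℝ, 0 < δ ∧ intInv T (Metric.cthickening δ (zeroSet T)) < ∞) →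
      ∀ α : ℝ, 0 < α → α < 1 / 4 →
        IsQuantBound T (fun u =>
          ENNReal.ofReal (α ^ 2 / (1 - 4 * α) ^ 2) *
            bigG T (u / ENNReal.ofReal (α ^ 2))) :=
    fun ⟨_, hδ, h⟩ _ hα hα' => isQuantBound_bigG hT hfin hδ h hα hα'
  -- Any α below 1/4 would do in place of 1/8. The explicit bound vanishes at 0, and the potential
  -- found is both nonpositive and integrable, so it serves both equivalences of (a).
  have hno : (∃ δ : ℝ, 0 < δ ∧ intInv T (Metric.cthickening δ (zeroSet T)) < ∞) →
      ∃ V : RSpace d → ℝ, Measurable V ∧ Integrable V ∧ RelFormCompact T V ∧ NonTrivial V ∧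
        (∀ x, V x ≤ 0) ∧ ¬ HasNegEigenvalue T V := fun h =>
    exists_no_negEigenvalue hT (hexpl h (1 / 8) (by norm_num) (by norm_num)) (by simp [bigG]) hpot
  have hinf : (¬ ∃ δ : ℝ, 0 < δ ∧ intInv T (Metric.cthickening δ (zeroSet T)) = ∞) →
      ∃ δ : ℝ, 0 < δ ∧ intInv T (Metric.cthickening δ (zeroSet T)) < ∞ := fun h =>
    ⟨1, one_pos, lt_top_iff_ne_top.2 fun h1 => h ⟨1, one_pos, h1⟩⟩
  have hball : (∃ δ : ℝ, 0 < δ ∧ intInv T (Metric.cthickening δ (zeroSet T)) = ∞) →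
      ∃ ξ₀ : RSpace d, ∀ r : ℝ, 0 < r →
        ∫⁻ ξ in Metric.ball ξ₀ r, (T ((2 * Real.pi) • ξ) : ℝ≥0∞)⁻¹ = ∞ := by
    rintro ⟨δ, -, h⟩
    obtain ⟨η₀, hη₀⟩ := exists_point_intInv_ball_eq_top hZ hfin h
    exact ⟨_, fun r hr => lintegral_inv_freqSymbol_ball hT hη₀ hr⟩
  have hweak : (∃ δ : ℝ, 0 < δ ∧ intInv T (Metric.cthickening δ (zeroSet T)) = ∞) →
      ∀ V : RSpace d → ℝ, Measurable V → RelFormCompact T V → NonTrivial V →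
        (∀ᵐ x, V x ≤ 0) → HasNegEigenvalue T V := fun h V hVm hV hne hle =>
    have ⟨_, hξ₀⟩ := hball h
    hasNegEigenvalue_of_nonpos hT hξ₀ hVm hV hne hle
  refine ⟨⟨hweak, fun h => ?_⟩, fun hloc => ⟨fun h V hVm hVi hV hne hle => ?_, fun h => ?_⟩,
    ⟨fun h => ⟨_, hexpl h (1 / 8) (by norm_num) (by norm_num)⟩, fun ⟨G₀, hG₀⟩ => ?_⟩, hexpl⟩
  · by_contra hcon
    obtain ⟨V, hVm, -, hV, hne, hle, hnot⟩ := hno (hinf hcon)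
    exact hnot (h V hVm hV hne (Eventually.of_forall hle))
  · obtain ⟨_, hξ₀⟩ := hball h
    exact hasNegEigenvalue_of_integral_nonpos hT hloc hξ₀ hVm hVi hV hne hle
  · by_contra hcon
    obtain ⟨V, hVm, hVi, hV, hne, hle, hnot⟩ := hno (hinf hcon)
    exact hnot (h V hVm hVi hV hne (integral_nonpos hle))
  -- If (2) fails, the integral already diverges for δ = 1, so all nontrivial nonpositive potentials
  -- bind, which no quantitative bound allows.
  · by_contra hcon
    refine not_isQuantBound hT hpot (hweak ⟨1, one_pos, ?_⟩) G₀ hG₀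
    by_contra h1
    exact hcon ⟨1, one_pos, lt_top_iff_ne_top.2 h1⟩
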